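/- Consider the focusing modified Korteweg--de Vries equation $$\partial_t u+\partial_x^3u=-6u^2\,\partial_x u \qquad\text{(mKdV)}$$ for real-valued $u$ on $\mathbb{R}_t\times\mathbb{R}_x$. By a Schwartz solution we mean a curve $t\mapsto u(t)$, defined for all $t\in\mathbb{R}$ and continuous with values in the Schwartz space $\mathcal{S}(\mathbb{R})$, that satisfies (mKdV) at every $(t,x)\in\mathbb{R}\times\mathbb{R}$. For $1\le p<\infty$, $s\in\mathbb{R}$ and a Schwartz function $f$ put $$\|f\|_{\mathcal{F}L^p_s(\mathbb{R})}:=\bigl\|\langle\xi\rangle^s\,\widehat f(\xi)\bigr\|_{L^p_\xi(\mathbb{R})},\qquad \widehat f(\xi):=\tfrac1{\sqrt{2\pi}}\int_{\mathbb{R}}e^{-ix\xi}f(x)\,dx,\qquad \langle\xi\rangle:=(1+\xi^2)^{1/2}.$$ **Theorem.** For each $1\le p<\infty$ with $p\neq2$ and each $s\in\mathbb{R}$, there is a sequence of Schwartz solutions $u_n(t)$ to (mKdV) such that $$\lim_{n\to\infty}\|u_n(0)\|_{\mathcal{F}L^p_s(\mathbb{R})}=0\qquad\text{and}\qquad \lim_{n\to\infty}\,\sup_{t\in\mathbb{R}}\|u_n(t)\|_{\mathcal{F}L^p_s(\mathbb{R})}=\infty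 .$$ -/

import Mathlib

open scoped SchwartzMap ENNReal Topology
open MeasureTheory Filter

/-- The Fourier transform of a real-valued function on the line, normalized as
`(2π)^{-1/2} ∫ e^{-ixξ} f(x) dx`. -/
noncomputable def fourierHat (f : ℝ → ℝ) (ξ : ℝ) : ℂ :=
  ((Real.sqrt (2 * Real.pi) : ℝ) : ℂ)⁻¹ *
    ∫ x : ℝ, Complex.exp (-(Complex.I * (x : ℂ) * (ξ : ℂ))) * (f x : ℂ)

/-- The Japanese bracket `⟨ξ⟩ = (1 + ξ²)^{1/2}`. -/
noncomputable def japaneseBracket (ξ : ℝ) : ℝ := Real.sqrt (1 + ξ ^ 2)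

/-- The Fourier–Lebesgue norm `‖ ⟨ξ⟩^s f̂(ξ) ‖_{L^p}` of a real-valued Schwartz function, as an
extended nonnegative real (so that suprema of such norms carry no junk values). -/
noncomputable def fourierLebesgueNorm (p s : ℝ) (f : 𝓢(ℝ, ℝ)) : ℝ≥0∞ :=
  eLpNorm (fun ξ : ℝ => ((japaneseBracket ξ ^ s : ℝ) : ℂ) * fourierHat f ξ)
    (ENNReal.ofReal p) volume

/-- A global Schwartz solution of the focusing mKdV equation `u_t + u_xxx = -6 u² u_x` on the line:
a curve `t ↦ u(t)`, defined for all real times, which is continuous for the Schwartz topology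
and satisfies the equation at every point of space-time. (The right-hand side
`-u_xxx - 6 u² u_x` is then a continuous curve in Schwartz space as well, so that `u` is in fact
a smooth curve in Schwartz space, in particular smooth jointly in `(t, x)`.) -/
structure IsSchwartzSolutionMKdV (u : ℝ → 𝓢(ℝ, ℝ)) : Prop where
  continuous : Continuous u
  equation : ∀ t x : ℝ,
    HasDerivAt (fun τ : ℝ => u τ x)
      (-iteratedDeriv 3 (u t) x - 6 * (u t x) ^ 2 * deriv (u t) x) t

open scoped ComplexConjugate
open Complex (I)

/-! The mechanism is loss of coherence. The datum `μ N sech (μ x)` is an exact `N`-soliton, and its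
transform is `N` times a fixed profile at frequency scale `μ`, so its weighted `p`-th moment is
comparable to `μ N^p`. As `t → ∞` it splits into solitons of amplitudes `κ j = μ (2j + 1)`
travelling at speeds `κ j ^ 2`. The transform then becomes a sum of `N` profiles at scales up to `2
μ N` with phases that drift apart. Square-root cancellation suggests height `N^(1/2)`, hence a
`p`-th moment near `μ N^(1 + p/2)`. The two sizes agree only at `p = 2`. For `p < 2` the norm grows
as the train separates. For `p > 2` it shrinks, so time is translated to start from the separated
train and the growth is seen at the moment of recombination. Choosing `μ` as a suitable negative
power of `N` makes the small norm tend to `0` and the large one to infinity. Since every scale stays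
below `2`, the weight `⟨ξ⟩^s` costs only constants.

Cancellation is made rigorous through the second and fourth moments alone. By Riemann–Lebesgue only
resonant products survive as `t → ∞`: the diagonal for the second moment, giving order `μ N^2`, and
the solutions of `κ a ^ 2 - κ b ^ 2 + κ c ^ 2 - κ d ^ 2 = 0` for the fourth. A divisor count
(`card_resonances_le`) bounds the latter by a multiple of `N^(5/2)`, so the fourth moment is at most
of order `μ N^(7/2)`. This is weaker than the heuristic but enough: splitting at height about
`N^(3/4)` gives a power gain in `exists_trainHat_moment_ge` and `exists_trainHat_moment_le`.

The exact solutions come from the linear system `(1 + i M) φ = v` with `M i j = v i v j / (k i + k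
j)`, and `u = 2 ∑ ‖φ i‖ ^ 2`. The rank-one displacement structure of `M` yields `φ' = i u φ - k φ̄`,
from which the equation (`multisoliton_mkdv`), the decay of all derivatives, and the late-time
splitting (`exists_tendsto_sum_solitons`) follow. That the profile `μ N sech (μ x)` arises from this
system (`multisoliton_sech`) is proved with Jost polynomials generated by Darboux steps. -/

/-- The quadratic form of the Cauchy matrix `1 / (k i + k j)`. -/
noncomputable def cauchyForm {ι : Type*} [Fintype ι] (k c : ι → ℝ) : ℝ :=
  ∑ i, ∑ j, c i * c j / (k i + k j)

/-! ### Positivity and inversion of Cauchy matrices. -/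

section Cauchy

variable {ι : Type*} [Fintype ι]

/-- Sampling at the positive integers turns the hypothesis into a Vandermonde system with distinct
nodes `exp (-k i)`. The sample points start at `1`, so one factor `exp (-k i)` is absorbed into the
coefficients. -/
lemma exp_sum_eq_zero {k : ι → ℝ} (hk : Function.Injective k) {c : ι → ℝ}
    (h : ∀ x : ℝ, 0 < x → ∑ i, c i * Real.exp (-k i * x) = 0) : c = 0 := by
  classical
  let e := (Fintype.equivFin ι).symm
  have hinj : Function.Injective (fun i => Real.exp (-k (e i))) := by
    intro i j hij
    have := Real.exp_injective hij
    exact e.injective (hk (neg_injective this))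
  have key : (fun i => c (e i) * Real.exp (-k (e i))) = 0 := by
    refine Matrix.eq_zero_of_forall_pow_sum_mul_pow_eq_zero hinj fun m => ?_
    have := h ((m : ℕ) + 1) (by positivity)
    rw [← Equiv.sum_comp e] at this
    rw [← this]
    refine Finset.sum_congr rfl fun i _ => ?_
    rw [← Real.exp_nat_mul, mul_assoc, ← Real.exp_add]
    congr 2; ring
  funext i
  have h2 := congrFun key (e.symm i)
  simp only [Equiv.apply_symm_apply, Pi.zero_apply, mul_eq_zero, Real.exp_ne_zero, or_false] at h2
  exact h2

lemma integral_exp_neg_mul_Ioi' {a : ℝ} (ha : 0 < a) :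
    ∫ x in Set.Ioi (0 : ℝ), Real.exp (-a * x) = 1 / a := by
  have := integral_exp_mul_Ioi (a := -a) (by linarith) 0
  rw [this]; simp

/-- The Cauchy matrix is the Gram matrix of the exponentials `exp (-k i x)` in `L²(0, ∞)`. -/
lemma cauchyForm_eq_integral {k : ι → ℝ} (hk : ∀ i, 0 < k i) (c : ι → ℝ) :
    IntegrableOn (fun x => (∑ i, c i * Real.exp (-k i * x)) ^ 2) (Set.Ioi 0) ∧
    cauchyForm k c = ∫ x in Set.Ioi (0 : ℝ), (∑ i, c i * Real.exp (-k i * x)) ^ 2 := by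
  have hexp : ∀ x : ℝ, (∑ i, c i * Real.exp (-k i * x)) ^ 2
      = ∑ i, ∑ j, c i * c j * Real.exp (-(k i + k j) * x) := by
    intro x
    rw [sq, Finset.sum_mul_sum]
    refine Finset.sum_congr rfl fun i _ => Finset.sum_congr rfl fun j _ => ?_
    rw [show -(k i + k j) * x = -k i * x + -k j * x by ring, Real.exp_add]; ring
  have hint : ∀ i j, IntegrableOn (fun x => c i * c j * Real.exp (-(k i + k j) * x))
      (Set.Ioi (0 : ℝ)) := fun i j =>
    (integrableOn_exp_mul_Ioi (by linarith [hk i, hk j]) 0).const_mul _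
  simp only [hexp]
  refine ⟨integrable_finsetSum _ fun i _ => integrable_finsetSum _ fun j _ => hint i j, ?_⟩
  rw [integral_finsetSum _ fun i _ => integrable_finsetSum _ fun j _ => hint i j]
  refine Finset.sum_congr rfl fun i _ => ?_
  rw [integral_finsetSum _ fun j _ => hint i j]
  refine Finset.sum_congr rfl fun j _ => ?_
  rw [integral_const_mul, integral_exp_neg_mul_Ioi' (by linarith [hk i, hk j])]
  ring

lemma cauchyForm_pos {k : ι → ℝ} (hk : ∀ i, 0 < k i) (hinj : Function.Injective k) {c : ι → ℝ}
    (hc : c ≠ 0) : 0 < cauchyForm k c := by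
  obtain ⟨hint, heq⟩ := cauchyForm_eq_integral hk c
  have hnn : 0 ≤ cauchyForm k c := by
    rw [heq]; exact integral_nonneg fun x => sq_nonneg _
  refine lt_of_le_of_ne hnn fun h0 => hc ?_
  rw [heq, eq_comm, integral_eq_zero_iff_of_nonneg (fun x => sq_nonneg _) hint] at h0
  have hcont : Continuous fun x : ℝ => (∑ i, c i * Real.exp (-k i * x)) ^ 2 := by fun_prop
  have := Measure.eqOn_open_of_ae_eq h0 isOpen_Ioi hcont.continuousOn continuousOn_const
  exact exp_sum_eq_zero hinj fun x hx => by simpa using this hx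

/-- Positivity becomes coercivity by compactness of the unit sphere and homogeneity. The constant
depends on `k` only, which later makes the soliton bounds uniform in time and space. -/
lemma exists_cauchyForm_lower {k : ι → ℝ} (hk : ∀ i, 0 < k i) (hinj : Function.Injective k) :
    ∃ δ > 0, ∀ c : ι → ℝ, δ * ∑ i, c i ^ 2 ≤ cauchyForm k c := by
  rcases isEmpty_or_nonempty ι with hι | hι
  · exact ⟨1, one_pos, fun c => by simp [cauchyForm]⟩
  let S : Set (ι → ℝ) := {c | ∑ i, c i ^ 2 = 1}
  have hS : IsCompact S := by
    refine Metric.isCompact_of_isClosed_isBounded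
      (isClosed_eq (by fun_prop) continuous_const) ?_
    refine (Metric.isBounded_iff_subset_closedBall 0).2 ⟨1, fun c hc => ?_⟩
    rw [mem_closedBall_zero_iff, pi_norm_le_iff_of_nonneg zero_le_one]
    intro i
    have h1 : c i ^ 2 ≤ 1 := by
      rw [← (show ∑ i, c i ^ 2 = 1 from hc)]
      exact Finset.single_le_sum (f := fun i => c i ^ 2) (fun i _ => sq_nonneg _)
        (Finset.mem_univ i)
    rw [Real.norm_eq_abs]
    exact abs_le_one_iff_mul_self_le_one.2 (by nlinarith)
  have hne : S.Nonempty := by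
    classical
    obtain ⟨i⟩ := hι
    exact ⟨Pi.single i 1, by simp [S, Pi.single_apply, Finset.sum_ite_eq']⟩
  have hcont : Continuous (cauchyForm k) := by
    unfold cauchyForm; fun_prop
  obtain ⟨c0, hc0, hmin⟩ := hS.exists_isMinOn hne hcont.continuousOn
  have hpos : 0 < cauchyForm k c0 := cauchyForm_pos hk hinj (by
    rintro rfl
    simp [S] at hc0)
  refine ⟨_, hpos, fun c => ?_⟩
  by_cases hc : c = 0
  · subst hc; simp [cauchyForm]
  have hs : 0 < ∑ i, c i ^ 2 := by
    refine lt_of_le_of_ne (Finset.sum_nonneg fun i _ => sq_nonneg _) fun h => hc ?_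
    rw [eq_comm, Finset.sum_eq_zero_iff_of_nonneg (fun i _ => sq_nonneg _)] at h
    funext i
    simpa using h i (Finset.mem_univ i)
  set r := Real.sqrt (∑ i, c i ^ 2) with hr
  have hr0 : 0 < r := Real.sqrt_pos.2 hs
  have hr2 : r ^ 2 = ∑ i, c i ^ 2 := Real.sq_sqrt hs.le
  have hmem : (fun i => c i / r) ∈ S := by
    simp only [S, Set.mem_ofPred_eq, div_pow, ← Finset.sum_div, ← hr2]
    field_simp
  have h1 := hmin hmem
  have h2 : cauchyForm k (fun i => c i / r) = cauchyForm k c / r ^ 2 := by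
    simp only [cauchyForm, Finset.sum_div]
    refine Finset.sum_congr rfl fun i _ => Finset.sum_congr rfl fun j _ => ?_
    field_simp
  simp only [Set.mem_ofPred_eq, h2] at h1
  rwa [le_div_iff₀ (by positivity), hr2] at h1

lemma exists_cauchy_dual [DecidableEq ι] {k : ι → ℝ} (hk : ∀ i, 0 < k i)
    (hinj : Function.Injective k) (j : ι) :
    ∃ w : ι → ℝ, ∀ m, ∑ i, w i / (k i + k m) = if m = j then 1 else 0 := by
  let T : (ι → ℝ) →ₗ[ℝ] (ι → ℝ) :=
    { toFun := fun w m => ∑ i, w i / (k i + k m)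
      map_add' := fun a b => by
        funext m; simp [add_div, Finset.sum_add_distrib]
      map_smul' := fun r a => by
        funext m; simp [mul_div_assoc, Finset.mul_sum] }
  have hT : Function.Injective T := by
    rw [← LinearMap.ker_eq_bot, LinearMap.ker_eq_bot']
    intro c hc
    by_contra hne
    have := cauchyForm_pos hk hinj hne
    have h0 : cauchyForm k c = ∑ j, c j * T c j := by
      simp only [cauchyForm, T, LinearMap.coe_mk, AddHom.coe_mk, Finset.mul_sum]
      rw [Finset.sum_comm]
      refine Finset.sum_congr rfl fun i _ => Finset.sum_congr rfl fun j _ => ?_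
      ring
    rw [h0, hc] at this
    simp at this
  obtain ⟨w, hw⟩ := (LinearMap.injective_iff_surjective.1 hT) (fun m => if m = j then 1 else 0)
  exact ⟨w, fun m => congrFun hw m⟩

/-- The two moments of the dual vector are linked by the displacement structure of the Cauchy
matrix. -/
lemma cauchy_dual_moment [DecidableEq ι] {k : ι → ℝ} (hk : ∀ i, 0 < k i) {j : ι} {w : ι → ℝ}
    (hw : ∀ m, ∑ i, w i / (k i + k m) = if m = j then 1 else 0) :
    2 * k j * w j = (∑ i, w i) ^ 2 := by
  -- Insert `1 = (k i + k m) / (k i + k m)` in each product; by symmetry the two halves are equal,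
  -- and duality collapses each to `k j * w j`.
  have h1 : (∑ i, w i) ^ 2 = ∑ m, ∑ i, (w i * w m * k i / (k i + k m)
      + w i * w m * k m / (k i + k m)) := by
    rw [sq, Finset.sum_mul_sum, Finset.sum_comm]
    refine Finset.sum_congr rfl fun m _ => Finset.sum_congr rfl fun i _ => ?_
    have := (add_pos (hk i) (hk m)).ne'
    field_simp
  have h2 : ∑ m, ∑ i, w i * w m * k m / (k i + k m) = k j * w j := by
    have : ∀ m, ∑ i, w i * w m * k m / (k i + k m) = w m * k m * (if m = j then 1 else 0) := by
      intro m
      rw [← hw m, Finset.mul_sum]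
      refine Finset.sum_congr rfl fun i _ => ?_
      ring
    simp only [this]
    simp [mul_comm]
  have h3 : ∑ m, ∑ i, w i * w m * k i / (k i + k m) = k j * w j := by
    rw [← h2, Finset.sum_comm]
    refine Finset.sum_congr rfl fun m _ => Finset.sum_congr rfl fun i _ => ?_
    rw [add_comm (k i)]; ring
  simp only [h1, Finset.sum_add_distrib, h2, h3]; ring

/-- The entry `w j` is the value of the positive definite form at `w`. -/
lemma cauchy_dual_pos [DecidableEq ι] {k : ι → ℝ} (hk : ∀ i, 0 < k i)
    (hinj : Function.Injective k) {j : ι} {w : ι → ℝ}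
    (hw : ∀ m, ∑ i, w i / (k i + k m) = if m = j then 1 else 0) : 0 < w j := by
  have hne : w ≠ 0 := by
    rintro rfl
    have := hw j
    simp at this
  have := cauchyForm_pos hk hinj hne
  have h0 : cauchyForm k w = w j := by
    have : ∀ m, ∑ i, w i * w m / (k i + k m) = w m * (if m = j then 1 else 0) := by
      intro m
      rw [← hw m, Finset.mul_sum]
      refine Finset.sum_congr rfl fun i _ => ?_
      ring
    rw [cauchyForm, Finset.sum_comm]
    simp [this]
  linarith

end Cauchy

/-! ### Algebra of the soliton system. -/

/-- The kernel `v i v j / (k i + k j)` of the multisoliton with norming exponentials `v`. -/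
noncomputable def solitonKernel {ι : Type*} (k v : ι → ℝ) (i j : ι) : ℂ :=
  ((v i * v j / (k i + k j) : ℝ) : ℂ)

/-- The linear system `(1 + i M) φ = v` whose solution gives the multisoliton. -/
def SolitonSystem {ι : Type*} [Fintype ι] (k v : ι → ℝ) (φ : ι → ℂ) : Prop :=
  ∀ i, φ i + I * ∑ j, solitonKernel k v i j * φ j = v i

section System

lemma solitonKernel_symm {ι : Type*} (k v : ι → ℝ) (i j : ι) :
    solitonKernel k v i j = solitonKernel k v j i := by
  unfold solitonKernel; rw [mul_comm (v i), add_comm (k i)]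

lemma conj_solitonKernel {ι : Type*} (k v : ι → ℝ) (i j : ι) :
    conj (solitonKernel k v i j) = solitonKernel k v i j := Complex.conj_ofReal _

variable {ι : Type*} [Fintype ι]

/-- The matrix is real symmetric, so the cross terms between real and imaginary parts cancel. -/
lemma hermitian_cauchyForm (k : ι → ℝ) (a : ι → ℂ) :
    ∑ i, ∑ j, conj (a i) * a j / ((k i + k j : ℝ) : ℂ)
      = ((cauchyForm k (fun i => (a i).re) + cauchyForm k (fun i => (a i).im) : ℝ) : ℂ) := by
  have hterm : ∀ i j, conj (a i) * a j / ((k i + k j : ℝ) : ℂ)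
      = (((a i).re * (a j).re / (k i + k j) + (a i).im * (a j).im / (k i + k j) : ℝ) : ℂ)
        + I * (((a i).re * (a j).im / (k i + k j) : ℝ) - ((a i).im * (a j).re / (k i + k j) : ℝ)) := by
    intro i j
    have h1 : conj (a i) * a j = (((a i).re * (a j).re + (a i).im * (a j).im : ℝ) : ℂ)
        + I * (((a i).re * (a j).im - (a i).im * (a j).re : ℝ) : ℂ) := by
      apply Complex.ext <;> simp <;> ring
    rw [h1]; push_cast; ring
  simp only [hterm, Finset.sum_add_distrib, ← Finset.mul_sum, Finset.sum_sub_distrib]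
  have h2 : ∑ i, ∑ j, (((a i).im * (a j).re / (k i + k j) : ℝ) : ℂ)
      = ∑ i, ∑ j, (((a i).re * (a j).im / (k i + k j) : ℝ) : ℂ) := by
    rw [Finset.sum_comm]
    refine Finset.sum_congr rfl fun i _ => Finset.sum_congr rfl fun j _ => ?_
    rw [add_comm (k j), mul_comm]
  rw [h2]
  simp [cauchyForm, Finset.sum_add_distrib]

lemma kernel_form_eq (k v : ι → ℝ) (φ : ι → ℂ) :
    ∑ i, conj (φ i) * ∑ j, solitonKernel k v i j * φ j
      = ((cauchyForm k (fun i => (v i * φ i).re) + cauchyForm k (fun i => (v i * φ i).im) : ℝ) : ℂ)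
      := by
  rw [← hermitian_cauchyForm]
  refine Finset.sum_congr rfl fun i _ => ?_
  rw [Finset.mul_sum]
  refine Finset.sum_congr rfl fun j _ => ?_
  simp only [solitonKernel, map_mul, Complex.conj_ofReal]
  push_cast; ring

lemma sum_conj_mul_self (φ : ι → ℂ) :
    ∑ i, conj (φ i) * φ i = ((∑ i, ‖φ i‖ ^ 2 : ℝ) : ℂ) := by
  push_cast
  refine Finset.sum_congr rfl fun i _ => ?_
  rw [mul_comm, Complex.mul_conj']

/-- Pairing with `φ̄` gives `∑ ‖φ i‖ ^ 2` plus `i` times a real number; the real part forces `φ =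
0`. Only symmetry of `M` enters, not its positivity. -/
lemma solitonSystem_injective {k v : ι → ℝ} {φ : ι → ℂ}
    (h : ∀ i, φ i + I * ∑ j, solitonKernel k v i j * φ j = 0) : φ = 0 := by
  have h1 : ∑ i, conj (φ i) * (φ i + I * ∑ j, solitonKernel k v i j * φ j) = 0 :=
    Finset.sum_eq_zero fun i _ => by rw [h i, mul_zero]
  have h2 : ∑ i, conj (φ i) * (φ i + I * ∑ j, solitonKernel k v i j * φ j)
      = ∑ i, conj (φ i) * φ i + I * ∑ i, conj (φ i) * ∑ j, solitonKernel k v i j * φ j := by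
    rw [Finset.mul_sum, ← Finset.sum_add_distrib]
    refine Finset.sum_congr rfl fun i _ => ?_
    ring
  rw [h2, kernel_form_eq, sum_conj_mul_self] at h1
  have h3 := congrArg Complex.re h1
  simp only [Complex.add_re, Complex.ofReal_re, Complex.re_mul_ofReal, Complex.I_re, zero_mul,
    add_zero, Complex.zero_re] at h3
  rw [Finset.sum_eq_zero_iff_of_nonneg (fun i _ => sq_nonneg _)] at h3
  funext i
  simpa using h3 i (Finset.mem_univ i)

lemma SolitonSystem.unique {k v : ι → ℝ} {φ ψ : ι → ℂ} (hφ : SolitonSystem k v φ)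
    (hψ : SolitonSystem k v ψ) : φ = ψ := by
  have : φ - ψ = 0 := solitonSystem_injective (k := k) (v := v) fun i => by
    have h1 := hφ i
    have h2 := hψ i
    simp only [Pi.sub_apply, mul_sub, Finset.sum_sub_distrib]
    linear_combination h1 - h2
  exact sub_eq_zero.1 this

/-- The same pairing with the right-hand side kept. Its real part makes the density `∑ ‖φ i‖ ^ 2`
linear in `φ`; its imaginary part is the identity behind the uniform bounds. -/
lemma SolitonSystem.conj_sum {k v : ι → ℝ} {φ : ι → ℂ} (h : SolitonSystem k v φ) :
    conj (∑ i, v i * φ i) = ((∑ i, ‖φ i‖ ^ 2 : ℝ) : ℂ)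
      + I * ((cauchyForm k (fun i => (v i * φ i).re)
        + cauchyForm k (fun i => (v i * φ i).im) : ℝ) : ℂ) := by
  rw [← kernel_form_eq, ← sum_conj_mul_self, Finset.mul_sum, ← Finset.sum_add_distrib, map_sum]
  refine Finset.sum_congr rfl fun i _ => ?_
  have := h i
  rw [map_mul, Complex.conj_ofReal]
  linear_combination (-conj (φ i)) * this

lemma SolitonSystem.re_sum {k v : ι → ℝ} {φ : ι → ℂ} (h : SolitonSystem k v φ) :
    (∑ i, v i * φ i).re = ∑ i, ‖φ i‖ ^ 2 := by
  have := congrArg Complex.re h.conj_sum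
  rw [Complex.conj_re] at this
  rw [this]
  simp only [Complex.add_re, Complex.ofReal_re, Complex.re_mul_ofReal, Complex.I_re, zero_mul,
    add_zero]

lemma SolitonSystem.im_sum {k v : ι → ℝ} {φ : ι → ℂ} (h : SolitonSystem k v φ) :
    cauchyForm k (fun i => (v i * φ i).re) + cauchyForm k (fun i => (v i * φ i).im)
      = -(∑ i, v i * φ i).im := by
  have := congrArg Complex.im h.conj_sum
  rw [Complex.conj_im] at this
  rw [this]
  simp only [Complex.add_im, Complex.ofReal_im, Complex.im_mul_ofReal, Complex.I_im, one_mul,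
    zero_add]

/-- The linear equation obtained by differentiating the soliton system along `v' = ω v`. -/
def DerivSystem (k v ω : ι → ℝ) (φ φ' : ι → ℂ) : Prop :=
  ∀ i, φ' i + I * ∑ j, ((ω i + ω j) * solitonKernel k v i j * φ j + solitonKernel k v i j * φ' j)
    = ω i * v i

/-- Pairing the differentiated system with `φ` and using symmetry of the kernel to move it from `φ'`
back onto `φ` eliminates `φ'`: the flow of `∑ v i φ i` depends on `φ` alone. -/
lemma SolitonSystem.sum_deriv {k v ω : ι → ℝ} {φ φ' : ι → ℂ} (h : SolitonSystem k v φ)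
    (h' : DerivSystem k v ω φ φ') :
    ∑ i, (ω i * v i * φ i + v i * φ' i) = ∑ i, 2 * ω i * φ i ^ 2 := by
  have hS : ∀ i, I * ∑ j, solitonKernel k v i j * φ j = v i - φ i := fun i => by
    rw [← h i]; ring
  have e1 : ∑ i, φ i * (φ' i + I * ∑ j, ((ω i + ω j) * solitonKernel k v i j * φ j
      + solitonKernel k v i j * φ' j)) = ∑ i, φ i * (ω i * v i) :=
    Finset.sum_congr rfl fun i _ => by rw [h' i]
  have e2 : ∑ i, φ i * (φ' i + I * ∑ j, ((ω i + ω j) * solitonKernel k v i j * φ j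
      + solitonKernel k v i j * φ' j))
      = ∑ i, φ i * φ' i + ∑ i, ω i * φ i * (I * ∑ j, solitonKernel k v i j * φ j)
        + I * ∑ i, ∑ j, φ i * (ω j * solitonKernel k v i j * φ j)
        + I * ∑ i, ∑ j, φ i * (solitonKernel k v i j * φ' j) := by
    simp only [Finset.mul_sum]
    rw [← Finset.sum_add_distrib, ← Finset.sum_add_distrib, ← Finset.sum_add_distrib]
    refine Finset.sum_congr rfl fun i _ => ?_
    rw [mul_add, Finset.mul_sum, add_assoc, add_assoc, ← Finset.sum_add_distrib,
      ← Finset.sum_add_distrib]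
    congr 1
    refine Finset.sum_congr rfl fun j _ => ?_
    ring
  have e3 : I * ∑ i, ∑ j, φ i * (ω j * solitonKernel k v i j * φ j)
      = ∑ j, ω j * φ j * (I * ∑ i, solitonKernel k v j i * φ i) := by
    rw [Finset.sum_comm, Finset.mul_sum]
    refine Finset.sum_congr rfl fun j _ => ?_
    rw [Finset.mul_sum, Finset.mul_sum, Finset.mul_sum]
    refine Finset.sum_congr rfl fun i _ => ?_
    rw [solitonKernel_symm k v i j]; ring
  have e4 : I * ∑ i, ∑ j, φ i * (solitonKernel k v i j * φ' j)
      = ∑ j, φ' j * (I * ∑ i, solitonKernel k v j i * φ i) := by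
    rw [Finset.sum_comm, Finset.mul_sum]
    refine Finset.sum_congr rfl fun j _ => ?_
    rw [Finset.mul_sum, Finset.mul_sum, Finset.mul_sum]
    refine Finset.sum_congr rfl fun i _ => ?_
    rw [solitonKernel_symm k v i j]; ring
  rw [e2, e3, e4] at e1
  simp only [hS] at e1
  rw [← sub_eq_zero] at e1 ⊢
  rw [← e1]
  simp only [← Finset.sum_add_distrib, ← Finset.sum_sub_distrib]
  refine Finset.sum_congr rfl fun i _ => ?_
  ring

lemma DerivSystem.unique {k v ω : ι → ℝ} {φ φ' ψ' : ι → ℂ} (h : DerivSystem k v ω φ φ')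
    (h' : DerivSystem k v ω φ ψ') : φ' = ψ' := by
  have : φ' - ψ' = 0 := solitonSystem_injective (k := k) (v := v) fun i => by
    have h1 := h i
    have h2 := h' i
    simp only [Finset.sum_add_distrib] at h1 h2
    simp only [Pi.sub_apply, mul_sub, Finset.sum_sub_distrib]
    linear_combination h1 - h2
  exact sub_eq_zero.1 this

/-- The closed equation satisfied by the spatial derivative of the soliton vector. -/
lemma SolitonSystem.derivSystem {k v : ι → ℝ} (hk : ∀ i, 0 < k i) {φ : ι → ℂ}
    (h : SolitonSystem k v φ) :
    DerivSystem k v (fun i => -k i) φ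
      (fun i => I * ((2 * ∑ j, ‖φ j‖ ^ 2 : ℝ) : ℂ) * φ i - k i * conj (φ i)) := by
  intro i
  set q : ℂ := ∑ j, v j * φ j with hq
  have hu : ((2 * ∑ j, ‖φ j‖ ^ 2 : ℝ) : ℂ) = q + conj q := by
    rw [Complex.add_conj, h.re_sum]
  rw [hu]
  have hS : I * ∑ j, solitonKernel k v i j * φ j = v i - φ i := by
    rw [← h i]; ring
  have hSc : I * ∑ j, solitonKernel k v i j * conj (φ j) = conj (φ i) - v i := by
    have := congrArg conj hS
    simp only [map_mul, map_sum, conj_solitonKernel, map_sub, Complex.conj_ofReal,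
      Complex.conj_I] at this
    linear_combination -this
  have hkk : ∀ j, (k i : ℂ) + k j ≠ 0 := fun j => by
    exact_mod_cast (add_pos (hk i) (hk j)).ne'
  -- The displacement identity: differentiating `M` in space produces a rank-one matrix, and so the
  -- equation closes up with `q = ∑ v j φ j` and its conjugate.
  have hM : ∀ j, ((k i : ℂ) + k j) * solitonKernel k v i j = v i * v j := fun j => by
    have := hkk j
    simp only [solitonKernel]; push_cast; field_simp
  have hterm : ∀ j, (((-k i : ℝ) : ℂ) + ((-k j : ℝ) : ℂ)) * solitonKernel k v i j * φ j
      + solitonKernel k v i j * (I * (q + conj q) * φ j - k j * conj (φ j))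
      = -(v i * (v j * φ j)) + I * (q + conj q) * (solitonKernel k v i j * φ j)
        - v i * conj (v j * φ j) + k i * (solitonKernel k v i j * conj (φ j)) := by
    intro j
    have := hM j
    push_cast
    rw [map_mul, Complex.conj_ofReal]
    linear_combination (-(φ j) - conj (φ j)) * this
  rw [Finset.sum_congr rfl fun j _ => hterm j]
  simp only [Finset.sum_add_distrib, Finset.sum_sub_distrib, Finset.sum_neg_distrib,
    ← Finset.mul_sum, ← map_sum]
  rw [← hq]
  push_cast
  linear_combination I * (q + conj q) * hS + k i * hSc

/-- The conserved quantity of the spatial flow. -/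
lemma SolitonSystem.im_sum_sq {k v : ι → ℝ} (hk : ∀ i, 0 < k i) {φ : ι → ℂ}
    (h : SolitonSystem k v φ) :
    (∑ i, k i * φ i ^ 2).im = -(∑ i, ‖φ i‖ ^ 2) ^ 2 := by
  -- The derivative of `∑ v i φ i` is computed in two ways, directly from the closed equation and by
  -- `sum_deriv`; the imaginary parts are compared.
  have h1 := h.sum_deriv (h.derivSystem hk)
  have h2 := congrArg Complex.im h1
  have h3 : ∑ i, 2 * ((-k i : ℝ) : ℂ) * φ i ^ 2 = ((-2 : ℝ) : ℂ) * ∑ i, k i * φ i ^ 2 := by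
    rw [Finset.mul_sum]
    refine Finset.sum_congr rfl fun i _ => ?_
    push_cast; ring
  have h4 : ∑ i, (((-k i : ℝ) : ℂ) * v i * φ i
      + v i * (I * ((2 * ∑ j, ‖φ j‖ ^ 2 : ℝ) : ℂ) * φ i - k i * conj (φ i)))
      = ((2 * ∑ j, ‖φ j‖ ^ 2 : ℝ) : ℂ) * (I * ∑ i, v i * φ i)
        - ((∑ i, 2 * k i * v i * (φ i).re : ℝ) : ℂ) := by
    generalize (2 * ∑ j, ‖φ j‖ ^ 2 : ℝ) = U
    rw [Finset.mul_sum, Finset.mul_sum, Complex.ofReal_sum, ← Finset.sum_sub_distrib]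
    refine Finset.sum_congr rfl fun i _ => ?_
    have : (2 * ((φ i).re : ℂ)) = φ i + conj (φ i) := by rw [Complex.add_conj]; push_cast; ring
    push_cast
    linear_combination (k i : ℂ) * v i * this
  rw [h3, h4, Complex.im_ofReal_mul, Complex.sub_im, Complex.ofReal_im, Complex.im_ofReal_mul,
    Complex.I_mul_im, h.re_sum] at h2
  linarith

end System

/-! ### Cramer's rule: smooth dependence and differentiation of the solution. -/

section Vector

variable {ι : Type*} [Fintype ι] [DecidableEq ι]

/-- The matrix `1 + i M`. -/
noncomputable def solitonMatrix (k v : ι → ℝ) : Matrix ι ι ℂ :=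
  fun i j => (if i = j then 1 else 0) + I * solitonKernel k v i j

/-- The solution of the soliton system, by Cramer's rule. -/
noncomputable def solitonVec (k v : ι → ℝ) (i : ι) : ℂ :=
  (solitonMatrix k v).cramer (fun j => (v j : ℂ)) i / (solitonMatrix k v).det

lemma solitonMatrix_mulVec (k v : ι → ℝ) (φ : ι → ℂ) (i : ι) :
    (solitonMatrix k v).mulVec φ i = φ i + I * ∑ j, solitonKernel k v i j * φ j := by
  simp [solitonMatrix, Matrix.mulVec, dotProduct, add_mul, Finset.sum_add_distrib,
    Finset.mul_sum, mul_assoc]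

lemma det_solitonMatrix_ne_zero (k v : ι → ℝ) : (solitonMatrix k v).det ≠ 0 := by
  intro h
  obtain ⟨φ, hφ, h0⟩ := Matrix.exists_mulVec_eq_zero_iff.2 h
  exact hφ (solitonSystem_injective fun i => by
    rw [← solitonMatrix_mulVec, h0, Pi.zero_apply])

lemma solitonVec_system (k v : ι → ℝ) : SolitonSystem k v (solitonVec k v) := by
  intro i
  rw [← solitonMatrix_mulVec]
  have h := Matrix.mulVec_cramer (solitonMatrix k v) (fun j => (v j : ℂ))
  have h2 : solitonVec k v = ((solitonMatrix k v).det)⁻¹ •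
      (solitonMatrix k v).cramer (fun j => (v j : ℂ)) := by
    funext j; simp [solitonVec, div_eq_inv_mul]
  rw [h2, Matrix.mulVec_smul, h, smul_smul, inv_mul_cancel₀ (det_solitonMatrix_ne_zero k v),
    one_smul]

lemma ContDiff.matrix_det {E : Type*} [NormedAddCommGroup E] [NormedSpace ℝ E]
    {A : E → Matrix ι ι ℂ} {n : WithTop ℕ∞} (h : ∀ i j, ContDiff ℝ n fun p => A p i j) :
    ContDiff ℝ n fun p => (A p).det := by
  simp only [Matrix.det_apply']
  exact ContDiff.sum fun σ _ => contDiff_const.mul (contDiff_prod fun i _ => h _ _)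

/-- By Cramer's rule the solution is a ratio of determinants, and the denominator never vanishes. -/
lemma contDiff_solitonVec {E : Type*} [NormedAddCommGroup E] [NormedSpace ℝ E] (k : ι → ℝ)
    {v : E → ι → ℝ} {n : WithTop ℕ∞} (h : ∀ i, ContDiff ℝ n fun p => v p i) (i : ι) :
    ContDiff ℝ n fun p => solitonVec k (v p) i := by
  have hA : ∀ i j, ContDiff ℝ n fun p => solitonMatrix k (v p) i j := fun i j => by
    unfold solitonMatrix solitonKernel
    exact contDiff_const.add (contDiff_const.mul
      (Complex.ofRealCLM.contDiff.comp (((h i).mul (h j)).div_const _)))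
  unfold solitonVec
  simp only [Matrix.cramer_apply, div_eq_mul_inv]
  refine ContDiff.mul (ContDiff.matrix_det fun a b => ?_) ((ContDiff.matrix_det hA).inv
    fun p => det_solitonMatrix_ne_zero k (v p))
  simp only [Matrix.updateCol_apply]
  split_ifs with hb
  · exact Complex.ofRealCLM.contDiff.comp (h a)
  · exact hA a b

lemma hasDerivAt_solitonKernel {ι : Type*} {k ω : ι → ℝ} {v : ℝ → ι → ℝ} {τ : ℝ}
    (hv : ∀ i, HasDerivAt (fun s => v s i) (ω i * v τ i) τ) (i j : ι) :
    HasDerivAt (fun s => solitonKernel k (v s) i j)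
      ((ω i + ω j) * solitonKernel k (v τ) i j) τ := by
  have := (((hv i).mul (hv j)).div_const (k i + k j)).ofReal_comp
  refine this.congr_deriv ?_
  simp only [solitonKernel]; push_cast; ring

lemma derivSystem_of_hasDerivAt {k ω : ι → ℝ} {v : ℝ → ι → ℝ} {τ : ℝ} {φ' : ι → ℂ}
    (hv : ∀ i, HasDerivAt (fun s => v s i) (ω i * v τ i) τ)
    (hφ : ∀ i, HasDerivAt (fun s => solitonVec k (v s) i) (φ' i) τ) :
    DerivSystem k (v τ) ω (solitonVec k (v τ)) φ' := by
  intro i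
  have h1 := (hφ i).add ((HasDerivAt.fun_sum (u := Finset.univ) fun j _ =>
    (hasDerivAt_solitonKernel (k := k) hv i j).mul (hφ j)).const_mul I)
  have h2 := (hv i).ofReal_comp
  have heq : (fun s => solitonVec k (v s) i + I * ∑ j, solitonKernel k (v s) i j
      * solitonVec k (v s) j) = fun s => (v s i : ℂ) := by
    funext s; exact solitonVec_system k (v s) i
  have h3 := h1.unique (heq ▸ h2)
  rw [h3]; push_cast; rfl

lemma hasDerivAt_sum_solitonVec {k ω : ι → ℝ} {v : ℝ → ι → ℝ} {τ : ℝ}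
    (hv : ∀ i, HasDerivAt (fun s => v s i) (ω i * v τ i) τ)
    (hφ : ∀ i, DifferentiableAt ℝ (fun s => solitonVec k (v s) i) τ) :
    HasDerivAt (fun s => ∑ i, (v s i : ℂ) * solitonVec k (v s) i)
      (∑ i, 2 * ω i * solitonVec k (v τ) i ^ 2) τ := by
  rw [← (solitonVec_system k (v τ)).sum_deriv
    (derivSystem_of_hasDerivAt hv fun i => (hφ i).hasDerivAt)]
  refine (HasDerivAt.fun_sum (u := Finset.univ) fun i _ =>
    ((hv i).ofReal_comp).mul ((hφ i).hasDerivAt)).congr_deriv ?_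
  push_cast; rfl

end Vector

/-! ### The multisoliton and its equation of motion. -/

section Flow

variable {ι : Type*} [Fintype ι] [DecidableEq ι]

/-- The norming exponentials of the multisoliton. -/
noncomputable def solitonExp (k c : ι → ℝ) (t x : ℝ) (i : ι) : ℝ :=
  c i * Real.exp (-k i * x + 4 * k i ^ 3 * t)

/-- The eigenfunctions of the multisoliton. -/
noncomputable def solitonWave (k c : ι → ℝ) (t x : ℝ) : ι → ℂ :=
  solitonVec k (solitonExp k c t x)

/-- The multisoliton. -/
noncomputable def multisoliton (k c : ι → ℝ) (t x : ℝ) : ℝ :=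
  2 * ∑ i, ‖solitonWave k c t x i‖ ^ 2

lemma solitonWave_system (k c : ι → ℝ) (t x : ℝ) :
    SolitonSystem k (solitonExp k c t x) (solitonWave k c t x) := solitonVec_system _ _

lemma solitonWave_contDiff (k c : ι → ℝ) (i : ι) :
    ContDiff ℝ 1 fun p : ℝ × ℝ => solitonWave k c p.1 p.2 i :=
  contDiff_solitonVec k (fun i => by unfold solitonExp; fun_prop) i

lemma solitonWave_continuous (k c : ι → ℝ) (i : ι) :
    Continuous fun p : ℝ × ℝ => solitonWave k c p.1 p.2 i := (solitonWave_contDiff k c i).continuous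

lemma multisoliton_eq_re (k c : ι → ℝ) (t x : ℝ) :
    multisoliton k c t x = 2 * (∑ i, (solitonExp k c t x i : ℂ) * solitonWave k c t x i).re := by
  rw [multisoliton, (solitonWave_system k c t x).re_sum]

lemma hasDerivAt_solitonExp_x {ι : Type*} (k c : ι → ℝ) (t x : ℝ) (i : ι) :
    HasDerivAt (fun y => solitonExp k c t y i) (-k i * solitonExp k c t x i) x := by
  unfold solitonExp
  have h : HasDerivAt (fun y : ℝ => -k i * y + 4 * k i ^ 3 * t) (-k i) x := by
    simpa using ((hasDerivAt_id x).const_mul (-k i)).add_const (4 * k i ^ 3 * t)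
  refine ((h.exp).const_mul (c i)).congr_deriv ?_
  ring

lemma hasDerivAt_solitonExp_t {ι : Type*} (k c : ι → ℝ) (t x : ℝ) (i : ι) :
    HasDerivAt (fun s => solitonExp k c s x i) (4 * k i ^ 3 * solitonExp k c t x i) t := by
  unfold solitonExp
  have h : HasDerivAt (fun s : ℝ => -k i * x + 4 * k i ^ 3 * s) (4 * k i ^ 3) t := by
    simpa using ((hasDerivAt_id t).const_mul (4 * k i ^ 3)).const_add (-k i * x)
  refine ((h.exp).const_mul (c i)).congr_deriv ?_
  ring

lemma solitonWave_differentiable_x (k c : ι → ℝ) (t x : ℝ) (i : ι) :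
    DifferentiableAt ℝ (fun y => solitonWave k c t y i) x := by
  have := (contDiff_solitonVec k (v := fun y => solitonExp k c t y) (n := 1)
    (fun i => by unfold solitonExp; fun_prop) i).differentiable (by simp)
  exact this x

lemma solitonWave_differentiable_t (k c : ι → ℝ) (t x : ℝ) (i : ι) :
    DifferentiableAt ℝ (fun s => solitonWave k c s x i) t := by
  have := (contDiff_solitonVec k (v := fun s => solitonExp k c s x) (n := 1)
    (fun i => by unfold solitonExp; fun_prop) i).differentiable (by simp)
  exact this t

/-- The true derivative and the closed expression solve the same uniquely solvable linear system.
This is the linear spectral problem with potential `u`. -/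
lemma hasDerivAt_solitonWave {k : ι → ℝ} (hk : ∀ i, 0 < k i) (c : ι → ℝ) (t x : ℝ) (i : ι) :
    HasDerivAt (fun y => solitonWave k c t y i)
      (I * (multisoliton k c t x : ℂ) * solitonWave k c t x i
        - k i * conj (solitonWave k c t x i)) x := by
  have h1 := derivSystem_of_hasDerivAt (k := k) (fun i => hasDerivAt_solitonExp_x k c t x i)
    (fun i => (solitonWave_differentiable_x k c t x i).hasDerivAt)
  have h2 := (solitonWave_system k c t x).derivSystem hk
  have h3 := congrFun (DerivSystem.unique h1 h2) i
  rw [multisoliton, ← h3]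
  exact (solitonWave_differentiable_x k c t x i).hasDerivAt

/-- Stated along a path `(a, b)` so that the space and time derivatives, with `ω = -k` and `ω = 4 k
^ 3`, are two instances. -/
lemma hasDerivAt_multisoliton_of {k ω c : ι → ℝ} {a b : ℝ → ℝ} {τ : ℝ}
    (hv : ∀ i, HasDerivAt (fun s => solitonExp k c (a s) (b s) i)
      (ω i * solitonExp k c (a τ) (b τ) i) τ)
    (hφ : ∀ i, DifferentiableAt ℝ (fun s => solitonWave k c (a s) (b s) i) τ) :
    HasDerivAt (fun s => multisoliton k c (a s) (b s))
      (4 * (∑ i, ω i * solitonWave k c (a τ) (b τ) i ^ 2).re) τ := by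
  have h := hasDerivAt_sum_solitonVec (v := fun s => solitonExp k c (a s) (b s)) hv hφ
  have h2 := (Complex.reCLM.hasFDerivAt.comp_hasDerivAt τ h).const_mul 2
  have h3 : (fun s => multisoliton k c (a s) (b s)) = fun s =>
      2 * (∑ i, (solitonExp k c (a s) (b s) i : ℂ) * solitonWave k c (a s) (b s) i).re := by
    funext s; exact multisoliton_eq_re k c _ _
  rw [h3]
  refine h2.congr_deriv ?_
  have h4 : ∑ i, 2 * (ω i : ℂ) * solitonVec k (solitonExp k c (a τ) (b τ)) i ^ 2
      = ((2 : ℝ) : ℂ) * ∑ i, ω i * solitonWave k c (a τ) (b τ) i ^ 2 := by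
    rw [Finset.mul_sum]
    refine Finset.sum_congr rfl fun i _ => ?_
    simp only [solitonWave]; push_cast; ring
  rw [h4, Complex.reCLM_apply, Complex.re_ofReal_mul]
  ring

lemma hasDerivAt_multisoliton_t (k c : ι → ℝ) (t x : ℝ) :
    HasDerivAt (fun s => multisoliton k c s x)
      (16 * (∑ i, k i ^ 3 * solitonWave k c t x i ^ 2 : ℂ).re) t := by
  refine (hasDerivAt_multisoliton_of (k := k) (c := c) (a := fun s => s) (b := fun _ => x) (τ := t)
    (hasDerivAt_solitonExp_t k c t x) (solitonWave_differentiable_t k c t x)).congr_deriv ?_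
  have : ∑ i, ((4 * k i ^ 3 : ℝ) : ℂ) * solitonWave k c t x i ^ 2
      = ((4 : ℝ) : ℂ) * ∑ i, (k i : ℂ) ^ 3 * solitonWave k c t x i ^ 2 := by
    rw [Finset.mul_sum]
    refine Finset.sum_congr rfl fun i _ => ?_
    push_cast; ring
  rw [this, Complex.re_ofReal_mul]; ring

lemma hasDerivAt_multisoliton_x (k c : ι → ℝ) (t x : ℝ) :
    HasDerivAt (fun y => multisoliton k c t y)
      (-4 * (∑ i, k i * solitonWave k c t x i ^ 2).re) x := by
  refine (hasDerivAt_multisoliton_of (k := k) (c := c) (a := fun _ => t) (b := fun y => y) (τ := x)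
    (ω := fun i => -k i)
    (hasDerivAt_solitonExp_x k c t x) (solitonWave_differentiable_x k c t x)).congr_deriv ?_
  have : ∑ i, ((-k i : ℝ) : ℂ) * solitonWave k c t x i ^ 2
      = ((-1 : ℝ) : ℂ) * ∑ i, (k i : ℂ) * solitonWave k c t x i ^ 2 := by
    rw [Finset.mul_sum]
    refine Finset.sum_congr rfl fun i _ => ?_
    push_cast; ring
  rw [this, Complex.re_ofReal_mul]; ring

/-- The cubic term appears because the rotation `i u` brings in the imaginary part of `∑ k i φ i ^
2`, which `im_sum_sq` expresses through `u ^ 2`. -/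
lemma hasDerivAt_sum_re_sq {k : ι → ℝ} (hk : ∀ i, 0 < k i) (c : ι → ℝ) (t x : ℝ) :
    HasDerivAt (fun y => (∑ i, k i * solitonWave k c t y i ^ 2).re)
      (multisoliton k c t x ^ 3 / 2 - 2 * ∑ i, k i ^ 2 * ‖solitonWave k c t x i‖ ^ 2) x := by
  have h := HasDerivAt.fun_sum (u := Finset.univ) fun i _ =>
    ((hasDerivAt_solitonWave hk c t x i).pow 2).const_mul (k i : ℂ)
  refine (Complex.reCLM.hasFDerivAt.comp_hasDerivAt x h).congr_deriv ?_
  set u := multisoliton k c t x with hu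
  have h1 : ∑ i, (k i : ℂ) * (((2 : ℕ) : ℂ) * solitonWave k c t x i ^ (2 - 1)
      * (I * (u : ℂ) * solitonWave k c t x i - k i * conj (solitonWave k c t x i)))
      = ((2 * u : ℝ) : ℂ) * (I * ∑ i, k i * solitonWave k c t x i ^ 2)
        - ((2 * ∑ i, k i ^ 2 * ‖solitonWave k c t x i‖ ^ 2 : ℝ) : ℂ) := by
    rw [Finset.mul_sum, Finset.mul_sum, Finset.mul_sum, Complex.ofReal_sum,
      ← Finset.sum_sub_distrib]
    refine Finset.sum_congr rfl fun i _ => ?_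
    have := Complex.mul_conj' (solitonWave k c t x i)
    push_cast
    simp only [pow_one]
    linear_combination (-2 * (k i : ℂ) ^ 2) * this
  have h2 := (solitonWave_system k c t x).im_sum_sq hk
  have h3 : ∑ i, ‖solitonWave k c t x i‖ ^ 2 = u / 2 := by rw [hu, multisoliton]; ring
  rw [Complex.reCLM_apply, h1, Complex.sub_re, Complex.ofReal_re, Complex.re_ofReal_mul,
    Complex.I_mul_re, h2, h3]
  ring

/-- The term `i u φ` only rotates the phase and does not affect moduli. -/
lemma hasDerivAt_sum_sq_norm {k : ι → ℝ} (hk : ∀ i, 0 < k i) (c : ι → ℝ) (t x : ℝ) :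
    HasDerivAt (fun y => ∑ i, k i ^ 2 * ‖solitonWave k c t y i‖ ^ 2)
      (-2 * (∑ i, k i ^ 3 * solitonWave k c t x i ^ 2 : ℂ).re) x := by
  have h : ∀ i, HasDerivAt (fun y => ‖solitonWave k c t y i‖ ^ 2)
      (-2 * k i * (solitonWave k c t x i ^ 2).re) x := by
    intro i
    have hd := hasDerivAt_solitonWave hk c t x i
    have hre := Complex.reCLM.hasFDerivAt.comp_hasDerivAt x hd
    have him := Complex.imCLM.hasFDerivAt.comp_hasDerivAt x hd
    have heq : (fun y => ‖solitonWave k c t y i‖ ^ 2)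
        = fun y => (solitonWave k c t y i).re ^ 2 + (solitonWave k c t y i).im ^ 2 := by
      funext y
      rw [← Complex.normSq_eq_norm_sq, Complex.normSq_apply]; ring
    rw [heq]
    refine ((hre.pow 2).add (him.pow 2)).congr_deriv ?_
    simp [sq]; ring
  refine (HasDerivAt.fun_sum (u := Finset.univ)
    fun i _ => (h i).const_mul (k i ^ 2)).congr_deriv ?_
  rw [Complex.re_sum, Finset.mul_sum]
  refine Finset.sum_congr rfl fun i _ => ?_
  rw [show (k i : ℂ) ^ 3 = ((k i ^ 3 : ℝ) : ℂ) by push_cast; ring, Complex.re_ofReal_mul]; ring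

/-- The multisoliton solves the modified Korteweg–de Vries equation. -/
lemma multisoliton_mkdv {k : ι → ℝ} (hk : ∀ i, 0 < k i) (c : ι → ℝ) (t x : ℝ) :
    HasDerivAt (fun s => multisoliton k c s x)
      (-iteratedDeriv 3 (multisoliton k c t) x
        - 6 * (multisoliton k c t x) ^ 2 * deriv (multisoliton k c t) x) t := by
  -- Successively `u_x = -4 Re ∑ k φ²`, `u_xx = -2 u³ + 8 ∑ k² |φ|²` and `u_xxx = -6 u² u_x - 16 Re
  -- ∑ k³ φ²`; the last term is `-u_t`.
  have d1 : deriv (multisoliton k c t)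
      = fun y => -4 * (∑ i, k i * solitonWave k c t y i ^ 2).re :=
    funext fun y => (hasDerivAt_multisoliton_x k c t y).deriv
  have d2 : deriv (fun y => -4 * (∑ i, k i * solitonWave k c t y i ^ 2).re)
      = fun y => -4 * (multisoliton k c t y ^ 3 / 2
        - 2 * ∑ i, k i ^ 2 * ‖solitonWave k c t y i‖ ^ 2) :=
    funext fun y => ((hasDerivAt_sum_re_sq hk c t y).const_mul (-4)).deriv
  have d3 : deriv (fun y => -4 * (multisoliton k c t y ^ 3 / 2
        - 2 * ∑ i, k i ^ 2 * ‖solitonWave k c t y i‖ ^ 2)) x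
      = -6 * multisoliton k c t x ^ 2 * (-4 * (∑ i, k i * solitonWave k c t x i ^ 2).re)
        - 16 * (∑ i, k i ^ 3 * solitonWave k c t x i ^ 2 : ℂ).re := by
    refine (((((hasDerivAt_multisoliton_x k c t x).pow 3).div_const 2).sub
      ((hasDerivAt_sum_sq_norm hk c t x).const_mul 2)).const_mul (-4)).deriv.trans ?_
    norm_num; ring
  refine (hasDerivAt_multisoliton_t k c t x).congr_deriv ?_
  rw [iteratedDeriv_succ, iteratedDeriv_succ, iteratedDeriv_one, d1, d2, d3]
  ring

end Flow

/-! ### Uniform bounds and exponential localization. -/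

section Bounds

variable {ι : Type*} [Fintype ι]

/-- By `im_sum` and coercivity, a quadratic form in the quantities `v i φ i` is at most their `ℓ¹`
norm, which bounds them independently of `v`. Dividing row `i` of the system by `v i` then bounds `φ
i / v i`. The first bound serves where `v i` is large, the second where it is small. -/
lemma exists_soliton_bound {k : ι → ℝ} (hk : ∀ i, 0 < k i) (hinj : Function.Injective k) :
    ∃ C > 0, ∀ (v : ι → ℝ) (φ : ι → ℂ), (∀ i, 0 < v i) → SolitonSystem k v φ →
      ∀ i, ‖v i * φ i‖ ≤ C ∧ ‖φ i / v i‖ ≤ C := by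
  obtain ⟨δ, hδ, hlow⟩ := exists_cauchyForm_lower hk hinj
  set C₁ : ℝ := (Fintype.card ι + 2) / (2 * δ) with hC₁
  have hC₁0 : 0 < C₁ := by positivity
  have h1 : ∀ (v : ι → ℝ) (φ : ι → ℂ), (∀ i, 0 < v i) → SolitonSystem k v φ →
      ∀ i, ‖v i * φ i‖ ≤ C₁ := by
    intro v φ hv h i
    have e1 := h.im_sum
    have e2 := hlow fun i => (v i * φ i).re
    have e3 := hlow fun i => (v i * φ i).im
    have e4 : -(∑ i, v i * φ i).im ≤ ∑ i, ‖v i * φ i‖ :=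
      (neg_le_abs _).trans ((Complex.abs_im_le_norm _).trans (norm_sum_le _ _))
    have e5 : ∑ i, (v i * φ i).re ^ 2 + ∑ i, (v i * φ i).im ^ 2 = ∑ i, ‖v i * φ i‖ ^ 2 := by
      rw [← Finset.sum_add_distrib]
      refine Finset.sum_congr rfl fun i _ => ?_
      rw [← Complex.normSq_eq_norm_sq, Complex.normSq_apply]; ring
    have e6 : δ * ∑ i, ‖v i * φ i‖ ^ 2 ≤ ∑ i, ‖v i * φ i‖ := by
      rw [← e5, mul_add]; linarith
    -- Completing the square in `δ ∑ y i ^ 2 ≤ ∑ y i`.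
    have e7 : ∑ i, (‖v i * φ i‖ - 1 / (2 * δ)) ^ 2 ≤ Fintype.card ι * (1 / (2 * δ)) ^ 2 := by
      have : ∑ i, (‖v i * φ i‖ - 1 / (2 * δ)) ^ 2
          = (δ * ∑ i, ‖v i * φ i‖ ^ 2 - ∑ i, ‖v i * φ i‖) / δ
            + Fintype.card ι * (1 / (2 * δ)) ^ 2 := by
        simp only [sub_sq, Finset.sum_add_distrib, Finset.sum_sub_distrib, Finset.sum_const,
          Finset.card_univ, nsmul_eq_mul, ← Finset.sum_mul, ← Finset.mul_sum]
        field_simp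
      rw [this]
      have : (δ * ∑ i, ‖v i * φ i‖ ^ 2 - ∑ i, ‖v i * φ i‖) / δ ≤ 0 :=
        div_nonpos_of_nonpos_of_nonneg (by linarith) hδ.le
      linarith
    have e8 : (‖v i * φ i‖ - 1 / (2 * δ)) ^ 2 ≤ ((Fintype.card ι + 1) / (2 * δ)) ^ 2 := by
      refine (Finset.single_le_sum (f := fun i => (‖v i * φ i‖ - 1 / (2 * δ)) ^ 2)
        (fun i _ => sq_nonneg _) (Finset.mem_univ i)).trans (e7.trans ?_)
      rw [div_pow, div_pow, ← mul_div_assoc]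
      gcongr
      nlinarith [(Nat.cast_nonneg (Fintype.card ι) : (0 : ℝ) ≤ _)]
    have e9 := (abs_le_of_sq_le_sq' e8 (by positivity)).2
    rw [hC₁]
    have : ((Fintype.card ι : ℝ) + 2) / (2 * δ)
      = (Fintype.card ι + 1) / (2 * δ) + 1 / (2 * δ) := by ring
    linarith
  set C₂ : ℝ := 1 + ∑ i, ∑ j, C₁ / (k i + k j) with hC₂
  have hkk : ∀ i j, 0 ≤ C₁ / (k i + k j) := fun i j =>
    (div_pos hC₁0 (add_pos (hk i) (hk j))).le
  refine ⟨C₁ + C₂, add_pos_of_pos_of_nonneg hC₁0 (by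
    have := Finset.sum_nonneg fun i (_ : i ∈ Finset.univ) =>
      Finset.sum_nonneg fun j (_ : j ∈ Finset.univ) => hkk i j
    linarith), fun v φ hv h i => ?_⟩
  have hsum := Finset.sum_nonneg fun i (_ : i ∈ Finset.univ) =>
      Finset.sum_nonneg fun j (_ : j ∈ Finset.univ) => hkk i j
  refine ⟨(h1 v φ hv h i).trans (by linarith), ?_⟩
  have hvi : (v i : ℂ) ≠ 0 := by exact_mod_cast (hv i).ne'
  have h2 : φ i / v i = 1 - I * ∑ j, v j * φ j / ((k i + k j : ℝ) : ℂ) := by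
    rw [div_eq_iff hvi]
    have := h i
    have h3 : ∑ j, solitonKernel k v i j * φ j
        = v i * ∑ j, v j * φ j / ((k i + k j : ℝ) : ℂ) := by
      rw [Finset.mul_sum]
      refine Finset.sum_congr rfl fun j _ => ?_
      simp only [solitonKernel]; push_cast; ring
    rw [h3] at this
    linear_combination this
  rw [h2]
  refine (norm_sub_le _ _).trans ?_
  rw [norm_one, norm_mul, Complex.norm_I, one_mul]
  have h4 : ‖∑ j, v j * φ j / ((k i + k j : ℝ) : ℂ)‖ ≤ ∑ j, C₁ / (k i + k j) := by
    refine (norm_sum_le _ _).trans (Finset.sum_le_sum fun j _ => ?_)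
    rw [norm_div, Complex.norm_real, Real.norm_of_nonneg (add_pos (hk i) (hk j)).le]
    exact div_le_div_of_nonneg_right (h1 v φ hv h j) (add_pos (hk i) (hk j)).le
  have h5 := Finset.single_le_sum (f := fun i => ∑ j, C₁ / (k i + k j))
    (fun i _ => Finset.sum_nonneg fun j _ => hkk i j) (Finset.mem_univ i)
  linarith

lemma solitonExp_pos {ι : Type*} {k c : ι → ℝ} (hc : ∀ i, 0 < c i) (t x : ℝ) (i : ι) :
    0 < solitonExp k c t x i := mul_pos (hc i) (Real.exp_pos _)

variable [DecidableEq ι]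

lemma exists_solitonWave_decay {k c : ι → ℝ} (hk : ∀ i, 0 < k i) (hinj : Function.Injective k)
    (hc : ∀ i, 0 < c i) :
    ∃ C > 0, ∀ t x i, ‖solitonWave k c t x i‖ ≤ C * Real.exp (-k i * |x - 4 * k i ^ 2 * t|) := by
  obtain ⟨C, hC, h⟩ := exists_soliton_bound hk hinj
  set B : ℝ := 1 + ∑ i, (c i + (c i)⁻¹) with hB
  have hBi : ∀ i, c i ≤ B ∧ (c i)⁻¹ ≤ B := fun i => by
    have h1 := Finset.single_le_sum (f := fun i => c i + (c i)⁻¹)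
      (fun i _ => (add_pos (hc i) (inv_pos.2 (hc i))).le) (Finset.mem_univ i)
    have h2 := hc i
    have h3 := inv_pos.2 (hc i)
    constructor <;> linarith
  have hB0 : 0 < B := by
    have := Finset.sum_nonneg fun i (_ : i ∈ Finset.univ) =>
      (add_pos (hc i) (inv_pos.2 (hc i))).le
    linarith
  refine ⟨C * B, by positivity, fun t x i => ?_⟩
  have hv := solitonExp_pos (k := k) hc t x i
  obtain ⟨h1, h2⟩ := h _ _ (solitonExp_pos (k := k) hc t x) (solitonWave_system k c t x) i
  rw [norm_mul, Complex.norm_real, Real.norm_of_nonneg hv.le] at h1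
  rw [norm_div, Complex.norm_real, Real.norm_of_nonneg hv.le, div_le_iff₀ hv] at h2
  have hexp : -k i * x + 4 * k i ^ 3 * t = -k i * (x - 4 * k i ^ 2 * t) := by ring
  rcases le_total 0 (x - 4 * k i ^ 2 * t) with hs | hs
  · rw [abs_of_nonneg hs, mul_assoc]
    refine h2.trans (mul_le_mul_of_nonneg_left ?_ hC.le)
    rw [solitonExp, hexp]
    exact mul_le_mul_of_nonneg_right (hBi i).1 (Real.exp_pos _).le
  · rw [abs_of_nonpos hs, mul_assoc]
    rw [mul_comm, ← le_div_iff₀ hv] at h1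
    refine h1.trans ?_
    rw [div_eq_mul_inv]
    refine mul_le_mul_of_nonneg_left ?_ hC.le
    rw [solitonExp, hexp, mul_inv, ← Real.exp_neg]
    rw [show -k i * -(x - 4 * k i ^ 2 * t) = -(-k i * (x - 4 * k i ^ 2 * t)) by ring]
    exact mul_le_mul_of_nonneg_right (hBi i).2 (Real.exp_pos _).le

/-- Polynomials without constant term in the eigenfunctions of a multisoliton and their
conjugates. -/
inductive SolitonPoly (k c : ι → ℝ) : (ℝ → ℝ → ℂ) → Prop
  | zero : SolitonPoly k c fun _ _ => 0
  | wave (i : ι) : SolitonPoly k c fun t x => solitonWave k c t x i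
  | star {f : ℝ → ℝ → ℂ} : SolitonPoly k c f → SolitonPoly k c fun t x => conj (f t x)
  | add {f g : ℝ → ℝ → ℂ} : SolitonPoly k c f → SolitonPoly k c g →
      SolitonPoly k c fun t x => f t x + g t x
  | mul {f g : ℝ → ℝ → ℂ} : SolitonPoly k c f → SolitonPoly k c g →
      SolitonPoly k c fun t x => f t x * g t x
  | smul (a : ℂ) {f : ℝ → ℝ → ℂ} : SolitonPoly k c f → SolitonPoly k c fun t x => a * f t x

namespace SolitonPoly

variable {k c : ι → ℝ}

lemma sum {κ : Type*} (s : Finset κ) {f : κ → ℝ → ℝ → ℂ} (h : ∀ i ∈ s, SolitonPoly k c (f i)) :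
    SolitonPoly k c fun t x => ∑ i ∈ s, f i t x := by
  classical
  induction s using Finset.induction_on with
  | empty => simpa using zero
  | insert a s ha ih =>
    simp only [Finset.sum_insert ha]
    exact (h a (Finset.mem_insert_self _ _)).add
      (ih fun i hi => h i (Finset.mem_insert_of_mem hi))

lemma wave_normSq (k c : ι → ℝ) (i : ι) :
    SolitonPoly k c fun t x => ((2 * ‖solitonWave k c t x i‖ ^ 2 : ℝ) : ℂ) := by
  have h := ((wave (k := k) (c := c) i).mul (wave i).star).smul 2
  convert h using 3 with t x
  rw [Complex.mul_conj']; push_cast; ring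

lemma multisoliton (k c : ι → ℝ) : SolitonPoly k c fun t x => (multisoliton k c t x : ℂ) := by
  have h := sum (k := k) (c := c) Finset.univ fun i _ => wave_normSq k c i
  convert h using 3 with t x
  rw [_root_.multisoliton, Finset.mul_sum]; push_cast; rfl

lemma continuous {f : ℝ → ℝ → ℂ} (hf : SolitonPoly k c f) :
    Continuous fun p : ℝ × ℝ => f p.1 p.2 := by
  induction hf with
  | zero => exact continuous_const
  | wave i => exact solitonWave_continuous k c i
  | star _ ih => exact Complex.continuous_conj.comp ih
  | add _ _ ih₁ ih₂ => exact ih₁.add ih₂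
  | mul _ _ ih₁ ih₂ => exact ih₁.mul ih₂
  | smul a _ ih => exact continuous_const.mul ih

/-- The class is closed under `∂x` because `φ' = i u φ - k φ̄` is polynomial in `φ` and `φ̄`; one
decay estimate thus covers all derivatives. -/
lemma exists_hasDerivAt (hk : ∀ i, 0 < k i) {f : ℝ → ℝ → ℂ} (hf : SolitonPoly k c f) :
    ∃ g, SolitonPoly k c g ∧ ∀ t x, HasDerivAt (f t) (g t x) x := by
  induction hf with
  | zero => exact ⟨_, zero, fun t x => hasDerivAt_const _ _⟩
  | wave i =>
    refine ⟨_, (((multisoliton k c).mul (wave i)).smul I).add ((wave i).star.smul (-k i)),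
      fun t x => (hasDerivAt_solitonWave hk c t x i).congr_deriv ?_⟩
    ring
  | star _ ih =>
    obtain ⟨g, hg, h⟩ := ih
    exact ⟨_, hg.star, fun t x =>
      (Complex.conjCLE.toContinuousLinearMap.hasFDerivAt.comp_hasDerivAt x (h t x))⟩
  | add _ _ ih₁ ih₂ =>
    obtain ⟨g₁, hg₁, h₁⟩ := ih₁
    obtain ⟨g₂, hg₂, h₂⟩ := ih₂
    exact ⟨_, hg₁.add hg₂, fun t x => (h₁ t x).add (h₂ t x)⟩
  | mul hf₁ hf₂ ih₁ ih₂ =>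
    obtain ⟨g₁, hg₁, h₁⟩ := ih₁
    obtain ⟨g₂, hg₂, h₂⟩ := ih₂
    exact ⟨_, (hg₁.mul hf₂).add (hf₁.mul hg₂), fun t x => (h₁ t x).mul (h₂ t x)⟩
  | smul a _ ih =>
    obtain ⟨g, hg, h⟩ := ih
    exact ⟨_, hg.smul a, fun t x => (h t x).const_mul a⟩

lemma iteratedDeriv (hk : ∀ i, 0 < k i) {f : ℝ → ℝ → ℂ} (hf : SolitonPoly k c f) (m : ℕ) :
    SolitonPoly k c fun t x => iteratedDeriv m (f t) x := by
  induction m with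
  | zero => simpa only [iteratedDeriv_zero] using hf
  | succ m ih =>
    obtain ⟨g, hg, h⟩ := ih.exists_hasDerivAt hk
    convert hg using 3 with t x
    rw [iteratedDeriv_succ]
    exact (h t x).deriv

lemma contDiff (hk : ∀ i, 0 < k i) {f : ℝ → ℝ → ℂ} (hf : SolitonPoly k c f) (t : ℝ)
    {n : ℕ∞} : ContDiff ℝ n (f t) := by
  refine contDiff_of_differentiable_iteratedDeriv fun m _ x => ?_
  obtain ⟨g, -, h⟩ := (hf.iteratedDeriv hk m).exists_hasDerivAt hk
  exact (h t x).differentiableAt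

lemma exists_bound (hk : ∀ i, 0 < k i) (hinj : Function.Injective k) (hc : ∀ i, 0 < c i)
    {f : ℝ → ℝ → ℂ} (hf : SolitonPoly k c f) :
    ∃ C ≥ 0, ∀ t x, ‖f t x‖ ≤ C * ∑ i, Real.exp (-k i * |x - 4 * k i ^ 2 * t|) := by
  have hle : ∀ t x, ∑ i, Real.exp (-k i * |x - 4 * k i ^ 2 * t|) ≤ Fintype.card ι := by
    intro t x
    have : ∀ i ∈ Finset.univ, Real.exp (-k i * |x - 4 * k i ^ 2 * t|) ≤ 1 := fun i _ => by
      rw [Real.exp_le_one_iff]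
      nlinarith [hk i, abs_nonneg (x - 4 * k i ^ 2 * t)]
    simpa using Finset.sum_le_card_nsmul _ _ _ this
  have hnn : ∀ t x, 0 ≤ ∑ i, Real.exp (-k i * |x - 4 * k i ^ 2 * t|) := fun t x =>
    Finset.sum_nonneg fun i _ => (Real.exp_pos _).le
  induction hf with
  | zero => exact ⟨0, le_rfl, fun t x => by simp⟩
  | wave i =>
    obtain ⟨C, hC, h⟩ := exists_solitonWave_decay hk hinj hc
    refine ⟨C, hC.le, fun t x => (h t x i).trans (mul_le_mul_of_nonneg_left ?_ hC.le)⟩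
    exact Finset.single_le_sum (f := fun i => Real.exp (-k i * |x - 4 * k i ^ 2 * t|))
      (fun i _ => (Real.exp_pos _).le) (Finset.mem_univ i)
  | star _ ih =>
    obtain ⟨C, hC, h⟩ := ih
    exact ⟨C, hC, fun t x => by rw [RCLike.norm_conj]; exact h t x⟩
  | add _ _ ih₁ ih₂ =>
    obtain ⟨C₁, hC₁, h₁⟩ := ih₁
    obtain ⟨C₂, hC₂, h₂⟩ := ih₂
    refine ⟨C₁ + C₂, add_nonneg hC₁ hC₂, fun t x => (norm_add_le _ _).trans ?_⟩
    rw [add_mul]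
    exact add_le_add (h₁ t x) (h₂ t x)
  | mul _ _ ih₁ ih₂ =>
    obtain ⟨C₁, hC₁, h₁⟩ := ih₁
    obtain ⟨C₂, hC₂, h₂⟩ := ih₂
    refine ⟨C₁ * (C₂ * Fintype.card ι), by positivity, fun t x => ?_⟩
    rw [norm_mul]
    calc _ ≤ (C₁ * ∑ i, Real.exp (-k i * |x - 4 * k i ^ 2 * t|)) * (C₂ * Fintype.card ι) :=
          mul_le_mul (h₁ t x) ((h₂ t x).trans (mul_le_mul_of_nonneg_left (hle t x) hC₂))
            (norm_nonneg _) (mul_nonneg hC₁ (hnn t x))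
      _ = _ := by ring
  | smul a _ ih =>
    obtain ⟨C, hC, h⟩ := ih
    refine ⟨‖a‖ * C, by positivity, fun t x => ?_⟩
    rw [norm_mul, mul_assoc]
    exact mul_le_mul_of_nonneg_left (h t x) (norm_nonneg _)

lemma exists_pow_bound (hk : ∀ i, 0 < k i) (hinj : Function.Injective k) (hc : ∀ i, 0 < c i)
    {f : ℝ → ℝ → ℂ} (hf : SolitonPoly k c f) (l : ℕ) (R : ℝ) :
    ∃ C ≥ 0, ∀ t x, |t| ≤ R → |x| ^ l * ‖f t x‖ ≤ C := by
  obtain ⟨C, hC, h⟩ := hf.exists_bound hk hinj hc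
  refine ⟨C * ∑ i, (l.factorial / k i ^ l * Real.exp (4 * k i ^ 3 * R)),
    mul_nonneg hC (Finset.sum_nonneg fun i _ => by have := hk i; positivity), fun t x ht => ?_⟩
  refine (mul_le_mul_of_nonneg_left (h t x) (by positivity)).trans ?_
  rw [mul_left_comm, Finset.mul_sum]
  refine mul_le_mul_of_nonneg_left (Finset.sum_le_sum fun i _ => ?_) hC
  have hki := hk i
  have h1 : |x| ≤ |x - 4 * k i ^ 2 * t| + 4 * k i ^ 2 * R := by
    have : |4 * k i ^ 2 * t| ≤ 4 * k i ^ 2 * R := by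
      rw [abs_mul, abs_of_nonneg (by positivity : 0 ≤ 4 * k i ^ 2)]
      exact mul_le_mul_of_nonneg_left ht (by positivity)
    have h2 := abs_add_le (x - 4 * k i ^ 2 * t) (4 * k i ^ 2 * t)
    rw [sub_add_cancel] at h2
    linarith
  have h2 : Real.exp (-k i * |x - 4 * k i ^ 2 * t|)
      ≤ Real.exp (4 * k i ^ 3 * R) * Real.exp (-(k i * |x|)) := by
    rw [← Real.exp_add]
    refine Real.exp_le_exp.2 ?_
    nlinarith
  have h3 : |x| ^ l ≤ l.factorial / k i ^ l * Real.exp (k i * |x|) := by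
    have := Real.pow_div_factorial_le_exp (k i * |x|) (by positivity) l
    rw [div_le_iff₀ (by positivity), mul_pow] at this
    rw [div_mul_eq_mul_div, le_div_iff₀ (by positivity)]
    linarith
  calc _ ≤ (l.factorial / k i ^ l * Real.exp (k i * |x|))
        * (Real.exp (4 * k i ^ 3 * R) * Real.exp (-(k i * |x|))) :=
        mul_le_mul h3 h2 (Real.exp_pos _).le (by positivity)
    _ = l.factorial / k i ^ l * Real.exp (4 * k i ^ 3 * R)
        * (Real.exp (k i * |x|) * Real.exp (-(k i * |x|))) := by ring
    _ = _ := by rw [← Real.exp_add, add_neg_cancel, Real.exp_zero, mul_one]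

end SolitonPoly

end Bounds

lemma iteratedDeriv_ofReal {f : ℝ → ℝ} (hf : ContDiff ℝ (⊤ : ℕ∞) f) (m : ℕ) (x : ℝ) :
    iteratedDeriv m (fun y => (f y : ℂ)) x = ((iteratedDeriv m f x : ℝ) : ℂ) := by
  induction m generalizing x with
  | zero => simp
  | succ m ih =>
    rw [iteratedDeriv_succ, iteratedDeriv_succ, funext ih]
    have hd : DifferentiableAt ℝ (iteratedDeriv m f) x :=
      (hf.differentiable_iteratedDeriv m (by exact_mod_cast WithTop.coe_lt_top m)) x
    exact hd.hasDerivAt.ofReal_comp.deriv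

/-! ### Multisolitons as continuous curves in Schwartz space. -/

section Schwartz

variable {ι : Type*} [Fintype ι] [DecidableEq ι] {k c : ι → ℝ}

lemma multisoliton_contDiff (hk : ∀ i, 0 < k i) (c : ι → ℝ) (t : ℝ) :
    ContDiff ℝ (⊤ : ℕ∞) (multisoliton k c t) := by
  have := Complex.reCLM.contDiff.comp ((SolitonPoly.multisoliton k c).contDiff hk t (n := ⊤))
  exact this

lemma norm_iteratedDeriv_multisoliton (hk : ∀ i, 0 < k i) (c : ι → ℝ) (t : ℝ) (m : ℕ) (x : ℝ) :
    ‖iteratedDeriv m (multisoliton k c t) x‖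
      = ‖iteratedDeriv m (fun y => (multisoliton k c t y : ℂ)) x‖ := by
  rw [iteratedDeriv_ofReal (multisoliton_contDiff hk c t), Complex.norm_real]

/-- The multisoliton at time `t` as a Schwartz function. -/
noncomputable def multisolitonSchwartz (hk : ∀ i, 0 < k i) (hinj : Function.Injective k)
    (hc : ∀ i, 0 < c i) (t : ℝ) : 𝓢(ℝ, ℝ) where
  toFun := multisoliton k c t
  smooth' := multisoliton_contDiff hk c t
  decay' := by
    intro l m
    obtain ⟨C, -, h⟩ := ((SolitonPoly.multisoliton k c).iteratedDeriv hk m).exists_pow_bound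
      hk hinj hc l |t|
    refine ⟨C, fun x => ?_⟩
    rw [norm_iteratedFDeriv_eq_norm_iteratedDeriv, norm_iteratedDeriv_multisoliton hk,
      Real.norm_eq_abs]
    exact h t x le_rfl

lemma multisolitonSchwartz_coe (hk : ∀ i, 0 < k i) (hinj : Function.Injective k)
    (hc : ∀ i, 0 < c i) (t : ℝ) :
    ⇑(multisolitonSchwartz hk hinj hc t) = multisoliton k c t := rfl

lemma multisolitonSchwartz_continuous (hk : ∀ i, 0 < k i) (hinj : Function.Injective k)
    (hc : ∀ i, 0 < c i) : Continuous (multisolitonSchwartz hk hinj hc) := by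
  rw [continuous_iff_continuousAt]
  intro t₀
  rw [ContinuousAt, (schwartz_withSeminorms ℝ ℝ ℝ).tendsto_nhds]
  rintro ⟨l, m⟩ ε hε
  have hpoly := (SolitonPoly.multisoliton k c).iteratedDeriv hk m
  obtain ⟨D, hD⟩ : ∃ D : ℝ → ℝ → ℂ,
    D = fun t x => iteratedDeriv m (fun y => (multisoliton k c t y : ℂ)) x := ⟨_, rfl⟩
  have hDpoly : SolitonPoly k c D := hD ▸ hpoly
  -- One spare power of `|x|` makes the seminorm small outside `[-R, R]`, uniformly for `|t - t₀| <
  -- 1`; inside, joint continuity on a compact set suffices.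
  obtain ⟨C, hC, hb⟩ := hDpoly.exists_pow_bound hk hinj hc (l + 1) (|t₀| + 1)
  set R : ℝ := 4 * C / ε + 1 with hR
  have hR0 : 0 < R := by positivity
  have hcont : Continuous fun p : ℝ × ℝ => |p.2| ^ l * ‖D p.1 p.2 - D t₀ p.2‖ := by
    have h1 := hDpoly.continuous
    have h2 : Continuous fun p : ℝ × ℝ => D t₀ p.2 :=
      h1.comp (f := fun p : ℝ × ℝ => (t₀, p.2)) (continuous_const.prodMk continuous_snd)
    have h3 : Continuous fun p : ℝ × ℝ => |p.2| ^ l := by fun_prop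
    exact h3.mul (h1.sub h2).norm
  have hloc : ∀ᶠ t in 𝓝 t₀, ∀ x ∈ Set.Icc (-R) R, |x| ^ l * ‖D t x - D t₀ x‖ < ε / 2 := by
    refine isCompact_Icc.eventually_forall_of_forall_eventually fun x _ => ?_
    have h1 : (fun p : ℝ × ℝ => |p.2| ^ l * ‖D p.1 p.2 - D t₀ p.2‖) (t₀, x) < ε / 2 := by
      simp only [sub_self, norm_zero, mul_zero]
      exact half_pos hε
    have h2 : ∀ᶠ p : ℝ × ℝ in 𝓝 (t₀, x), |p.2| ^ l * ‖D p.1 p.2 - D t₀ p.2‖ < ε / 2 :=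
      hcont.continuousAt.eventually (gt_mem_nhds h1)
    exact h2
  have hnear : ∀ᶠ t in 𝓝 t₀, |t - t₀| < 1 := by
    filter_upwards [Metric.ball_mem_nhds t₀ one_pos] with t ht
    rwa [Metric.mem_ball, Real.dist_eq] at ht
  filter_upwards [hloc, hnear] with t ht htn
  refine lt_of_le_of_lt ?_ (half_lt_self hε)
  refine SchwartzMap.seminorm_le_bound' ℝ l m _ (half_pos hε).le fun x => ?_
  have hsub : ‖iteratedDeriv m (⇑(multisolitonSchwartz hk hinj hc t
      - multisolitonSchwartz hk hinj hc t₀)) x‖ = ‖D t x - D t₀ x‖ := by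
    have hcoe : ⇑(multisolitonSchwartz hk hinj hc t - multisolitonSchwartz hk hinj hc t₀)
        = multisoliton k c t - multisoliton k c t₀ := rfl
    rw [hcoe, iteratedDeriv_sub
        ((multisoliton_contDiff hk c t).contDiffAt.of_le (by exact_mod_cast le_top))
        ((multisoliton_contDiff hk c t₀).contDiffAt.of_le (by exact_mod_cast le_top))]
    simp only [hD]
    rw [iteratedDeriv_ofReal (multisoliton_contDiff hk c t),
      iteratedDeriv_ofReal (multisoliton_contDiff hk c t₀), ← Complex.ofReal_sub,
      Complex.norm_real]
  rw [hsub]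
  by_cases hx : x ∈ Set.Icc (-R) R
  · exact (ht x hx).le
  · have hxR : R < |x| := by
      rw [Set.mem_Icc, ← abs_le, not_le] at hx; exact hx
    have htb : |t| ≤ |t₀| + 1 := by
      have := abs_add_le (t - t₀) t₀
      rw [sub_add_cancel] at this
      linarith
    have h1 := hb t x htb
    have h2 := hb t₀ x (by linarith)
    have h3 : |x| * (|x| ^ l * ‖D t x - D t₀ x‖) ≤ 2 * C := by
      calc _ = |x| ^ (l + 1) * ‖D t x - D t₀ x‖ := by ring
        _ ≤ |x| ^ (l + 1) * (‖D t x‖ + ‖D t₀ x‖) :=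
            mul_le_mul_of_nonneg_left (norm_sub_le _ _) (by positivity)
        _ ≤ 2 * C := by rw [mul_add]; linarith
    have h4 : R * (|x| ^ l * ‖D t x - D t₀ x‖) ≤ 2 * C :=
      (mul_le_mul_of_nonneg_right hxR.le (by positivity)).trans h3
    have h5 : 2 * C ≤ R * (ε / 2) := by
      rw [hR]; field_simp; linarith
    exact le_of_mul_le_mul_left (h4.trans h5) hR0

lemma multisolitonSchwartz_isSolution (hk : ∀ i, 0 < k i) (hinj : Function.Injective k)
    (hc : ∀ i, 0 < c i) : IsSchwartzSolutionMKdV (multisolitonSchwartz hk hinj hc) where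
  continuous := multisolitonSchwartz_continuous hk hinj hc
  equation t x := multisoliton_mkdv hk c t x

end Schwartz

lemma IsSchwartzSolutionMKdV.translate {u : ℝ → 𝓢(ℝ, ℝ)} (h : IsSchwartzSolutionMKdV u) (T : ℝ) :
    IsSchwartzSolutionMKdV fun t => u (t + T) where
  continuous := h.continuous.comp (continuous_add_const T)
  equation t x := (h.equation (t + T) x).comp_add_const t T

/-! ### Asymptotic decoupling into single solitons. -/

section LateTime

variable {ι : Type*} [Fintype ι] [DecidableEq ι] {k c : ι → ℝ}

/-- In the frame of soliton `j`, the exponentials `v i` of the faster solitons (`k i > k j`) blow up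
and those of the slower ones vanish. The weights `w` combine the rows with `k i ≥ k j` so that the
unknowns of the faster solitons are eliminated. -/
lemma exists_cauchy_block_dual (hk : ∀ i, 0 < k i) (hinj : Function.Injective k) (j : ι) :
    ∃ w : ι → ℝ, 0 < w j ∧ 2 * k j * w j = (∑ i, w i) ^ 2 ∧ (∀ i, k i < k j → w i = 0) ∧
      ∀ m, k j ≤ k m → ∑ i, w i / (k i + k m) = if m = j then 1 else 0 := by
  classical
  let S := {i // k j ≤ k i}
  let j₀ : S := ⟨j, le_rfl⟩
  have hk' : ∀ i : S, 0 < k i := fun i => hk i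
  have hinj' : Function.Injective fun i : S => k i := hinj.comp Subtype.val_injective
  obtain ⟨w, hw⟩ := exists_cauchy_dual hk' hinj' j₀
  let W : ι → ℝ := fun i => if h : k j ≤ k i then w ⟨i, h⟩ else 0
  have hW : ∀ i : S, W i = w i := fun i => by simp [W, i.2]
  have hsum : ∀ g : ι → ℝ, ∑ i, W i * g i = ∑ i : S, w i * g i := by
    intro g
    have h1 : ∑ i : S, w i * g i = ∑ i : S, W i * g i :=
      Finset.sum_congr rfl fun i _ => by rw [hW i]
    rw [h1, ← Finset.sum_subtype (Finset.univ.filter fun i => k j ≤ k i) (by simp)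
      fun i => W i * g i]
    refine (Finset.sum_filter_of_ne fun i _ hi => ?_).symm
    by_contra hlt
    exact hi (by simp [W, hlt])
  refine ⟨W, ?_, ?_, ?_, ?_⟩
  · have := cauchy_dual_pos hk' hinj' hw
    rwa [← hW] at this
  · have h1 := cauchy_dual_moment hk' hw
    have h2 := hsum fun _ => 1
    simp only [mul_one] at h2
    rw [h2, ← h1, hW j₀]
  · intro i hi
    simp [W, not_le.2 hi]
  · intro m hm
    have h1 := hw ⟨m, hm⟩
    have h2 := hsum fun i => 1 / (k i + k m)
    simp only [mul_one_div] at h2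
    rw [h2, h1]
    exact if_congr Subtype.ext_iff rfl rfl

lemma solitonExp_travel {ι : Type*} (k c : ι → ℝ) (t z : ℝ) (i j : ι) :
    solitonExp k c t (z + 4 * k j ^ 2 * t) i
      = c i * Real.exp (-k i * z) * Real.exp (4 * k i * (k i ^ 2 - k j ^ 2) * t) := by
  rw [solitonExp, mul_assoc (c i), ← Real.exp_add]
  congr 2; ring

lemma tendsto_exp_mul_atTop_of_neg {a : ℝ} (ha : a < 0) :
    Tendsto (fun t => Real.exp (a * t)) atTop (𝓝 0) :=
  Real.tendsto_exp_atBot.comp (tendsto_id.const_mul_atTop_of_neg ha)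

/-- In the frame moving with the `j`-th soliton, the `j`-th density converges to a soliton. -/
lemma exists_tendsto_soliton (hk : ∀ i, 0 < k i) (hinj : Function.Injective k)
    (hc : ∀ i, 0 < c i) (j : ι) :
    ∃ s : ℝ, ∀ z, Tendsto (fun t => 2 * ‖solitonWave k c t (z + 4 * k j ^ 2 * t) j‖ ^ 2) atTop
      (𝓝 (2 * k j / Real.cosh (2 * k j * z + s))) := by
  obtain ⟨C, hC, hbd⟩ := exists_soliton_bound hk hinj
  obtain ⟨w, hwj, hmom, hw0, hdual⟩ := exists_cauchy_block_dual hk hinj j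
  refine ⟨Real.log (w j) - 2 * Real.log (c j), fun z => ?_⟩
  set v : ℝ → ι → ℝ := fun t => solitonExp k c t (z + 4 * k j ^ 2 * t) with hv
  set φ : ℝ → ι → ℂ := fun t => solitonWave k c t (z + 4 * k j ^ 2 * t) with hφ
  have hvpos : ∀ t i, 0 < v t i := fun t i => solitonExp_pos hc _ _ _
  have hvne : ∀ t i, (v t i : ℂ) ≠ 0 := fun t i => by exact_mod_cast (hvpos t i).ne'
  have hb := fun t => hbd (v t) (φ t) (hvpos t) (solitonWave_system k c t _)
  set a : ι → ℝ := fun m => ∑ i, w i / (k i + k m) with ha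
  set V : ℝ := c j * Real.exp (-k j * z) with hV
  have hVpos : 0 < V := mul_pos (hc j) (Real.exp_pos _)
  have hvj : ∀ t, v t j = V := fun t => by
    simp only [hv]
    rw [solitonExp_travel]; simp [hV]
  -- Row `i` divided by `v i`, so that only the uniformly bounded quantities `φ / v` and `v φ`
  -- occur.
  have heq : ∀ t i, φ t i / v t i + I * ∑ m, v t m * φ t m / ((k i + k m : ℝ) : ℂ) = 1 := by
    intro t i
    have h1 := solitonWave_system k c t (z + 4 * k j ^ 2 * t) i
    have h3 : ∑ m, solitonKernel k (v t) i m * φ t m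
        = v t i * ∑ m, v t m * φ t m / ((k i + k m : ℝ) : ℂ) := by
      rw [Finset.mul_sum]
      refine Finset.sum_congr rfl fun m _ => ?_
      simp only [solitonKernel]; push_cast; ring
    have h4 : φ t i + I * (v t i * ∑ m, v t m * φ t m / ((k i + k m : ℝ) : ℂ)) = v t i := by
      rw [← h3]; exact h1
    have := hvne t i
    field_simp
    linear_combination h4
  have hweighted : ∀ t, ∑ i, ((w i : ℂ) * (φ t i / v t i) + I * (a i * (v t i * φ t i)))
      = ((∑ i, w i : ℝ) : ℂ) := by
    intro t
    have h1 : ∑ i, (w i : ℂ) * (φ t i / v t i + I * ∑ m, v t m * φ t m / ((k i + k m : ℝ) : ℂ))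
        = ((∑ i, w i : ℝ) : ℂ) := by
      rw [Complex.ofReal_sum]
      exact Finset.sum_congr rfl fun i _ => by rw [heq t i, mul_one]
    rw [← h1]
    simp only [mul_add, Finset.sum_add_distrib]
    congr 1
    simp only [ha, Complex.ofReal_sum, Finset.sum_mul, Finset.mul_sum]
    rw [Finset.sum_comm]
    refine Finset.sum_congr rfl fun i _ => Finset.sum_congr rfl fun m _ => ?_
    push_cast; ring
  -- For a slower soliton `w i = 0` and `v φ = (φ / v) v ^ 2` tends to `0`; for a faster one `a i =
  -- 0` and `φ / v = (v φ) v ^ (-2)` tends to `0`. Only the terms of index `j` survive.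
  have hterm : ∀ i ∈ Finset.univ.erase j, Tendsto
      (fun t => (w i : ℂ) * (φ t i / v t i) + I * (a i * (v t i * φ t i))) atTop (𝓝 0) := by
    intro i hi
    have hij : i ≠ j := Finset.ne_of_mem_erase hi
    rcases lt_or_gt_of_ne (fun h => hij (hinj h)) with hlt | hgt
    · rw [show w i = 0 from hw0 i hlt]
      simp only [Complex.ofReal_zero, zero_mul, zero_add]
      have hv0 : Tendsto (fun t => |a i| * (C * v t i ^ 2)) atTop (𝓝 0) := by
        have h1 : Tendsto (fun t => v t i) atTop (𝓝 0) := by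
          have h2 : 4 * k i * (k i ^ 2 - k j ^ 2) < 0 := by
            have := hk i
            have : k i ^ 2 - k j ^ 2 < 0 := by nlinarith [hk j]
            nlinarith
          have h3 := (tendsto_exp_mul_atTop_of_neg h2).const_mul (c i * Real.exp (-k i * z))
          rw [mul_zero] at h3
          exact h3.congr fun t => (solitonExp_travel k c t z i j).symm
        simpa using ((h1.pow 2).const_mul C).const_mul |a i|
      refine squeeze_zero_norm (fun t => ?_) hv0
      rw [norm_mul, Complex.norm_I, one_mul, norm_mul, Complex.norm_real, Real.norm_eq_abs]
      refine mul_le_mul_of_nonneg_left ?_ (abs_nonneg _)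
      have h2 : (v t i : ℂ) * φ t i = φ t i / v t i * (v t i : ℂ) ^ 2 := by
        have := hvne t i
        field_simp
      rw [h2, norm_mul, norm_pow, Complex.norm_real, Real.norm_of_nonneg (hvpos t i).le]
      exact mul_le_mul_of_nonneg_right (hb t i).2 (by positivity)
    · rw [show a i = 0 by simp only [ha]; rw [hdual i (le_of_lt hgt), if_neg hij]]
      simp only [Complex.ofReal_zero, zero_mul, mul_zero, add_zero]
      have hv0 : Tendsto (fun t => |w i| * (C * (v t i)⁻¹ ^ 2)) atTop (𝓝 0) := by
        have h1 : Tendsto (fun t => (v t i)⁻¹) atTop (𝓝 0) := by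
          have h2 : -(4 * k i) * (k i ^ 2 - k j ^ 2) < 0 := by
            have := hk i
            have : 0 < k i ^ 2 - k j ^ 2 := by nlinarith [hk j]
            nlinarith
          have h3 := (tendsto_exp_mul_atTop_of_neg h2).const_mul ((c i)⁻¹ * Real.exp (k i * z))
          rw [mul_zero] at h3
          refine h3.congr fun t => ?_
          simp only [hv]
          rw [solitonExp_travel, mul_inv, mul_inv, ← Real.exp_neg, ← Real.exp_neg]
          ring_nf
        simpa using ((h1.pow 2).const_mul C).const_mul |w i|
      refine squeeze_zero_norm (fun t => ?_) hv0
      rw [norm_mul, Complex.norm_real, Real.norm_eq_abs]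
      refine mul_le_mul_of_nonneg_left ?_ (abs_nonneg _)
      have h2 : φ t i / (v t i : ℂ) = v t i * φ t i * ((v t i : ℂ)⁻¹) ^ 2 := by
        have := hvne t i
        field_simp
      rw [h2, norm_mul, norm_pow, norm_inv, Complex.norm_real,
        Real.norm_of_nonneg (hvpos t i).le]
      exact mul_le_mul_of_nonneg_right (hb t i).1 (by positivity)
  have herr := tendsto_finsetSum (Finset.univ.erase j) hterm
  simp only [Finset.sum_const_zero] at herr
  have haj : a j = 1 := by simp only [ha]; rw [hdual j le_rfl, if_pos rfl]
  have hden : (w j : ℂ) + I * (V : ℂ) ^ 2 ≠ 0 := by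
    intro h
    have := congrArg Complex.re h
    rw [← Complex.ofReal_pow, Complex.add_re, Complex.ofReal_re, Complex.re_mul_ofReal,
      Complex.I_re, zero_mul, add_zero, Complex.zero_re] at this
    exact hwj.ne' this
  have hφj : ∀ t, φ t j = V * (((∑ i, w i : ℝ) : ℂ) - ∑ i ∈ Finset.univ.erase j,
      ((w i : ℂ) * (φ t i / v t i) + I * (a i * (v t i * φ t i)))) / ((w j : ℂ) + I * (V : ℂ) ^ 2) := by
    intro t
    have h1 := hweighted t
    rw [← Finset.add_sum_erase _ _ (Finset.mem_univ j), haj, hvj] at h1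
    rw [eq_div_iff hden, ← h1]
    have : (V : ℂ) ≠ 0 := by exact_mod_cast hVpos.ne'
    field_simp
    push_cast
    ring
  have hlim : Tendsto (fun t => φ t j) atTop
      (𝓝 (V * ((∑ i, w i : ℝ) : ℂ) / ((w j : ℂ) + I * (V : ℂ) ^ 2))) := by
    simp only [hφj]
    simpa using ((tendsto_const_nhds.sub herr).const_mul (V : ℂ)).div_const
      ((w j : ℂ) + I * (V : ℂ) ^ 2)
  convert (hlim.norm.pow 2).const_mul 2 using 2
  have hn : ‖(w j : ℂ) + I * (V : ℂ) ^ 2‖ ^ 2 = w j ^ 2 + V ^ 4 := by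
    rw [← Complex.normSq_eq_norm_sq, Complex.normSq_apply, ← Complex.ofReal_pow, Complex.add_re,
      Complex.add_im, Complex.ofReal_re, Complex.ofReal_im, Complex.re_mul_ofReal,
      Complex.im_mul_ofReal, Complex.I_re, Complex.I_im]
    ring
  rw [norm_div, div_pow, hn, norm_mul, Complex.norm_real, Complex.norm_real, mul_pow,
    Real.norm_eq_abs, Real.norm_eq_abs, sq_abs, sq_abs, ← hmom, Real.cosh_eq]
  -- The limit is `2 V² (∑ w)² / (w j ² + V⁴)`; with `(∑ w)² = 2 k j w j` it is `2 k j` over the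
  -- hyperbolic cosine of `log (w j / V²)`.
  have he : Real.exp (2 * k j * z + (Real.log (w j) - 2 * Real.log (c j))) = w j / V ^ 2 := by
    have h2 : 2 * k j * z + (Real.log (w j) - 2 * Real.log (c j))
        = Real.log (w j) - (Real.log (c j) + -k j * z) - (Real.log (c j) + -k j * z) := by ring
    rw [h2, Real.exp_sub, Real.exp_sub, Real.exp_add, Real.exp_log hwj, Real.exp_log (hc j), ← hV]
    field_simp
  rw [Real.exp_neg, he]
  field_simp

/-- The soliton profile. -/
noncomputable def sech (x : ℝ) : ℝ := 1 / Real.cosh x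

lemma sech_pos (x : ℝ) : 0 < sech x := one_div_pos.2 (Real.cosh_pos x)

lemma continuous_sech : Continuous sech :=
  continuous_const.div Real.continuous_cosh fun x => (Real.cosh_pos x).ne'

lemma sech_le (x : ℝ) : sech x ≤ 2 * Real.exp (-|x|) := by
  rw [sech, div_le_iff₀ (Real.cosh_pos x), ← Real.cosh_abs, Real.cosh_eq]
  have h : Real.exp (-|x|) * Real.exp |x| = 1 := by rw [← Real.exp_add]; simp
  nlinarith [Real.exp_pos (-|x|)]

lemma integrable_exp_neg_mul_abs {a : ℝ} (ha : 0 < a) :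
    Integrable fun x : ℝ => Real.exp (-a * |x|) := by
  have h : IntegrableOn (fun x : ℝ => Real.exp (-a * |x|)) (Set.Ioi 0) := by
    refine (integrableOn_exp_mul_Ioi (neg_lt_zero.2 ha) 0).congr_fun (fun x hx => ?_)
      measurableSet_Ioi
    simp only [abs_of_pos (Set.mem_Ioi.1 hx)]
  rw [← integrableOn_univ, ← Set.Iic_union_Ioi (a := (0 : ℝ))]
  refine IntegrableOn.union ?_ h
  rw [← neg_zero, ← integrableOn_Ici_iff_integrableOn_Ioi] at h
  have h2 := h.comp_neg_Iic
  simpa using h2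

lemma integrable_sech : Integrable sech := by
  refine ((integrable_exp_neg_mul_abs one_pos).const_mul 2).mono'
    continuous_sech.aestronglyMeasurable (Eventually.of_forall fun x => ?_)
  rw [Real.norm_of_nonneg (sech_pos x).le]
  simpa using sech_le x

/-- At late times the multisoliton decouples into solitons, in `L¹`. -/
lemma exists_tendsto_sum_solitons (hk : ∀ i, 0 < k i) (hinj : Function.Injective k)
    (hc : ∀ i, 0 < c i) :
    ∃ s : ι → ℝ, Tendsto (fun t => ∫ x, |multisoliton k c t x
      - ∑ j, 2 * k j * sech (2 * k j * (x - 4 * k j ^ 2 * t) + s j)|) atTop (𝓝 0) := by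
  choose s hs using fun j => exists_tendsto_soliton (k := k) (c := c) hk hinj hc j
  refine ⟨s, ?_⟩
  obtain ⟨C, hC, hdec⟩ := exists_solitonWave_decay hk hinj hc
  have hint : ∀ j, Integrable fun z => 2 * k j * sech (2 * k j * z + s j) := fun j =>
    ((integrable_sech.comp_add_right (s j)).comp_mul_left'
      (mul_pos two_pos (hk j)).ne').const_mul _
  set D : ι → ℝ → ℝ → ℝ := fun j t z => 2 * ‖solitonWave k c t (z + 4 * k j ^ 2 * t) j‖ ^ 2
    - 2 * k j * sech (2 * k j * z + s j) with hD
  have hDcont : ∀ j t, Continuous (D j t) := fun j t => by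
    have h1 := (solitonWave_continuous k c j).comp
      (f := fun z : ℝ => (t, z + 4 * k j ^ 2 * t)) (by fun_prop)
    have h2 := continuous_sech.comp (f := fun z : ℝ => 2 * k j * z + s j) (by fun_prop)
    exact (continuous_const.mul (h1.norm.pow 2)).sub (continuous_const.mul h2)
  have hbound : ∀ j t z, ‖D j t z‖
      ≤ 2 * C ^ 2 * Real.exp (-(2 * k j) * |z|) + 2 * k j * sech (2 * k j * z + s j) := by
    intro j t z
    refine (norm_sub_le _ _).trans (add_le_add ?_ ?_)
    · rw [Real.norm_of_nonneg (by positivity)]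
      have h1 := hdec t (z + 4 * k j ^ 2 * t) j
      rw [add_sub_cancel_right] at h1
      have h2 := pow_le_pow_left₀ (norm_nonneg _) h1 2
      rw [mul_pow, ← Real.exp_nat_mul] at h2
      have h3 : ((2 : ℕ) : ℝ) * (-k j * |z|) = -(2 * k j) * |z| := by push_cast; ring
      rw [h3] at h2
      linarith
    · rw [Real.norm_of_nonneg]
      exact mul_nonneg (mul_pos two_pos (hk j)).le (sech_pos _).le
  have hbint : ∀ j, Integrable fun z =>
      2 * C ^ 2 * Real.exp (-(2 * k j) * |z|) + 2 * k j * sech (2 * k j * z + s j) := fun j =>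
    ((integrable_exp_neg_mul_abs (mul_pos two_pos (hk j))).const_mul _).add (hint j)
  have hDint : ∀ j t, Integrable (D j t) := fun j t =>
    (hbint j).mono' (hDcont j t).aestronglyMeasurable (Eventually.of_forall (hbound j t))
  -- Dominated convergence in the frame of each soliton separately: the density of index `j` is
  -- exponentially localized there uniformly in `t`.
  have hlim : ∀ j, Tendsto (fun t => ∫ z, ‖D j t z‖) atTop (𝓝 0) := by
    intro j
    have := tendsto_integral_filter_of_dominated_convergence (F := fun t z => ‖D j t z‖)
      (f := fun _ => (0 : ℝ)) (μ := volume) (l := atTop) _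
      (Eventually.of_forall fun t => (hDcont j t).norm.aestronglyMeasurable)
      (Eventually.of_forall fun t => Eventually.of_forall fun z =>
        (norm_norm (D j t z)).le.trans (hbound j t z)) (hbint j)
      (Eventually.of_forall fun z => by
        have h1 := ((hs j z).sub_const (2 * k j * sech (2 * k j * z + s j))).norm
        have h2 : 2 * k j / Real.cosh (2 * k j * z + s j)
            - 2 * k j * sech (2 * k j * z + s j) = 0 := by rw [sech]; ring
        rwa [h2, norm_zero] at h1)
    simpa using this
  have hsum := tendsto_finsetSum Finset.univ fun j _ => hlim j
  simp only [Finset.sum_const_zero] at hsum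
  refine squeeze_zero (fun t => integral_nonneg fun x => abs_nonneg _) (fun t => ?_) hsum
  have hshift : ∀ j, Integrable fun x => ‖D j t (x - 4 * k j ^ 2 * t)‖ := fun j =>
    ((hDint j t).comp_sub_right (4 * k j ^ 2 * t)).norm
  have h1 : ∀ j, ∫ z, ‖D j t z‖ = ∫ x, ‖D j t (x - 4 * k j ^ 2 * t)‖ := fun j =>
    (integral_sub_right_eq_self (fun z => ‖D j t z‖) _).symm
  simp only [h1]
  rw [← integral_finsetSum _ fun j _ => hshift j]
  refine integral_mono_of_nonneg (Eventually.of_forall fun x => abs_nonneg _)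
    (integrable_finsetSum _ fun j _ => hshift j) (Eventually.of_forall fun x => ?_)
  have h2 : multisoliton k c t x
      - ∑ j, 2 * k j * sech (2 * k j * (x - 4 * k j ^ 2 * t) + s j)
      = ∑ j, D j t (x - 4 * k j ^ 2 * t) := by
    simp only [hD, sub_add_cancel, Finset.sum_sub_distrib, multisoliton, Finset.mul_sum]
  simp only [h2]
  exact Finset.abs_sum_le_sum_abs _ _

end LateTime

/-! ### The potential `μ n sech (μ x)` as an `n`-soliton. -/

section SatsumaYajima

/-- The unimodular function `tanh x - i sech x`. -/
noncomputable def sechPhase (x : ℝ) : ℂ := (Real.sinh x - I) / Real.cosh x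

/-- The values at real spectral parameter `κ` of the Jost polynomials of the potential
`n sech x`, generated by Darboux transformations. -/
noncomputable def jostPoly : ℕ → ℝ → ℝ → ℂ
  | 0, _, _ => 1
  | n + 1, x, κ => κ * conj (jostPoly n x κ) + (n + 1 / 2) * sechPhase x * jostPoly n x κ

lemma exists_monic_jostPoly (n : ℕ) (x : ℝ) :
    ∃ p : Polynomial ℂ, p.Monic ∧ p.natDegree = n ∧ ∀ κ : ℝ, p.eval (κ : ℂ) = jostPoly n x κ := by
  induction n with
  | zero => exact ⟨1, Polynomial.monic_one, Polynomial.natDegree_one, fun κ => by simp [jostPoly]⟩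
  | succ n ih =>
    obtain ⟨p, hp, hd, he⟩ := ih
    set q := Polynomial.X * p.map (starRingEnd ℂ) with hq
    set r := Polynomial.C ((n + 1 / 2 : ℂ) * sechPhase x) * p with hr
    have hqm : q.Monic := Polynomial.monic_X.mul (hp.map _)
    have hqd : q.natDegree = n + 1 := by
      rw [hq, Polynomial.monic_X.natDegree_mul (hp.map _), Polynomial.natDegree_X,
        hp.natDegree_map, hd, add_comm]
    have hrd : r.degree < q.degree := by
      refine lt_of_le_of_lt (b := (n : WithBot ℕ)) ?_ ?_
      · refine (Polynomial.degree_le_of_natDegree_le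
          ((Polynomial.natDegree_C_mul_le _ _).trans hd.le))
      · rw [Polynomial.degree_eq_natDegree hqm.ne_zero, hqd]
        exact_mod_cast Nat.lt_succ_self n
    refine ⟨q + r, hqm.add_of_left hrd, ?_, fun κ => ?_⟩
    · rw [Polynomial.natDegree_add_eq_left_of_degree_lt hrd, hqd]
    · have h1 : (p.map (starRingEnd ℂ)).eval (κ : ℂ) = conj (p.eval (κ : ℂ)) := by
        have := Polynomial.eval_map_apply (f := starRingEnd ℂ) (p := p) (κ : ℂ)
        rwa [Complex.conj_ofReal] at this
      simp only [hq, hr, Polynomial.eval_add, Polynomial.eval_mul, Polynomial.eval_X,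
        Polynomial.eval_C, h1, he, jostPoly]

lemma hasDerivAt_sechPhase (x : ℝ) :
    HasDerivAt sechPhase (I * sech x * sechPhase x) x := by
  have hc : (Real.cosh x : ℂ) ≠ 0 := by exact_mod_cast (Real.cosh_pos x).ne'
  have h1 := ((Real.hasDerivAt_sinh x).ofReal_comp.sub_const I).div
    (Real.hasDerivAt_cosh x).ofReal_comp hc
  refine h1.congr_deriv ?_
  have h2 : (Real.cosh x : ℂ) ^ 2 = Real.sinh x ^ 2 + 1 := by exact_mod_cast Real.cosh_sq x
  simp only [sechPhase, sech]
  push_cast at hc h2 ⊢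
  field_simp
  linear_combination h2 + Complex.I_sq

lemma conj_sechPhase (x : ℝ) : conj (sechPhase x) = (Real.sinh x + I) / Real.cosh x := by
  rw [sechPhase, map_div₀, map_sub, Complex.conj_I, Complex.conj_ofReal, Complex.conj_ofReal,
    sub_neg_eq_add]

lemma sechPhase_mul_conj (x : ℝ) : sechPhase x * conj (sechPhase x) = 1 := by
  have hc : (Real.cosh x : ℂ) ≠ 0 := by exact_mod_cast (Real.cosh_pos x).ne'
  have h2 : (Real.cosh x : ℂ) ^ 2 = Real.sinh x ^ 2 + 1 := by exact_mod_cast Real.cosh_sq x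
  rw [conj_sechPhase, sechPhase]
  field_simp
  linear_combination -h2 - Complex.I_sq

lemma sechPhase_sub_conj (x : ℝ) : sechPhase x - conj (sechPhase x) = -2 * I * sech x := by
  rw [conj_sechPhase, sechPhase, sech]
  push_cast; ring

/-- Equivalently `exp (-κ x)` times the polynomial solves `φ' = i u φ - κ φ̄` with `u = n sech x`.
The inductive step is a Darboux transformation raising `n` by one, and rests on
`sechPhase_sub_conj`. -/
lemma hasDerivAt_jostPoly (n : ℕ) (x κ : ℝ) :
    HasDerivAt (fun y => jostPoly n y κ)
      (I * n * sech x * jostPoly n x κ + κ * (jostPoly n x κ - conj (jostPoly n x κ))) x := by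
  induction n with
  | zero =>
    refine (hasDerivAt_const x (1 : ℂ)).congr_deriv ?_
    simp [jostPoly]
  | succ n ih =>
    have hconj := Complex.conjCLE.toContinuousLinearMap.hasFDerivAt.comp_hasDerivAt x ih
    have h := (hconj.const_mul (κ : ℂ)).add
      (((hasDerivAt_sechPhase x).const_mul ((n : ℂ) + 1 / 2)).mul ih)
    refine h.congr_deriv ?_
    have hw := sechPhase_sub_conj x
    simp only [jostPoly, ContinuousLinearEquiv.coe_coe, Complex.conjCLE_apply,
      map_add, map_mul, map_sub, Complex.conj_I, Complex.conj_ofReal,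
      Complex.conj_conj, Complex.conj_natCast, map_div₀, map_one, map_ofNat]
    push_cast
    linear_combination (-(κ : ℂ) * (n + 1 / 2) * conj (jostPoly n x κ)) * hw

lemma eq_zero_of_hasDerivAt_mul {E lam : ℝ → ℂ} (hl : Continuous lam)
    (hE : ∀ x, HasDerivAt E (lam x * E x) x) (h0 : E 0 = 0) (x : ℝ) : E x = 0 := by
  have hL : ∀ y, HasDerivAt (fun y => ∫ s in (0 : ℝ)..y, lam s) (lam y) y := fun y =>
    intervalIntegral.integral_hasDerivAt_right (hl.intervalIntegrable _ _)
      (hl.stronglyMeasurableAtFilter _ _) hl.continuousAt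
  have hG : ∀ y, HasDerivAt (fun y => E y * Complex.exp (-∫ s in (0 : ℝ)..y, lam s)) 0 y := by
    intro y
    refine ((hE y).mul (hL y).neg.cexp).congr_deriv ?_
    ring
  have hconst := is_const_of_deriv_eq_zero (fun y => (hG y).differentiableAt)
    (fun y => (hG y).deriv) x 0
  rw [h0, zero_mul] at hconst
  exact (mul_eq_zero.1 hconst).resolve_right (Complex.exp_ne_zero _)

lemma continuous_sechPhase : Continuous sechPhase :=
  continuous_iff_continuousAt.2 fun x => (hasDerivAt_sechPhase x).continuousAt

lemma jostPoly_zero_neg (n : ℕ) (κ : ℝ) :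
    jostPoly n 0 (-κ) = (-1) ^ n * conj (jostPoly n 0 κ) := by
  induction n with
  | zero => simp [jostPoly]
  | succ n ih =>
    have hw : sechPhase 0 = -I := by simp [sechPhase]
    simp only [jostPoly, hw, ih, map_add, map_mul, map_pow, map_neg, Complex.conj_I, map_one,
      Complex.conj_ofReal, Complex.conj_conj, Complex.conj_natCast, map_div₀, map_ofNat]
    push_cast
    ring

/-- The difference of the two sides solves a scalar homogeneous linear equation and vanishes at `x =
0` by the parity of `jostPoly_zero_neg`. It supplies the bound-state relation at the node `n + 1/2`
created by the next Darboux step. -/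
lemma jostPoly_top_relation (n : ℕ) (x : ℝ) :
    sechPhase x * jostPoly n x (-(n + 1 / 2)) - conj (jostPoly n x (-(n + 1 / 2)))
      = -I * (-1) ^ n * Real.exp (-2 * (n + 1 / 2) * x)
        * (conj (jostPoly n x (n + 1 / 2)) + sechPhase x * jostPoly n x (n + 1 / 2)) := by
  set κ : ℝ := n + 1 / 2 with hκ
  set lam : ℝ → ℂ := fun y => I * sech y * (n + 1) - κ - κ * conj (sechPhase y) with hlam
  have hcont : Continuous lam := by
    have h1 := continuous_sechPhase
    have h2 := Complex.continuous_conj.comp h1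
    have h3 := Complex.continuous_ofReal.comp continuous_sech
    exact ((((continuous_const.mul h3).mul continuous_const).sub continuous_const).sub
      (continuous_const.mul h2))
  have hexp : ∀ y, HasDerivAt (fun y : ℝ => ((Real.exp (-2 * κ * y) : ℝ) : ℂ))
      (-2 * κ * Real.exp (-2 * κ * y)) y := by
    intro y
    have h1 : HasDerivAt (fun y : ℝ => -2 * κ * y) (-2 * κ) y := by
      simpa using (hasDerivAt_id y).const_mul (-2 * κ)
    refine h1.exp.ofReal_comp.congr_deriv ?_
    push_cast; ring
  have hE : ∀ y, HasDerivAt (fun y => sechPhase y * jostPoly n y (-κ) - conj (jostPoly n y (-κ))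
      + I * (-1) ^ n * (((Real.exp (-2 * κ * y) : ℝ) : ℂ)
        * (conj (jostPoly n y κ) + sechPhase y * jostPoly n y κ)))
      (lam y * (sechPhase y * jostPoly n y (-κ) - conj (jostPoly n y (-κ))
      + I * (-1) ^ n * (((Real.exp (-2 * κ * y) : ℝ) : ℂ)
        * (conj (jostPoly n y κ) + sechPhase y * jostPoly n y κ)))) y := by
    intro y
    have hw := hasDerivAt_sechPhase y
    have hm := hasDerivAt_jostPoly n y (-κ)
    have hp := hasDerivAt_jostPoly n y κ
    have hmc := Complex.conjCLE.toContinuousLinearMap.hasFDerivAt.comp_hasDerivAt y hm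
    have hpc := Complex.conjCLE.toContinuousLinearMap.hasFDerivAt.comp_hasDerivAt y hp
    have h := ((hw.mul hm).sub hmc).add
      (((hexp y).mul (hpc.add (hw.mul hp))).const_mul (I * (-1) ^ n))
    refine h.congr_deriv ?_
    have e1 := sechPhase_mul_conj y
    have e2 := sechPhase_sub_conj y
    have e3 : (κ : ℂ) = n + 1 / 2 := by rw [hκ]; push_cast; ring
    simp only [hlam, ContinuousLinearEquiv.coe_coe, Complex.conjCLE_apply, Pi.add_apply,
      Pi.mul_apply, Function.comp_apply, map_add, map_mul, map_sub, Complex.conj_I, Complex.conj_ofReal,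
      Complex.conj_conj, Complex.conj_natCast]
    push_cast
    generalize jostPoly n y (-κ) = a
    generalize jostPoly n y κ = b
    generalize conj a = a'
    generalize conj b = b'
    generalize Complex.exp (-2 * κ * y) = X
    generalize hww : conj (sechPhase y) = w' at *
    generalize sechPhase y = w at *
    generalize ((sech y : ℝ) : ℂ) = σ at *
    rw [e3]
    linear_combination (n + 1 / 2) * (a + I * (-1) ^ n * X * b) * e1
      + (n + 1 / 2) * (a' - I * (-1) ^ n * X * b') * e2
  have h0 := eq_zero_of_hasDerivAt_mul hcont hE (by
    have hw : sechPhase 0 = -I := by simp [sechPhase]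
    rw [jostPoly_zero_neg, hw]
    simp
    ring_nf
    simp) x
  linear_combination h0

/-- The bound-state condition linking the values at opposite spectral parameters. The recursion
preserves it at old nodes; the newest one comes from `jostPoly_top_relation`. -/
lemma jostPoly_neg_node (n j : ℕ) (hj : j < n) (x : ℝ) :
    jostPoly n x (-(j + 1 / 2)) = -I * (-1) ^ j * Real.exp (-2 * (j + 1 / 2) * x)
      * jostPoly n x (j + 1 / 2) := by
  induction n with
  | zero => omega
  | succ n ih =>
    rcases Nat.lt_succ_iff_lt_or_eq.1 hj with h | h
    · have h1 := ih h
      have h2 := congrArg conj h1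
      simp only [map_mul, map_neg, Complex.conj_I, map_pow, map_one, Complex.conj_ofReal] at h2
      simp only [jostPoly, h2]
      rw [h1]
      push_cast
      ring
    · subst h
      have h1 := jostPoly_top_relation j x
      simp only [jostPoly]
      push_cast at h1 ⊢
      linear_combination ((j : ℂ) + 1 / 2) * h1

/-- The squared norming constants of the potential `n sech x`. -/
noncomputable def sechNormingSq (n : ℕ) (j : Fin n) : ℝ :=
  (-1) ^ (j : ℕ) * (∏ m ∈ Finset.univ.erase j, ((m : ℝ) - j)⁻¹)
    * ∏ m : Fin n, (((j : ℝ) + 1 / 2) + ((m : ℝ) + 1 / 2))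

lemma sechNormingSq_pos (n : ℕ) (j : Fin n) : 0 < sechNormingSq n j := by
  refine mul_pos ?_ (Finset.prod_pos fun m _ => by positivity)
  -- Exactly `j` of the factors `m - j` are negative, and the sign compensates them.
  have h1 : ((-1 : ℝ)) ^ (j : ℕ) = ∏ m ∈ Finset.univ.erase j, if m < j then (-1 : ℝ) else 1 := by
    rw [Finset.prod_ite, Finset.prod_const_one, mul_one, Finset.prod_const]
    congr 1
    have : (Finset.univ.erase j).filter (fun m => m < j) = Finset.Iio j := by
      ext m
      simp only [Finset.mem_filter, Finset.mem_erase, Finset.mem_univ, and_true, Finset.mem_Iio]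
      exact ⟨fun h => h.2, fun h => ⟨h.ne, h⟩⟩
    rw [this, Fin.card_Iio]
  rw [h1, ← Finset.prod_mul_distrib]
  refine Finset.prod_pos fun m hm => ?_
  have hne : m ≠ j := Finset.ne_of_mem_erase hm
  split_ifs with h
  · have : (m : ℝ) < j := by exact_mod_cast h
    rw [neg_one_mul, neg_pos, inv_lt_zero]; linarith
  · have : (j : ℝ) < m := by exact_mod_cast lt_of_le_of_ne (not_lt.1 h) hne.symm
    rw [one_mul, inv_pos]; linarith

/-- Subtracting the nodal polynomial at the points `-(j + 1/2)` from the monic Jost polynomial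
leaves degree below `n`, so Lagrange interpolation is exact. Rewriting the values at negative nodes
by `jostPoly_neg_node` turns this expansion into the soliton system. -/
lemma jostPoly_partial_fractions (n : ℕ) (x : ℝ) (i : Fin n) :
    jostPoly n x (i + 1 / 2) / ((∏ m : Fin n, (((i : ℝ) + 1 / 2) + ((m : ℝ) + 1 / 2)) : ℝ) : ℂ)
      = 1 + ∑ j : Fin n, ((∏ m ∈ Finset.univ.erase j, ((m : ℝ) - j)⁻¹ : ℝ) : ℂ)
        * jostPoly n x (-(j + 1 / 2)) / ((((i : ℝ) + 1 / 2) + ((j : ℝ) + 1 / 2) : ℝ) : ℂ) := by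
  obtain ⟨p, hp, hd, he⟩ := exists_monic_jostPoly n x
  set v : Fin n → ℂ := fun m => ((-((m : ℝ) + 1 / 2) : ℝ) : ℂ) with hv
  have hinj : Set.InjOn v (Finset.univ : Finset (Fin n)) := by
    intro a _ b _ hab
    have h1 := Complex.ofReal_injective hab
    have h2 : (a : ℝ) = b := by linarith
    exact Fin.ext (by exact_mod_cast h2)
  have hdeg : (p - Lagrange.nodal Finset.univ v).degree < (Finset.univ : Finset (Fin n)).card := by
    have h1 : p.degree = n := by rw [Polynomial.degree_eq_natDegree hp.ne_zero, hd]
    have h2 : (Lagrange.nodal (Finset.univ : Finset (Fin n)) v).degree = n := by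
      rw [Lagrange.degree_nodal]; simp
    have := Polynomial.degree_sub_lt_left (h1.trans h2.symm) hp.ne_zero
      (by rw [hp.leadingCoeff, Lagrange.nodal_monic.leadingCoeff])
    rw [h1] at this
    simpa using this
  have hint := Lagrange.eq_interpolate_of_eval_eq (fun j => p.eval (v j)) hinj hdeg (fun j hj => by
    rw [Polynomial.eval_sub, Lagrange.eval_nodal_at_node hj, sub_zero])
  have hnode : ∀ j ∈ (Finset.univ : Finset (Fin n)), (((i : ℝ) + 1 / 2 : ℝ) : ℂ) ≠ v j := by
    intro j _ h
    have h1 := Complex.ofReal_injective h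
    have : (0 : ℝ) ≤ i := Nat.cast_nonneg _
    have : (0 : ℝ) ≤ j := Nat.cast_nonneg _
    linarith
  have h1 := congrArg (Polynomial.eval (((i : ℝ) + 1 / 2 : ℝ) : ℂ)) hint
  rw [Lagrange.eval_interpolate_not_at_node _ hnode, Polynomial.eval_sub, he] at h1
  have hnod : Polynomial.eval (((i : ℝ) + 1 / 2 : ℝ) : ℂ) (Lagrange.nodal Finset.univ v)
      = ((∏ m : Fin n, (((i : ℝ) + 1 / 2) + ((m : ℝ) + 1 / 2)) : ℝ) : ℂ) := by
    rw [Lagrange.eval_nodal, Complex.ofReal_prod]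
    refine Finset.prod_congr rfl fun m _ => ?_
    simp only [hv]; push_cast; ring
  have hne : ((∏ m : Fin n, (((i : ℝ) + 1 / 2) + ((m : ℝ) + 1 / 2)) : ℝ) : ℂ) ≠ 0 := by
    exact_mod_cast (Finset.prod_pos fun m _ => by positivity).ne'
  rw [hnod, sub_eq_iff_eq_add] at h1
  rw [div_eq_iff hne, h1, add_mul, one_mul, add_comm, mul_comm]
  congr 2
  refine Finset.sum_congr rfl fun j _ => ?_
  have hw : Lagrange.nodalWeight Finset.univ v j
      = ((∏ m ∈ Finset.univ.erase j, ((m : ℝ) - j)⁻¹ : ℝ) : ℂ) := by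
    rw [Lagrange.nodalWeight, Complex.ofReal_prod]
    refine Finset.prod_congr rfl fun m _ => ?_
    rw [Complex.ofReal_inv]
    congr 1
    simp only [hv]; push_cast; ring
  rw [hw, show v j = ((-((j : ℝ) + 1 / 2) : ℝ) : ℂ) from rfl, he, ← Complex.ofReal_sub,
    sub_neg_eq_add]
  ring

/-- The spectral parameters of the potential `μ n sech (μ x)`. -/
noncomputable def sechSpectrum (μ : ℝ) (n : ℕ) (j : Fin n) : ℝ := μ * (j + 1 / 2)

/-- The norming constants of the potential `μ n sech (μ x)`. -/
noncomputable def sechNorming (μ : ℝ) (n : ℕ) (j : Fin n) : ℝ :=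
  Real.sqrt μ * Real.sqrt (sechNormingSq n j)

lemma sechSpectrum_pos {μ : ℝ} (hμ : 0 < μ) (n : ℕ) (j : Fin n) : 0 < sechSpectrum μ n j := by
  unfold sechSpectrum; positivity

lemma sechSpectrum_injective {μ : ℝ} (hμ : 0 < μ) (n : ℕ) :
    Function.Injective (sechSpectrum μ n) := by
  intro a b h
  have h1 := mul_left_cancel₀ hμ.ne' h
  have h2 : (a : ℝ) = b := by linarith
  exact Fin.ext (by exact_mod_cast h2)

lemma sechNorming_pos {μ : ℝ} (hμ : 0 < μ) (n : ℕ) (j : Fin n) : 0 < sechNorming μ n j :=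
  mul_pos (Real.sqrt_pos.2 hμ) (Real.sqrt_pos.2 (sechNormingSq_pos n j))

/-- The candidate eigenfunctions of the potential `n sech x`. -/
noncomputable def sechWave (n : ℕ) (x : ℝ) (j : Fin n) : ℂ :=
  (solitonExp (sechSpectrum 1 n) (sechNorming 1 n) 0 x j : ℂ) * (jostPoly n x (j + 1 / 2)
    / ((∏ m : Fin n, (((j : ℝ) + 1 / 2) + ((m : ℝ) + 1 / 2)) : ℝ) : ℂ))

lemma sechWave_system (n : ℕ) (x : ℝ) :
    SolitonSystem (sechSpectrum 1 n) (solitonExp (sechSpectrum 1 n) (sechNorming 1 n) 0 x)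
      (sechWave n x) := by
  intro i
  set v := solitonExp (sechSpectrum 1 n) (sechNorming 1 n) 0 x with hv
  have hvsq : ∀ j, v j ^ 2 = sechNormingSq n j * Real.exp (-2 * (j + 1 / 2) * x) := by
    intro j
    simp only [hv, solitonExp, sechNorming, sechSpectrum, Real.sqrt_one, one_mul, mul_zero,
      add_zero]
    rw [mul_pow, Real.sq_sqrt (sechNormingSq_pos n j).le, ← Real.exp_nat_mul]
    congr 2; push_cast; ring
  have hterm : ∀ j, I * (solitonKernel (sechSpectrum 1 n) v i j * sechWave n x j)
      = -(v i * (((∏ m ∈ Finset.univ.erase j, ((m : ℝ) - j)⁻¹ : ℝ) : ℂ)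
        * jostPoly n x (-(j + 1 / 2)) / ((((i : ℝ) + 1 / 2) + ((j : ℝ) + 1 / 2) : ℝ) : ℂ))) := by
    intro j
    have h1 := hvsq j
    rw [sechNormingSq] at h1
    have h2 : (v j : ℂ) ^ 2 = (((-1) ^ (j : ℕ) * (∏ m ∈ Finset.univ.erase j, ((m : ℝ) - j)⁻¹)
        * ∏ m : Fin n, (((j : ℝ) + 1 / 2) + ((m : ℝ) + 1 / 2)) : ℝ) : ℂ)
        * ((Real.exp (-2 * (j + 1 / 2) * x) : ℝ) : ℂ) := by exact_mod_cast h1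
    rw [jostPoly_neg_node n j j.2, sechWave]
    rw [← hv]
    have hne : ((∏ m : Fin n, (((j : ℝ) + 1 / 2) + ((m : ℝ) + 1 / 2)) : ℝ) : ℂ) ≠ 0 := by
      exact_mod_cast (Finset.prod_pos fun m _ => by positivity).ne'
    have hne2 : ((((i : ℝ) + 1 / 2) + ((j : ℝ) + 1 / 2) : ℝ) : ℂ) ≠ 0 := by
      exact_mod_cast (by positivity : (0 : ℝ) < ((i : ℝ) + 1 / 2) + ((j : ℝ) + 1 / 2)).ne'
    have hker : solitonKernel (sechSpectrum 1 n) v i j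
        = v i * v j / ((((i : ℝ) + 1 / 2) + ((j : ℝ) + 1 / 2) : ℝ) : ℂ) := by
      simp only [solitonKernel, sechSpectrum, one_mul]; push_cast; ring
    rw [hker]
    simp only [Complex.ofReal_mul] at h2
    generalize ((∏ m : Fin n, (((j : ℝ) + 1 / 2) + ((m : ℝ) + 1 / 2)) : ℝ) : ℂ) = D at *
    generalize ((((i : ℝ) + 1 / 2) + ((j : ℝ) + 1 / 2) : ℝ) : ℂ) = d at *
    generalize ((∏ m ∈ Finset.univ.erase j, ((m : ℝ) - j)⁻¹ : ℝ) : ℂ) = W at *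
    generalize jostPoly n x (j + 1 / 2) = P at *
    generalize ((Real.exp (-2 * (j + 1 / 2) * x) : ℝ) : ℂ) = E at *
    push_cast at h2
    field_simp
    linear_combination v i * P * h2
  rw [Finset.mul_sum, Finset.sum_congr rfl fun j _ => hterm j, Finset.sum_neg_distrib,
    ← Finset.mul_sum, sechWave, jostPoly_partial_fractions]
  ring

/-- The vector `sechWave` solves the soliton system, hence is the wave vector. It satisfies the
spectral equation with potential `n sech x` as well as with the multisoliton; at a nonzero component
the potentials must coincide. -/
lemma multisoliton_sech_one {n : ℕ} (hn : 0 < n) (x : ℝ) :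
    multisoliton (sechSpectrum 1 n) (sechNorming 1 n) 0 x = n * sech x := by
  have hk := sechSpectrum_pos one_pos n
  have hwave : ∀ y, solitonWave (sechSpectrum 1 n) (sechNorming 1 n) 0 y = sechWave n y :=
    fun y => (solitonWave_system _ _ 0 y).unique (sechWave_system n y)
  have hd : ∀ j, HasDerivAt (fun y => sechWave n y j)
      (I * (n * sech x) * sechWave n x j - sechSpectrum 1 n j * conj (sechWave n x j)) x := by
    intro j
    have h1 := (hasDerivAt_solitonExp_x (sechSpectrum 1 n) (sechNorming 1 n) 0 x j).ofReal_comp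
    have h2 := (hasDerivAt_jostPoly n x (j + 1 / 2)).div_const
      ((∏ m : Fin n, (((j : ℝ) + 1 / 2) + ((m : ℝ) + 1 / 2)) : ℝ) : ℂ)
    refine (h1.mul h2).congr_deriv ?_
    have h3 : sechSpectrum 1 n j = j + 1 / 2 := by simp [sechSpectrum]
    rw [h3]
    simp only [sechWave, map_mul, map_div₀, Complex.conj_ofReal]
    push_cast
    ring
  have hnz : ∃ j, sechWave n x j ≠ 0 := by
    by_contra! h
    have h1 := sechWave_system n x ⟨0, hn⟩
    simp only [h, mul_zero, Finset.sum_const_zero, add_zero] at h1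
    have h2 := solitonExp_pos (k := sechSpectrum 1 n) (sechNorming_pos one_pos n) 0 x ⟨0, hn⟩
    exact h2.ne (by exact_mod_cast h1)
  obtain ⟨j, hj⟩ := hnz
  have h1 := hasDerivAt_solitonWave hk (sechNorming 1 n) 0 x j
  simp only [hwave] at h1
  have h2 := h1.unique (hd j)
  have h3 : (multisoliton (sechSpectrum 1 n) (sechNorming 1 n) 0 x : ℂ) = n * sech x := by
    have h4 : I * sechWave n x j
        * ((multisoliton (sechSpectrum 1 n) (sechNorming 1 n) 0 x : ℂ) - n * sech x) = 0 := by
      linear_combination h2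
    exact sub_eq_zero.1 ((mul_eq_zero.1 h4).resolve_left (mul_ne_zero Complex.I_ne_zero hj))
  exact_mod_cast h3

lemma multisoliton_sech {μ : ℝ} (hμ : 0 < μ) {n : ℕ} (hn : 0 < n) (x : ℝ) :
    multisoliton (sechSpectrum μ n) (sechNorming μ n) 0 x = μ * n * sech (μ * x) := by
  have hs : (Real.sqrt μ : ℂ) ^ 2 = μ := by exact_mod_cast Real.sq_sqrt hμ.le
  have hexp : ∀ j, solitonExp (sechSpectrum μ n) (sechNorming μ n) 0 x j
      = Real.sqrt μ * solitonExp (sechSpectrum 1 n) (sechNorming 1 n) 0 (μ * x) j := by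
    intro j
    simp only [solitonExp, sechSpectrum, sechNorming, Real.sqrt_one]
    ring_nf
  have hker : ∀ i j, solitonKernel (sechSpectrum μ n)
      (solitonExp (sechSpectrum μ n) (sechNorming μ n) 0 x) i j
      = solitonKernel (sechSpectrum 1 n)
        (solitonExp (sechSpectrum 1 n) (sechNorming 1 n) 0 (μ * x)) i j := by
    intro i j
    simp only [solitonKernel]
    congr 1
    rw [hexp, hexp]
    have h1 : sechSpectrum μ n i + sechSpectrum μ n j
        = μ * (sechSpectrum 1 n i + sechSpectrum 1 n j) := by simp only [sechSpectrum]; ring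
    have h2 : sechSpectrum 1 n i + sechSpectrum 1 n j ≠ 0 :=
      (add_pos (sechSpectrum_pos one_pos n i) (sechSpectrum_pos one_pos n j)).ne'
    have h3 := Real.sq_sqrt hμ.le
    rw [h1]
    field_simp
    linear_combination (solitonExp (sechSpectrum 1 n) (sechNorming 1 n) 0 (μ * x) i *
      solitonExp (sechSpectrum 1 n) (sechNorming 1 n) 0 (μ * x) j) * h3
  have hwave : solitonWave (sechSpectrum μ n) (sechNorming μ n) 0 x = fun j =>
      (Real.sqrt μ : ℂ) * solitonWave (sechSpectrum 1 n) (sechNorming 1 n) 0 (μ * x) j := by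
    refine (solitonWave_system _ _ 0 x).unique fun i => ?_
    have h1 := solitonWave_system (sechSpectrum 1 n) (sechNorming 1 n) 0 (μ * x) i
    simp only [hker, mul_left_comm _ (Real.sqrt μ : ℂ), ← Finset.mul_sum]
    rw [hexp, Complex.ofReal_mul, ← h1]
    ring
  have h1 := multisoliton_sech_one hn (μ * x)
  rw [multisoliton] at h1 ⊢
  have h2 : ∀ j, ‖solitonWave (sechSpectrum μ n) (sechNorming μ n) 0 x j‖ ^ 2
      = μ * ‖solitonWave (sechSpectrum 1 n) (sechNorming 1 n) 0 (μ * x) j‖ ^ 2 := by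
    intro j
    rw [hwave, norm_mul, mul_pow, Complex.norm_real, Real.norm_eq_abs, sq_abs, Real.sq_sqrt hμ.le]
  simp only [h2, ← Finset.mul_sum]
  linear_combination μ * h1

end SatsumaYajima

/-! ### Fourier transform and weight estimates. -/

section FourierBasics

lemma one_le_sqrt_two_pi : 1 ≤ Real.sqrt (2 * Real.pi) := by
  rw [Real.one_le_sqrt]; linarith [Real.two_le_pi]

lemma norm_fourier_prefactor_le :
    ‖(((Real.sqrt (2 * Real.pi) : ℝ) : ℂ))⁻¹‖ ≤ 1 := by
  rw [norm_inv, Complex.norm_real, Real.norm_of_nonneg (Real.sqrt_nonneg _)]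
  exact inv_le_one_of_one_le₀ one_le_sqrt_two_pi

lemma norm_exp_neg_I_mul (x ξ : ℝ) : ‖Complex.exp (-(I * (x : ℂ) * (ξ : ℂ)))‖ = 1 := by
  rw [Complex.norm_exp]
  simp

lemma integrable_fourier_integrand {f : ℝ → ℝ} (hf : Integrable f) (ξ : ℝ) :
    Integrable fun x : ℝ => Complex.exp (-(I * (x : ℂ) * (ξ : ℂ))) * (f x : ℂ) := by
  refine hf.ofReal.bdd_mul (c := 1) (by fun_prop) (Eventually.of_forall fun x => ?_)
  exact (norm_exp_neg_I_mul x ξ).le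

lemma norm_fourierHat_le (f : ℝ → ℝ) (ξ : ℝ) : ‖fourierHat f ξ‖ ≤ ∫ x, |f x| := by
  rw [fourierHat, norm_mul]
  refine (mul_le_of_le_one_left (norm_nonneg _) norm_fourier_prefactor_le).trans ?_
  refine (norm_integral_le_integral_norm _).trans (le_of_eq ?_)
  refine integral_congr_ae (Eventually.of_forall fun x => ?_)
  simp only [norm_mul, norm_exp_neg_I_mul, one_mul, Complex.norm_real, Real.norm_eq_abs]

lemma fourierHat_sub {f g : ℝ → ℝ} (hf : Integrable f) (hg : Integrable g) (ξ : ℝ) :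
    fourierHat (fun x => f x - g x) ξ = fourierHat f ξ - fourierHat g ξ := by
  simp only [fourierHat, Complex.ofReal_sub, mul_sub]
  rw [integral_sub (integrable_fourier_integrand hf ξ) (integrable_fourier_integrand hg ξ), mul_sub]

lemma fourierHat_sum {ι : Type*} (s : Finset ι) {f : ι → ℝ → ℝ} (hf : ∀ i ∈ s, Integrable (f i))
    (ξ : ℝ) : fourierHat (fun x => ∑ i ∈ s, f i x) ξ = ∑ i ∈ s, fourierHat (f i) ξ := by
  simp only [fourierHat, Complex.ofReal_sum, Finset.mul_sum]
  rw [integral_finsetSum _ fun i hi => integrable_fourier_integrand (hf i hi) ξ, Finset.mul_sum]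

lemma continuous_fourierHat {f : ℝ → ℝ} (hf : Integrable f) : Continuous (fourierHat f) := by
  refine continuous_const.mul (continuous_of_dominated (bound := fun x => |f x|)
    (fun ξ => (integrable_fourier_integrand hf ξ).aestronglyMeasurable)
    (fun ξ => Eventually.of_forall fun x => ?_) hf.abs (Eventually.of_forall fun x => ?_))
  · rw [norm_mul, norm_exp_neg_I_mul, one_mul, Complex.norm_real, Real.norm_eq_abs]
  · fun_prop

lemma fourierHat_const_mul (a : ℝ) (f : ℝ → ℝ) (ξ : ℝ) :
    fourierHat (fun x => a * f x) ξ = a * fourierHat f ξ := by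
  simp only [fourierHat, Complex.ofReal_mul, mul_left_comm _ (a : ℂ)]
  rw [integral_const_mul]; ring

/-- The transform of a rescaled and translated profile. -/
lemma fourierHat_scale (g : ℝ → ℝ) {κ : ℝ} (hκ : 0 < κ) (a ξ : ℝ) :
    fourierHat (fun x => κ * g (κ * (x - a))) ξ
      = Complex.exp (-(I * (a : ℂ) * (ξ : ℂ))) * fourierHat g (ξ / κ) := by
  rw [fourierHat_const_mul]
  have hκ' : (κ : ℂ) ≠ 0 := by exact_mod_cast hκ.ne'
  have h1 : ∫ x : ℝ, Complex.exp (-(I * (x : ℂ) * (ξ : ℂ))) * (g (κ * (x - a)) : ℂ)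
      = ∫ x : ℝ, Complex.exp (-(I * ((x + a : ℝ) : ℂ) * (ξ : ℂ))) * (g (κ * x) : ℂ) := by
    rw [← integral_add_right_eq_self (fun x : ℝ =>
      Complex.exp (-(I * (x : ℂ) * (ξ : ℂ))) * (g (κ * (x - a)) : ℂ)) a]
    simp only [add_sub_cancel_right]
  have h2 : ∫ x : ℝ, Complex.exp (-(I * ((x + a : ℝ) : ℂ) * (ξ : ℂ))) * (g (κ * x) : ℂ)
      = Complex.exp (-(I * (a : ℂ) * (ξ : ℂ)))
        * ∫ x : ℝ, Complex.exp (-(I * ((κ * x : ℝ) : ℂ) * ((ξ / κ : ℝ) : ℂ))) * (g (κ * x) : ℂ) := by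
    rw [← integral_const_mul]
    refine integral_congr_ae (Eventually.of_forall fun x => ?_)
    simp only
    rw [← mul_assoc, ← Complex.exp_add]
    congr 2
    push_cast
    field_simp
    ring
  have h3 := Measure.integral_comp_mul_left (fun y : ℝ =>
    Complex.exp (-(I * (y : ℂ) * ((ξ / κ : ℝ) : ℂ))) * (g y : ℂ)) κ
  rw [fourierHat, h1, h2, h3, fourierHat, abs_of_pos (inv_pos.2 hκ), Complex.real_smul]
  push_cast
  field_simp

lemma fourierHat_eq_fourier (f : ℝ → ℝ) (ξ : ℝ) :
    fourierHat f ξ = ((Real.sqrt (2 * Real.pi) : ℝ) : ℂ)⁻¹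
      * FourierTransform.fourier (fun x : ℝ => (f x : ℂ)) (ξ / (2 * Real.pi)) := by
  rw [fourierHat, Real.fourier_real_eq_integral_exp_smul]
  congr 1
  refine integral_congr_ae (Eventually.of_forall fun x => ?_)
  simp only [smul_eq_mul]
  congr 2
  push_cast
  have : (Real.pi : ℂ) ≠ 0 := by exact_mod_cast Real.pi_ne_zero
  field_simp

lemma pow_mul_norm_fourierHat_le {f : ℝ → ℝ} (hf : ContDiff ℝ (⊤ : ℕ∞) fun x => (f x : ℂ))
    (hint : ∀ n, Integrable (iteratedDeriv n fun x => (f x : ℂ))) (m : ℕ) (ξ : ℝ) :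
    |ξ| ^ m * ‖fourierHat f ξ‖ ≤ ∫ x, ‖iteratedDeriv m (fun x => (f x : ℂ)) x‖ := by
  have h1 := congrFun (Real.fourier_iteratedDeriv (N := ⊤) (n := m) hf (fun n _ => hint n) le_top)
    (ξ / (2 * Real.pi))
  have h2 := congrArg norm h1
  rw [norm_smul, norm_pow] at h2
  have h3 : ‖2 * (Real.pi : ℂ) * I * ((ξ / (2 * Real.pi) : ℝ) : ℂ)‖ = |ξ| := by
    have : 2 * (Real.pi : ℂ) * I * ((ξ / (2 * Real.pi) : ℝ) : ℂ) = I * (ξ : ℂ) := by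
      have : (Real.pi : ℂ) ≠ 0 := by exact_mod_cast Real.pi_ne_zero
      push_cast; field_simp
    rw [this, norm_mul, Complex.norm_I, one_mul, Complex.norm_real, Real.norm_eq_abs]
  rw [h3] at h2
  rw [fourierHat_eq_fourier, norm_mul, ← mul_left_comm, ← h2]
  refine (mul_le_of_le_one_left (norm_nonneg _) norm_fourier_prefactor_le).trans ?_
  rw [Real.fourier_real_eq]
  refine (norm_integral_le_integral_norm _).trans (le_of_eq ?_)
  simp only [Circle.norm_smul]

lemma one_le_japaneseBracket (ξ : ℝ) : 1 ≤ japaneseBracket ξ := by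
  rw [japaneseBracket, Real.one_le_sqrt]; nlinarith [sq_nonneg ξ]

lemma japaneseBracket_pos (ξ : ℝ) : 0 < japaneseBracket ξ :=
  zero_lt_one.trans_le (one_le_japaneseBracket ξ)

lemma continuous_japaneseBracket : Continuous japaneseBracket := by
  unfold japaneseBracket; fun_prop

lemma continuous_japaneseBracket_rpow (r : ℝ) : Continuous fun ξ => japaneseBracket ξ ^ r :=
  continuous_japaneseBracket.rpow_const fun ξ => Or.inl (japaneseBracket_pos ξ).ne'

lemma japaneseBracket_le_add (ξ : ℝ) : japaneseBracket ξ ≤ 1 + |ξ| := by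
  rw [japaneseBracket]
  refine Real.sqrt_le_iff.2 ⟨by positivity, ?_⟩
  nlinarith [sq_abs ξ, abs_nonneg ξ]

lemma japaneseBracket_rpow_le (r : ℝ) :
    ∃ m : ℕ, ∀ ξ, japaneseBracket ξ ^ r ≤ 2 ^ m * (1 + |ξ| ^ m) := by
  obtain ⟨m, hm⟩ := exists_nat_ge r
  refine ⟨m, fun ξ => ?_⟩
  calc japaneseBracket ξ ^ r ≤ japaneseBracket ξ ^ (m : ℝ) :=
        Real.rpow_le_rpow_of_exponent_le (one_le_japaneseBracket ξ) hm
    _ = japaneseBracket ξ ^ m := Real.rpow_natCast _ _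
    _ ≤ (1 + |ξ|) ^ m := pow_le_pow_left₀ (japaneseBracket_pos ξ).le (japaneseBracket_le_add ξ) m
    _ ≤ 2 ^ m * (1 + |ξ| ^ m) := by
        rcases le_total |ξ| 1 with h | h
        · calc (1 + |ξ|) ^ m ≤ 2 ^ m := pow_le_pow_left₀ (by positivity) (by linarith) m
            _ ≤ 2 ^ m * (1 + |ξ| ^ m) := le_mul_of_one_le_right (by positivity)
              (by linarith [pow_nonneg (abs_nonneg ξ) m])
        · calc (1 + |ξ|) ^ m ≤ (2 * |ξ|) ^ m := pow_le_pow_left₀ (by positivity) (by linarith) m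
            _ = 2 ^ m * |ξ| ^ m := mul_pow _ _ _
            _ ≤ 2 ^ m * (1 + |ξ| ^ m) := by gcongr; linarith

lemma japaneseBracket_rpow_eq (ξ r : ℝ) : japaneseBracket ξ ^ r = (1 + ‖ξ‖ ^ 2) ^ (r / 2) := by
  rw [japaneseBracket, Real.sqrt_eq_rpow, ← Real.rpow_mul (by positivity), Real.norm_eq_abs, sq_abs]
  congr 1; ring

lemma integrable_japaneseBracket_rpow {r : ℝ} (hr : r < -1) :
    Integrable fun ξ => japaneseBracket ξ ^ r := by
  have := integrable_rpow_neg_one_add_norm_sq (E := ℝ) (μ := volume) (r := -r) (by simp; linarith)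
  simpa only [japaneseBracket_rpow_eq, neg_neg] using this

end FourierBasics

/-! ### Time-uniform Fourier decay of multisolitons. -/

section SolitonFourier

variable {ι : Type*} [Fintype ι] [DecidableEq ι] {k c : ι → ℝ}

lemma integrable_exp_translate {ι : Type*} {k : ι → ℝ} (hk : ∀ i, 0 < k i) (t : ℝ) (i : ι) :
    Integrable fun x : ℝ => Real.exp (-k i * |x - 4 * k i ^ 2 * t|) :=
  (integrable_exp_neg_mul_abs (hk i)).comp_sub_right (4 * k i ^ 2 * t)

/-- The dominating exponentials merely translate with time, which makes the `L¹` bound uniform in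
`t`. -/
lemma SolitonPoly.integrable (hk : ∀ i, 0 < k i) (hinj : Function.Injective k)
    (hc : ∀ i, 0 < c i) {f : ℝ → ℝ → ℂ} (hf : SolitonPoly k c f) :
    ∃ C, ∀ t, Integrable (f t) ∧ ∫ x, ‖f t x‖ ≤ C := by
  obtain ⟨C, hC, h⟩ := hf.exists_bound hk hinj hc
  have hint : ∀ t, Integrable fun x => C * ∑ i, Real.exp (-k i * |x - 4 * k i ^ 2 * t|) :=
    fun t => (integrable_finsetSum _ fun i _ => integrable_exp_translate hk t i).const_mul C
  have hcont : ∀ t, Continuous (f t) := fun t =>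
    hf.continuous.comp (f := fun x : ℝ => (t, x)) (by fun_prop)
  have hfi : ∀ t, Integrable (f t) := fun t =>
    (hint t).mono' (hcont t).aestronglyMeasurable (Eventually.of_forall (h t))
  refine ⟨C * ∑ i, ∫ x, Real.exp (-k i * |x|), fun t => ⟨hfi t, ?_⟩⟩
  refine (integral_mono (hfi t).norm (hint t) (h t)).trans (le_of_eq ?_)
  rw [integral_const_mul, integral_finsetSum _ fun i _ => integrable_exp_translate hk t i]
  congr 1
  refine Finset.sum_congr rfl fun i _ => ?_
  exact integral_sub_right_eq_self (fun x => Real.exp (-k i * |x|)) _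

lemma integrable_multisoliton (hk : ∀ i, 0 < k i) (hinj : Function.Injective k)
    (hc : ∀ i, 0 < c i) (t : ℝ) : Integrable (multisoliton k c t) := by
  obtain ⟨C, h⟩ := (SolitonPoly.multisoliton k c).integrable hk hinj hc
  simpa using (h t).1.re

/-- The Fourier transform of a multisoliton decays rapidly, uniformly in time. -/
lemma exists_multisoliton_fourier_decay (hk : ∀ i, 0 < k i) (hinj : Function.Injective k)
    (hc : ∀ i, 0 < c i) (r : ℝ) :
    ∃ C, 0 ≤ C ∧ ∀ t ξ, japaneseBracket ξ ^ r * ‖fourierHat (multisoliton k c t) ξ‖ ≤ C := by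
  obtain ⟨m, hm⟩ := japaneseBracket_rpow_le r
  have hpoly := fun n => (SolitonPoly.multisoliton k c).iteratedDeriv hk n
  choose C hC using fun n => (hpoly n).integrable hk hinj hc
  have hbd : ∀ n t ξ, |ξ| ^ n * ‖fourierHat (multisoliton k c t) ξ‖ ≤ C n := fun n t ξ =>
    (pow_mul_norm_fourierHat_le ((SolitonPoly.multisoliton k c).contDiff hk t)
      (fun j => (hC j t).1) n ξ).trans (hC n t).2
  have h0 : ∀ t ξ, ‖fourierHat (multisoliton k c t) ξ‖ ≤ C 0 := fun t ξ => by
    simpa using hbd 0 t ξ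
  refine ⟨2 ^ m * (C 0 + C m), ?_, fun t ξ => ?_⟩
  · have h1 := (norm_nonneg _).trans (h0 0 0)
    have h2 := (mul_nonneg (pow_nonneg (abs_nonneg 0) m) (norm_nonneg _)).trans (hbd m 0 0)
    positivity
  · refine (mul_le_mul_of_nonneg_right (hm ξ) (norm_nonneg _)).trans ?_
    rw [mul_assoc, add_mul, one_mul]
    exact mul_le_mul_of_nonneg_left (add_le_add (h0 t ξ) (hbd m t ξ)) (by positivity)

/-- The Fourier transform of the soliton profile. -/
noncomputable def sechHat : ℝ → ℂ := fourierHat sech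

lemma continuous_sechHat : Continuous sechHat := continuous_fourierHat integrable_sech

/-- The profile `sech` is itself the multisoliton with `μ = n = 1` at time `0`, so its decay is a
special case. -/
lemma exists_sechHat_decay (r : ℝ) :
    ∃ C, 0 ≤ C ∧ ∀ ξ, japaneseBracket ξ ^ r * ‖sechHat ξ‖ ≤ C := by
  obtain ⟨C, hC, h⟩ := exists_multisoliton_fourier_decay (sechSpectrum_pos one_pos 1)
    (sechSpectrum_injective one_pos 1) (sechNorming_pos one_pos 1) r
  refine ⟨C, hC, fun ξ => ?_⟩
  have h1 : multisoliton (sechSpectrum 1 1) (sechNorming 1 1) 0 = sech := by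
    funext x
    rw [multisoliton_sech_one one_pos]; simp
  have := h 0 ξ
  rwa [h1] at this

lemma sechHat_zero_ne : sechHat 0 ≠ 0 := by
  have h1 : 0 < ∫ x, sech x := integral_pos_of_integrable_nonneg_nonzero continuous_sech
    integrable_sech (fun x => (sech_pos x).le) (sech_pos 0).ne'
  have h2 : sechHat 0 = ((Real.sqrt (2 * Real.pi) : ℝ) : ℂ)⁻¹ * ((∫ x, sech x : ℝ) : ℂ) := by
    rw [sechHat, fourierHat, ← integral_complex_ofReal]
    simp
  rw [h2]
  refine mul_ne_zero (inv_ne_zero ?_) (by exact_mod_cast h1.ne')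
  exact_mod_cast (zero_lt_one.trans_le one_le_sqrt_two_pi).ne'

end SolitonFourier

/-! ### Calculus of rapidly decaying functions. -/

section RapidDecay

/-- Continuous functions decaying faster than any power. -/
structure RapidDecay (F : ℝ → ℂ) : Prop where
  continuous : Continuous F
  decay : ∀ r : ℝ, ∃ C, 0 ≤ C ∧ ∀ ξ, japaneseBracket ξ ^ r * ‖F ξ‖ ≤ C

lemma RapidDecay.bounded {F : ℝ → ℂ} (hF : RapidDecay F) : ∃ C, 0 ≤ C ∧ ∀ ξ, ‖F ξ‖ ≤ C := by
  simpa using hF.decay 0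

lemma RapidDecay.mul {F G : ℝ → ℂ} (hF : RapidDecay F) (hG : RapidDecay G) :
    RapidDecay fun ξ => F ξ * G ξ := by
  refine ⟨hF.continuous.mul hG.continuous, fun r => ?_⟩
  obtain ⟨C, hC, h⟩ := hF.decay r
  obtain ⟨D, hD, h'⟩ := hG.bounded
  refine ⟨C * D, by positivity, fun ξ => ?_⟩
  rw [norm_mul, ← mul_assoc]
  exact mul_le_mul (h ξ) (h' ξ) (norm_nonneg _) hC

lemma RapidDecay.star {F : ℝ → ℂ} (hF : RapidDecay F) : RapidDecay fun ξ => conj (F ξ) :=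
  ⟨Complex.continuous_conj.comp hF.continuous, fun r => by
    simpa only [RCLike.norm_conj] using hF.decay r⟩

lemma RapidDecay.sum {σ : Type*} (s : Finset σ) {F : σ → ℝ → ℂ} (hF : ∀ i ∈ s, RapidDecay (F i)) :
    RapidDecay fun ξ => ∑ i ∈ s, F i ξ := by
  refine ⟨continuous_finsetSum _ fun i hi => (hF i hi).continuous, fun r => ?_⟩
  choose! C hC h using fun i (hi : i ∈ s) => (hF i hi).decay r
  refine ⟨∑ i ∈ s, C i, Finset.sum_nonneg hC, fun ξ => ?_⟩
  refine (mul_le_mul_of_nonneg_left (norm_sum_le _ _)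
    (Real.rpow_nonneg (japaneseBracket_pos ξ).le r)).trans ?_
  rw [Finset.mul_sum]
  exact Finset.sum_le_sum fun i hi => h i hi ξ

lemma RapidDecay.const_mul {F : ℝ → ℂ} (hF : RapidDecay F) (z : ℂ) :
    RapidDecay fun ξ => z * F ξ := by
  refine ⟨continuous_const.mul hF.continuous, fun r => ?_⟩
  obtain ⟨C, hC, h⟩ := hF.decay r
  refine ⟨‖z‖ * C, by positivity, fun ξ => ?_⟩
  rw [norm_mul, mul_left_comm]
  exact mul_le_mul_of_nonneg_left (h ξ) (norm_nonneg z)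

lemma RapidDecay.exp_mul {F : ℝ → ℂ} (hF : RapidDecay F) (a : ℝ) :
    RapidDecay fun ξ => Complex.exp (-(I * (a : ℂ) * (ξ : ℂ))) * F ξ := by
  refine ⟨Continuous.mul (by fun_prop) hF.continuous, fun r => ?_⟩
  simpa only [norm_mul, norm_exp_neg_I_mul, one_mul] using hF.decay r

lemma japaneseBracket_mul_le {κ : ℝ} (hκ : 0 < κ) (ξ : ℝ) :
    japaneseBracket (κ * ξ) ≤ (1 + κ) * japaneseBracket ξ := by
  rw [japaneseBracket]
  refine Real.sqrt_le_iff.2 ⟨by have := japaneseBracket_pos ξ; positivity, ?_⟩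
  rw [mul_pow, mul_pow, japaneseBracket, Real.sq_sqrt (by positivity)]
  nlinarith [sq_nonneg ξ, mul_pos hκ hκ, mul_nonneg hκ.le (sq_nonneg ξ)]

lemma RapidDecay.comp_div {F : ℝ → ℂ} (hF : RapidDecay F) {κ : ℝ} (hκ : 0 < κ) :
    RapidDecay fun ξ => F (ξ / κ) := by
  refine ⟨hF.continuous.comp (continuous_id.div_const κ), fun r => ?_⟩
  obtain ⟨C, hC, h⟩ := hF.decay |r|
  refine ⟨(1 + κ) ^ |r| * C, by positivity, fun ξ => ?_⟩
  have hpos := (japaneseBracket_pos (ξ / κ)).le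
  have h1 : japaneseBracket ξ ^ r ≤ (1 + κ) ^ |r| * japaneseBracket (ξ / κ) ^ |r| := by
    rw [← Real.mul_rpow (by positivity) hpos]
    refine (Real.rpow_le_rpow_of_exponent_le (one_le_japaneseBracket ξ) (le_abs_self r)).trans ?_
    refine Real.rpow_le_rpow (japaneseBracket_pos ξ).le ?_ (abs_nonneg r)
    have := japaneseBracket_mul_le hκ (ξ / κ)
    rwa [mul_div_cancel₀ _ hκ.ne'] at this
  refine (mul_le_mul_of_nonneg_right h1 (norm_nonneg _)).trans ?_
  rw [mul_assoc]
  exact mul_le_mul_of_nonneg_left (h _) (by positivity)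

lemma RapidDecay.integrable_rpow {F : ℝ → ℂ} (hF : RapidDecay F) (a : ℝ) {b : ℝ} (hb : 0 < b) :
    Integrable fun ξ => japaneseBracket ξ ^ a * ‖F ξ‖ ^ b := by
  obtain ⟨C, hC, h⟩ := hF.decay ((a + 2) / b)
  refine ((integrable_japaneseBracket_rpow (r := -2) (by norm_num)).const_mul (C ^ b)).mono'
    (((continuous_japaneseBracket_rpow a).mul
      (hF.continuous.norm.rpow_const fun _ => Or.inr hb.le)).aestronglyMeasurable)
    (Eventually.of_forall fun ξ => ?_)
  have hpos := japaneseBracket_pos ξ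
  rw [Real.norm_of_nonneg (by positivity)]
  have h1 := Real.rpow_le_rpow (by positivity) (h ξ) hb.le
  rw [Real.mul_rpow (by positivity) (norm_nonneg _), ← Real.rpow_mul hpos.le,
    div_mul_cancel₀ _ hb.ne'] at h1
  have h2 : japaneseBracket ξ ^ a
      = japaneseBracket ξ ^ (a + 2) * japaneseBracket ξ ^ (-2 : ℝ) := by
    rw [← Real.rpow_add hpos]; congr 1; ring
  rw [h2, mul_right_comm]
  exact mul_le_mul_of_nonneg_right h1 (by positivity)

lemma RapidDecay.integrable_pow {F : ℝ → ℂ} (hF : RapidDecay F) (a : ℝ) {b : ℕ} (hb : 0 < b) :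
    Integrable fun ξ => japaneseBracket ξ ^ a * ‖F ξ‖ ^ b := by
  simpa using hF.integrable_rpow a (b := b) (by exact_mod_cast hb)

lemma RapidDecay.integrable {F : ℝ → ℂ} (hF : RapidDecay F) (a : ℝ) :
    Integrable fun ξ => ((japaneseBracket ξ ^ a : ℝ) : ℂ) * F ξ := by
  refine (hF.integrable_pow a (b := 1) one_pos).mono
    ((Complex.continuous_ofReal.comp (continuous_japaneseBracket_rpow a)).mul
      hF.continuous).aestronglyMeasurable (Eventually.of_forall fun ξ => ?_)
  simp

lemma rapidDecay_sechHat : RapidDecay sechHat := ⟨continuous_sechHat, exists_sechHat_decay⟩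

end RapidDecay

/-! ### Moments of a rescaled profile. -/

section Scaling

/-- The bound on `κ` keeps frequencies bounded, so after rescaling the weight is controlled
independently of `κ`; any `s` of either sign is then harmless. -/
lemma japaneseBracket_scale_rpow_le {κ : ℝ} (hκ : 0 < κ) (hκ2 : κ ≤ 2) (a η : ℝ) :
    japaneseBracket (κ * η) ^ a ≤ (3 * japaneseBracket η) ^ |a| := by
  have h1 := japaneseBracket_pos η
  refine (Real.rpow_le_rpow_of_exponent_le (one_le_japaneseBracket _) (le_abs_self a)).trans ?_
  refine Real.rpow_le_rpow (japaneseBracket_pos _).le ?_ (abs_nonneg a)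
  exact (japaneseBracket_mul_le hκ η).trans (mul_le_mul_of_nonneg_right (by linarith) h1.le)

lemma le_japaneseBracket_scale_rpow {κ : ℝ} (hκ : 0 < κ) (hκ2 : κ ≤ 2) (a η : ℝ) :
    (3 * japaneseBracket η) ^ (-|a|) ≤ japaneseBracket (κ * η) ^ a := by
  have h1 := japaneseBracket_pos η
  have h2 := japaneseBracket_pos (κ * η)
  have h3 := japaneseBracket_scale_rpow_le hκ hκ2 (-a) η
  rw [abs_neg, Real.rpow_neg h2.le] at h3
  rw [Real.rpow_neg (by positivity)]
  exact inv_le_of_inv_le₀ (by positivity) h3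

/-- Weighted `L^b` moments of the rescaled soliton profile are comparable to the scale. -/
lemma exists_sechHat_moment_bounds (a : ℝ) {b : ℝ} (hb : 0 < b) :
    ∃ c C : ℝ, 0 < c ∧ 0 < C ∧ ∀ κ, 0 < κ → κ ≤ 2 →
      c * κ ≤ ∫ ξ, japaneseBracket ξ ^ a * ‖sechHat (ξ / κ)‖ ^ b ∧
      ∫ ξ, japaneseBracket ξ ^ a * ‖sechHat (ξ / κ)‖ ^ b ≤ C * κ := by
  have hint : ∀ r : ℝ, Integrable fun η => (3 * japaneseBracket η) ^ r * ‖sechHat η‖ ^ b := by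
    intro r
    refine ((rapidDecay_sechHat.integrable_rpow r hb).const_mul ((3 : ℝ) ^ r)).congr
      (Eventually.of_forall fun η => ?_)
    simp only
    rw [Real.mul_rpow (by norm_num) (japaneseBracket_pos η).le, mul_assoc]
  have hpos : ∀ r : ℝ, 0 < ∫ η, (3 * japaneseBracket η) ^ r * ‖sechHat η‖ ^ b := by
    intro r
    refine integral_pos_of_integrable_nonneg_nonzero (x := 0) ?_ (hint r) (fun η => ?_) ?_
    · refine Continuous.mul ?_ (continuous_sechHat.norm.rpow_const fun _ => Or.inr hb.le)
      exact (continuous_const.mul continuous_japaneseBracket).rpow_const fun η =>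
        Or.inl (mul_pos three_pos (japaneseBracket_pos η)).ne'
    · have := japaneseBracket_pos η
      simp only [Pi.zero_apply]
      positivity
    · have := japaneseBracket_pos 0
      have := norm_pos_iff.2 sechHat_zero_ne
      positivity
  refine ⟨_, _, hpos (-|a|), hpos |a|, fun κ hκ hκ2 => ?_⟩
  have hchange : ∫ ξ, japaneseBracket ξ ^ a * ‖sechHat (ξ / κ)‖ ^ b
      = (∫ η, japaneseBracket (κ * η) ^ a * ‖sechHat η‖ ^ b) * κ := by
    have h := Measure.integral_comp_mul_left
      (fun ξ => japaneseBracket ξ ^ a * ‖sechHat (ξ / κ)‖ ^ b) κ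
    simp only [mul_div_cancel_left₀ _ hκ.ne', abs_of_pos (inv_pos.2 hκ), smul_eq_mul] at h
    rw [h]
    field_simp
  have hint' : Integrable fun η => japaneseBracket (κ * η) ^ a * ‖sechHat η‖ ^ b := by
    have h := ((rapidDecay_sechHat.comp_div hκ).integrable_rpow a hb).comp_mul_left' hκ.ne'
    simpa only [mul_div_cancel_left₀ _ hκ.ne'] using h
  rw [hchange]
  constructor
  · refine mul_le_mul_of_nonneg_right (integral_mono (hint _) hint' fun η => ?_) hκ.le
    exact mul_le_mul_of_nonneg_right (le_japaneseBracket_scale_rpow hκ hκ2 a η) (by positivity)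
  · refine mul_le_mul_of_nonneg_right (integral_mono hint' (hint _) fun η => ?_) hκ.le
    exact mul_le_mul_of_nonneg_right (japaneseBracket_scale_rpow_le hκ hκ2 a η) (by positivity)

end Scaling

/-! ### Riemann–Lebesgue for finite oscillatory sums. -/

section Oscillation

lemma tendsto_integral_exp_mul {h : ℝ → ℂ} {α β : ℝ} (hα : α ≠ 0) :
    Tendsto (fun t : ℝ => ∫ ξ : ℝ, Complex.exp (-(I * ((α * t + β : ℝ) : ℂ) * (ξ : ℂ))) * h ξ)
      atTop (𝓝 0) := by
  have h1 := Real.tendsto_integral_exp_smul_cocompact h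
  have h2 : Tendsto (fun t : ℝ => (α * t + β) / (2 * Real.pi)) atTop (cocompact ℝ) := by
    rw [cocompact_eq_atBot_atTop]
    rcases hα.lt_or_gt with h | h
    · exact ((tendsto_atBot_add_const_right _ β (tendsto_id.const_mul_atTop_of_neg h)).atBot_div_const
        (by positivity)).mono_right le_sup_left
    · exact ((tendsto_atTop_add_const_right _ β (tendsto_id.const_mul_atTop h)).atTop_div_const
        (by positivity)).mono_right le_sup_right
  refine (h1.comp h2).congr fun t => ?_
  refine integral_congr_ae (Eventually.of_forall fun ξ => ?_)
  simp only [Circle.smul_def, Real.fourierChar_apply, smul_eq_mul]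
  congr 2
  push_cast
  have : (Real.pi : ℂ) ≠ 0 := by exact_mod_cast Real.pi_ne_zero
  field_simp

/-- In the large-time limit only the resonant terms of an oscillatory sum survive. -/
lemma tendsto_integral_sum_exp_mul {σ : Type*} [Fintype σ] {h : σ → ℝ → ℂ}
    (hh : ∀ q, Integrable (h q)) (α β : σ → ℝ) :
    Tendsto (fun t : ℝ => ∫ ξ : ℝ, ∑ q,
        Complex.exp (-(I * ((α q * t + β q : ℝ) : ℂ) * (ξ : ℂ))) * h q ξ) atTop
      (𝓝 (∑ q with α q = 0, ∫ ξ : ℝ, Complex.exp (-(I * (β q : ℂ) * (ξ : ℂ))) * h q ξ)) := by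
  have hint : ∀ (θ : ℝ) q, Integrable fun ξ : ℝ => Complex.exp (-(I * (θ : ℂ) * (ξ : ℂ))) * h q ξ :=
    fun θ q => (hh q).bdd_mul (c := 1) (by fun_prop)
      (Eventually.of_forall fun ξ => (norm_exp_neg_I_mul θ ξ).le)
  simp only [integral_finsetSum _ fun q _ => hint _ q]
  rw [Finset.sum_filter]
  refine tendsto_finsetSum _ fun q _ => ?_
  split_ifs with hq
  · simp [hq]
  · exact tendsto_integral_exp_mul hq

end Oscillation

/-! ### Second and fourth moments of a soliton train. -/

section Train

variable {ι : Type*} [Fintype ι]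

/-- The Fourier transform of a train of solitons with scales `κ`, at time `t`. -/
noncomputable def trainHat (κ b : ι → ℝ) (t ξ : ℝ) : ℂ :=
  ∑ j, Complex.exp (-(I * ((κ j ^ 2 * t + b j : ℝ) : ℂ) * (ξ : ℂ))) * sechHat (ξ / κ j)

lemma rapidDecay_trainHat {κ : ι → ℝ} (hκ : ∀ j, 0 < κ j) (b : ι → ℝ) (t : ℝ) :
    RapidDecay (trainHat κ b t) :=
  RapidDecay.sum _ fun j _ => (rapidDecay_sechHat.comp_div (hκ j)).exp_mul _

lemma exists_norm_trainHat_le : ∃ C, 0 < C ∧ ∀ {ι : Type} [Fintype ι] (κ b : ι → ℝ) (t ξ : ℝ),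
    ‖trainHat κ b t ξ‖ ≤ C * Fintype.card ι := by
  obtain ⟨C, hC, h⟩ := rapidDecay_sechHat.bounded
  refine ⟨C + 1, by positivity, fun κ b t ξ => ?_⟩
  refine (norm_sum_le_of_le (f := fun j => _) (n := fun _ => C + 1) _ fun j _ => ?_).trans ?_
  · rw [norm_mul, norm_exp_neg_I_mul, one_mul]
    linarith [h (ξ / κ j)]
  · simp [mul_comm, mul_add]

lemma trainHat_mul_conj (κ b : ι → ℝ) (t ξ : ℝ) :
    trainHat κ b t ξ * conj (trainHat κ b t ξ) = ∑ p : ι × ι,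
      Complex.exp (-(I * (((κ p.1 ^ 2 - κ p.2 ^ 2) * t + (b p.1 - b p.2) : ℝ) : ℂ) * (ξ : ℂ)))
        * (sechHat (ξ / κ p.1) * conj (sechHat (ξ / κ p.2))) := by
  rw [trainHat, map_sum, Finset.sum_mul_sum, ← Finset.univ_product_univ, Finset.sum_product]
  refine Finset.sum_congr rfl fun i _ => Finset.sum_congr rfl fun j _ => ?_
  rw [map_mul, ← Complex.exp_conj, mul_mul_mul_comm, ← Complex.exp_add]
  congr 2
  simp only [map_neg, map_mul, Complex.conj_I, Complex.conj_ofReal]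
  push_cast
  ring

lemma trainHat_mul_conj_sq (κ b : ι → ℝ) (t ξ : ℝ) :
    (trainHat κ b t ξ * conj (trainHat κ b t ξ)) ^ 2 = ∑ q : (ι × ι) × (ι × ι),
      Complex.exp (-(I * (((κ q.1.1 ^ 2 - κ q.1.2 ^ 2 + (κ q.2.1 ^ 2 - κ q.2.2 ^ 2)) * t
          + (b q.1.1 - b q.1.2 + (b q.2.1 - b q.2.2)) : ℝ) : ℂ) * (ξ : ℂ)))
        * (sechHat (ξ / κ q.1.1) * conj (sechHat (ξ / κ q.1.2))
          * (sechHat (ξ / κ q.2.1) * conj (sechHat (ξ / κ q.2.2)))) := by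
  rw [sq, trainHat_mul_conj, Finset.sum_mul_sum, ← Finset.univ_product_univ (α := ι × ι),
    Finset.sum_product]
  refine Finset.sum_congr rfl fun i _ => Finset.sum_congr rfl fun j _ => ?_
  rw [mul_mul_mul_comm, ← Complex.exp_add]
  congr 2
  push_cast
  ring

variable {κ : ι → ℝ}

/-- The speeds `κ j ^ 2` are distinct, so only diagonal pairs are resonant. -/
lemma tendsto_trainHat_second_moment (hκ : ∀ j, 0 < κ j) (hinj : Function.Injective κ)
    (b : ι → ℝ) (a : ℝ) :
    Tendsto (fun t => ∫ ξ, japaneseBracket ξ ^ a * ‖trainHat κ b t ξ‖ ^ 2) atTop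
      (𝓝 (∑ j, ∫ ξ, japaneseBracket ξ ^ a * ‖sechHat (ξ / κ j)‖ ^ 2)) := by
  have hG : ∀ j, RapidDecay fun ξ => sechHat (ξ / κ j) := fun j =>
    rapidDecay_sechHat.comp_div (hκ j)
  have h := tendsto_integral_sum_exp_mul
    (h := fun (p : ι × ι) ξ => ((japaneseBracket ξ ^ a : ℝ) : ℂ) *
      (sechHat (ξ / κ p.1) * conj (sechHat (ξ / κ p.2))))
    (fun p => ((hG p.1).mul (hG p.2).star).integrable a)
    (fun p => κ p.1 ^ 2 - κ p.2 ^ 2) (fun p => b p.1 - b p.2)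
  have h1 : ∀ t, ∫ ξ : ℝ, ∑ p : ι × ι,
      Complex.exp (-(I * (((κ p.1 ^ 2 - κ p.2 ^ 2) * t + (b p.1 - b p.2) : ℝ) : ℂ) * (ξ : ℂ)))
        * (((japaneseBracket ξ ^ a : ℝ) : ℂ) * (sechHat (ξ / κ p.1) * conj (sechHat (ξ / κ p.2))))
      = ((∫ ξ, japaneseBracket ξ ^ a * ‖trainHat κ b t ξ‖ ^ 2 : ℝ) : ℂ) := by
    intro t
    rw [← integral_complex_ofReal]
    refine integral_congr_ae (Eventually.of_forall fun ξ => ?_)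
    simp only [mul_left_comm _ ((japaneseBracket ξ ^ a : ℝ) : ℂ)]
    rw [← Finset.mul_sum, ← trainHat_mul_conj, Complex.mul_conj, Complex.normSq_eq_norm_sq]
    push_cast
    rfl
  have h2 : (∑ p : ι × ι with κ p.1 ^ 2 - κ p.2 ^ 2 = 0, ∫ ξ : ℝ,
      Complex.exp (-(I * ((b p.1 - b p.2 : ℝ) : ℂ) * (ξ : ℂ))) *
      (((japaneseBracket ξ ^ a : ℝ) : ℂ) * (sechHat (ξ / κ p.1) * conj (sechHat (ξ / κ p.2)))))
      = ((∑ j, ∫ ξ, japaneseBracket ξ ^ a * ‖sechHat (ξ / κ j)‖ ^ 2 : ℝ) : ℂ) := by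
    symm
    push_cast
    refine Finset.sum_bij' (fun j _ => (j, j)) (fun p _ => p.1) ?_ ?_ ?_ ?_ ?_
    · simp
    · simp
    · simp
    · rintro ⟨i, j⟩ hij
      simp only [Finset.mem_filter, Finset.mem_univ, true_and, sub_eq_zero] at hij
      rw [sq_eq_sq₀ (hκ i).le (hκ j).le] at hij
      rw [hinj hij]
    · intro j _
      rw [← integral_complex_ofReal]
      refine integral_congr_ae (Eventually.of_forall fun ξ => ?_)
      simp only [sub_self, mul_zero, zero_mul, neg_zero, Complex.exp_zero,
        one_mul]
      rw [Complex.mul_conj, Complex.normSq_eq_norm_sq]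
      push_cast
      rfl
  simp only [h1] at h
  rw [h2] at h
  exact (Complex.continuous_re.tendsto _).comp h

lemma mul_mul_mul_le_pow_four (x y z w : ℝ) :
    x * y * (z * w) ≤ (x ^ 4 + y ^ 4 + z ^ 4 + w ^ 4) / 4 := by
  nlinarith [sq_nonneg (x * y - z * w), sq_nonneg (x ^ 2 - y ^ 2), sq_nonneg (z ^ 2 - w ^ 2),
    sq_nonneg (x * y + z * w)]

/-- The fourth moment of a soliton train is eventually controlled by the number of resonances. -/
lemma eventually_trainHat_fourth_moment_le (hκ : ∀ j, 0 < κ j) (b : ι → ℝ) (a : ℝ) {M ε : ℝ}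
    (hM : ∀ j, ∫ ξ, japaneseBracket ξ ^ a * ‖sechHat (ξ / κ j)‖ ^ 4 ≤ M) (hε : 0 < ε) :
    ∀ᶠ t in atTop, ∫ ξ, japaneseBracket ξ ^ a * ‖trainHat κ b t ξ‖ ^ 4
      ≤ (Finset.univ.filter fun q : (ι × ι) × (ι × ι) =>
        κ q.1.1 ^ 2 - κ q.1.2 ^ 2 + (κ q.2.1 ^ 2 - κ q.2.2 ^ 2) = 0).card * M + ε := by
  have hG : ∀ j, RapidDecay fun ξ => sechHat (ξ / κ j) := fun j =>
    rapidDecay_sechHat.comp_div (hκ j)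
  have hG4 : ∀ j, Integrable fun ξ => japaneseBracket ξ ^ a * ‖sechHat (ξ / κ j)‖ ^ 4 := fun j =>
    (hG j).integrable_pow a (by norm_num)
  have h := tendsto_integral_sum_exp_mul
    (h := fun (q : (ι × ι) × (ι × ι)) ξ => ((japaneseBracket ξ ^ a : ℝ) : ℂ) *
      (sechHat (ξ / κ q.1.1) * conj (sechHat (ξ / κ q.1.2))
          * (sechHat (ξ / κ q.2.1) * conj (sechHat (ξ / κ q.2.2)))))
    (fun q => (((hG q.1.1).mul (hG q.1.2).star).mul ((hG q.2.1).mul (hG q.2.2).star)).integrable a)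
    (fun q => κ q.1.1 ^ 2 - κ q.1.2 ^ 2 + (κ q.2.1 ^ 2 - κ q.2.2 ^ 2))
    (fun q => b q.1.1 - b q.1.2 + (b q.2.1 - b q.2.2))
  set S := ∑ q : (ι × ι) × (ι × ι) with κ q.1.1 ^ 2 - κ q.1.2 ^ 2 + (κ q.2.1 ^ 2 - κ q.2.2 ^ 2) = 0,
    ∫ ξ : ℝ, Complex.exp (-(I * ((b q.1.1 - b q.1.2 + (b q.2.1 - b q.2.2) : ℝ) : ℂ) * (ξ : ℂ))) *
      (((japaneseBracket ξ ^ a : ℝ) : ℂ) * (sechHat (ξ / κ q.1.1) * conj (sechHat (ξ / κ q.1.2))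
          * (sechHat (ξ / κ q.2.1) * conj (sechHat (ξ / κ q.2.2))))) with hS
  -- Each resonant integral is bounded by the average of four single-profile fourth moments,
  -- whatever the shifts `b`; only the number of resonances matters.
  have hSle : ‖S‖ ≤ (Finset.univ.filter fun q : (ι × ι) × (ι × ι) =>
        κ q.1.1 ^ 2 - κ q.1.2 ^ 2 + (κ q.2.1 ^ 2 - κ q.2.2 ^ 2) = 0).card * M := by
    rw [hS, ← nsmul_eq_mul]
    refine (norm_sum_le _ _).trans (Finset.sum_le_card_nsmul _ _ _ fun q _ => ?_)
    have hi := ((((hG4 q.1.1).add (hG4 q.1.2)).add (hG4 q.2.1)).add (hG4 q.2.2)).div_const 4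
    refine (norm_integral_le_of_norm_le hi (Eventually.of_forall fun ξ => ?_)).trans ?_
    · have hpos := Real.rpow_nonneg (japaneseBracket_pos ξ).le a
      simp only [norm_mul, norm_exp_neg_I_mul, one_mul, RCLike.norm_conj, Complex.norm_real,
        Real.norm_of_nonneg hpos, Pi.add_apply]
      have := mul_le_mul_of_nonneg_left (mul_mul_mul_le_pow_four ‖sechHat (ξ / κ q.1.1)‖
        ‖sechHat (ξ / κ q.1.2)‖ ‖sechHat (ξ / κ q.2.1)‖ ‖sechHat (ξ / κ q.2.2)‖) hpos
      linarith
    · rw [integral_div, integral_add' (((hG4 q.1.1).add (hG4 q.1.2)).add (hG4 q.2.1)) (hG4 q.2.2),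
        integral_add' ((hG4 q.1.1).add (hG4 q.1.2)) (hG4 q.2.1),
        integral_add' (hG4 q.1.1) (hG4 q.1.2)]
      linarith [hM q.1.1, hM q.1.2, hM q.2.1, hM q.2.2]
  have h1 : ∀ t, ∫ ξ : ℝ, ∑ q : (ι × ι) × (ι × ι),
      Complex.exp (-(I * (((κ q.1.1 ^ 2 - κ q.1.2 ^ 2 + (κ q.2.1 ^ 2 - κ q.2.2 ^ 2)) * t
          + (b q.1.1 - b q.1.2 + (b q.2.1 - b q.2.2)) : ℝ) : ℂ) * (ξ : ℂ)))
        * (((japaneseBracket ξ ^ a : ℝ) : ℂ) * (sechHat (ξ / κ q.1.1) * conj (sechHat (ξ / κ q.1.2))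
          * (sechHat (ξ / κ q.2.1) * conj (sechHat (ξ / κ q.2.2)))))
      = ((∫ ξ, japaneseBracket ξ ^ a * ‖trainHat κ b t ξ‖ ^ 4 : ℝ) : ℂ) := by
    intro t
    rw [← integral_complex_ofReal]
    refine integral_congr_ae (Eventually.of_forall fun ξ => ?_)
    simp only [mul_left_comm _ ((japaneseBracket ξ ^ a : ℝ) : ℂ)]
    rw [← Finset.mul_sum, ← trainHat_mul_conj_sq, Complex.mul_conj, Complex.normSq_eq_norm_sq]
    push_cast
    ring
  simp only [h1] at h
  have h2 := (Complex.continuous_re.tendsto _).comp h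
  filter_upwards [h2.eventually_le_const (u := S.re + ε) (by linarith)] with t ht
  have h3 := (Complex.re_le_norm S).trans hSle
  simp only [Function.comp_apply, Complex.ofReal_re] at ht
  linarith

end Train

/-! ### From the multisoliton to the train in the weighted norm. -/

section LateTime

variable {ι : Type*} [Fintype ι] [DecidableEq ι] {k c : ι → ℝ}

lemma fourierHat_soliton {κ : ℝ} (hκ : 0 < κ) (t b ξ : ℝ) :
    fourierHat (fun x => κ * sech (κ * (x - κ ^ 2 * t) + b)) ξ
      = Complex.exp (-(I * ((κ ^ 2 * t + -(b / κ) : ℝ) : ℂ) * (ξ : ℂ))) * sechHat (ξ / κ) := by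
  rw [sechHat, ← fourierHat_scale sech hκ]
  congr 1
  funext x
  congr 2
  field_simp
  ring

/-- At late times the Fourier transform of a multisoliton is that of a train of solitons. -/
lemma exists_tendsto_eLpNorm_sub_trainHat (hk : ∀ i, 0 < k i) (hinj : Function.Injective k)
    (hc : ∀ i, 0 < c i) (s : ℝ) {p : ℝ} (hp : 1 ≤ p) :
    ∃ b : ι → ℝ, Tendsto (fun t => eLpNorm (fun ξ => ((japaneseBracket ξ ^ s : ℝ) : ℂ) *
        (fourierHat (multisoliton k c t) ξ - trainHat (fun j => 2 * k j) b t ξ))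
        (ENNReal.ofReal p) volume) atTop (𝓝 0) := by
  obtain ⟨d, hd⟩ := exists_tendsto_sum_solitons hk hinj hc
  set κ : ι → ℝ := fun j => 2 * k j with hκdef
  have hκ : ∀ j, 0 < κ j := fun j => by simp only [hκdef]; linarith [hk j]
  refine ⟨fun j => -(d j / κ j), ?_⟩
  set b : ι → ℝ := fun j => -(d j / κ j) with hb
  set δ := fun t => ∫ x, |multisoliton k c t x
    - ∑ j, 2 * k j * sech (2 * k j * (x - 4 * k j ^ 2 * t) + d j)| with hδ
  set D := fun t ξ => fourierHat (multisoliton k c t) ξ - trainHat κ b t ξ with hD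
  have hDle : ∀ t ξ, ‖D t ξ‖ ≤ δ t := by
    intro t ξ
    have hi : ∀ j ∈ Finset.univ, Integrable fun x => κ j * sech (κ j * (x - κ j ^ 2 * t) + d j) := by
      intro j _
      have h := ((integrable_sech.comp_add_right (d j)).comp_mul_left'
        (hκ j).ne').comp_sub_right (κ j ^ 2 * t)
      exact h.const_mul (κ j)
    have h1 : D t ξ = fourierHat (fun x => multisoliton k c t x
        - ∑ j, 2 * k j * sech (2 * k j * (x - 4 * k j ^ 2 * t) + d j)) ξ := by
      have h2 : (fun x => multisoliton k c t x
          - ∑ j, 2 * k j * sech (2 * k j * (x - 4 * k j ^ 2 * t) + d j))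
          = fun x => multisoliton k c t x
          - ∑ j, κ j * sech (κ j * (x - κ j ^ 2 * t) + d j) := by
        funext x
        simp only [hκdef, mul_pow]
        norm_num
      rw [h2, fourierHat_sub (integrable_multisoliton hk hinj hc t) (integrable_finsetSum _ hi),
        fourierHat_sum _ hi]
      simp only [hD, trainHat, fourierHat_soliton (hκ _), hb]
    rw [h1]
    exact norm_fourierHat_le _ _
  -- The weight is doubled to take a geometric mean: the decay bound times the sup bound `δ t` (from
  -- `L¹` convergence) gives `⟨ξ⟩^(s+2) ‖D‖ ≤ √((C₁ + C₂) δ t)`. The two extra powers leave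
  -- `⟨ξ⟩^(-2)`, which lies in `L^p` for `p ≥ 1`.
  obtain ⟨C₁, hC₁, h₁⟩ := exists_multisoliton_fourier_decay hk hinj hc (2 * (s + 2))
  obtain ⟨C₂, hC₂, h₂⟩ : ∃ C, 0 ≤ C ∧ ∀ t ξ,
      japaneseBracket ξ ^ (2 * (s + 2)) * ‖trainHat κ b t ξ‖ ≤ C := by
    choose C hC h using fun j => (rapidDecay_sechHat.comp_div (hκ j)).decay (2 * (s + 2))
    refine ⟨∑ j, C j, Finset.sum_nonneg fun j _ => hC j, fun t ξ => ?_⟩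
    refine (mul_le_mul_of_nonneg_left (norm_sum_le _ _)
      (Real.rpow_nonneg (japaneseBracket_pos ξ).le _)).trans ?_
    rw [Finset.mul_sum]
    refine Finset.sum_le_sum fun j _ => ?_
    rw [norm_mul, norm_exp_neg_I_mul, one_mul]
    exact h j ξ
  have hpt : ∀ t ξ, ‖((japaneseBracket ξ ^ s : ℝ) : ℂ) * D t ξ‖
      ≤ Real.sqrt ((C₁ + C₂) * δ t) * ‖japaneseBracket ξ ^ (-2 : ℝ)‖ := by
    intro t ξ
    have hpos := japaneseBracket_pos ξ
    have hδ0 : 0 ≤ δ t := (norm_nonneg _).trans (hDle t ξ)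
    have h3 : japaneseBracket ξ ^ (2 * (s + 2)) * ‖D t ξ‖ ≤ C₁ + C₂ := by
      refine (mul_le_mul_of_nonneg_left (norm_sub_le _ _) (by positivity)).trans ?_
      rw [mul_add]
      exact add_le_add (h₁ t ξ) (h₂ t ξ)
    have h4 : japaneseBracket ξ ^ (s + 2) * ‖D t ξ‖ ≤ Real.sqrt ((C₁ + C₂) * δ t) := by
      refine Real.le_sqrt_of_sq_le ?_
      have h5 : (japaneseBracket ξ ^ (s + 2) * ‖D t ξ‖) ^ 2
          = (japaneseBracket ξ ^ (2 * (s + 2)) * ‖D t ξ‖) * ‖D t ξ‖ := by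
        rw [mul_pow, two_mul, Real.rpow_add hpos (s + 2) (s + 2)]; ring
      rw [h5]
      exact mul_le_mul h3 (hDle t ξ) (norm_nonneg _) (by positivity)
    have h6 : japaneseBracket ξ ^ s
        = japaneseBracket ξ ^ (s + 2) * japaneseBracket ξ ^ (-2 : ℝ) := by
      rw [← Real.rpow_add hpos]; congr 1; ring
    rw [norm_mul, Complex.norm_real, Real.norm_of_nonneg (by positivity),
      Real.norm_of_nonneg (by positivity), h6, mul_right_comm]
    exact mul_le_mul_of_nonneg_right h4 (by positivity)
  have hfin : eLpNorm (fun ξ => japaneseBracket ξ ^ (-2 : ℝ)) (ENNReal.ofReal p) volume ≠ ∞ := by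
    have h0 : ENNReal.ofReal p ≠ 0 := by simp; linarith
    refine ((integrable_norm_rpow_iff (continuous_japaneseBracket_rpow _).aestronglyMeasurable
      h0 ENNReal.ofReal_ne_top).1 ?_).eLpNorm_ne_top
    have := integrable_japaneseBracket_rpow (r := -2 * p) (by linarith)
    refine this.congr (Eventually.of_forall fun ξ => ?_)
    have hpos := japaneseBracket_pos ξ
    simp only
    rw [ENNReal.toReal_ofReal (by linarith), Real.norm_of_nonneg (by positivity),
      ← Real.rpow_mul hpos.le]
  have hlim : Tendsto (fun t => ENNReal.ofReal (Real.sqrt ((C₁ + C₂) * δ t)) *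
      eLpNorm (fun ξ => japaneseBracket ξ ^ (-2 : ℝ)) (ENNReal.ofReal p) volume) atTop (𝓝 0) := by
    have h7 : Tendsto (fun t => Real.sqrt ((C₁ + C₂) * δ t)) atTop (𝓝 0) := by
      have := (hd.const_mul (C₁ + C₂)).sqrt
      simpa using this
    have h8 := ENNReal.Tendsto.mul_const (b := eLpNorm (fun ξ => japaneseBracket ξ ^ (-2 : ℝ))
      (ENNReal.ofReal p) volume) (ENNReal.tendsto_ofReal h7) (Or.inr hfin)
    simpa using h8
  exact tendsto_of_tendsto_of_tendsto_of_le_of_le tendsto_const_nhds hlim (fun t => zero_le)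
    fun t => eLpNorm_le_mul_eLpNorm_of_ae_le_mul (Eventually.of_forall (hpt t)) _

end LateTime

/-! ### Counting four-soliton resonances. -/

section Resonances

/-- The lattice points under the hyperbola `x y ≤ L`. -/
def hyperbolaPoints (L : ℕ) : Finset (ℕ × ℕ) :=
  (Finset.Icc 1 L ×ˢ Finset.Icc 1 L).filter fun z => z.1 * z.2 ≤ L

lemma mem_hyperbolaPoints {L x y : ℕ} (hx : 0 < x) (hy : 0 < y) (h : x * y ≤ L) :
    (x, y) ∈ hyperbolaPoints L := by
  simp only [hyperbolaPoints, Finset.mem_filter, Finset.mem_product, Finset.mem_Icc]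
  exact ⟨⟨⟨hx, (Nat.le_mul_of_pos_right x hy).trans h⟩,
    ⟨hy, (Nat.le_mul_of_pos_left y hx).trans h⟩⟩, h⟩

/-- The count is at most `L` times a harmonic sum. With `log L ≤ 4 L^(1/4)` the harmonic sum is at
most `(1 + 4) L^(1/4)`; so small an exponent suffices for the final gain. -/
lemma card_hyperbolaPoints_le {L : ℕ} (hL : 0 < L) :
    ((hyperbolaPoints L).card : ℝ) ≤ 5 * (L : ℝ) ^ (5 / 4 : ℝ) := by
  have hL1 : (1 : ℝ) ≤ L := by exact_mod_cast hL
  have h1 : (hyperbolaPoints L).card ≤ ∑ x ∈ Finset.Icc 1 L, L / x := by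
    rw [hyperbolaPoints, Finset.card_filter, Finset.sum_product]
    refine Finset.sum_le_sum fun x hx => ?_
    have hx1 : 0 < x := (Finset.mem_Icc.1 hx).1
    rw [← Finset.card_filter]
    refine (Finset.card_le_card (t := Finset.Icc 1 (L / x)) fun y hy => ?_).trans (by simp)
    simp only [Finset.mem_filter, Finset.mem_Icc] at hy ⊢
    exact ⟨hy.1.1, (Nat.le_div_iff_mul_le hx1).2 (by rw [mul_comm]; exact hy.2)⟩
  have h2 : ((∑ x ∈ Finset.Icc 1 L, L / x : ℕ) : ℝ) ≤ L * (harmonic L : ℝ) := by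
    rw [harmonic_eq_sum_Icc]
    push_cast
    rw [Finset.mul_sum]
    refine Finset.sum_le_sum fun x _ => ?_
    rw [← div_eq_mul_inv]
    exact Nat.cast_div_le
  have h3 : (harmonic L : ℝ) ≤ 5 * (L : ℝ) ^ (1 / 4 : ℝ) := by
    have h4 := harmonic_le_one_add_log L
    have h5 := Real.log_le_rpow_div (x := L) (by positivity) (ε := 1 / 4) (by norm_num)
    have h6 := Real.one_le_rpow hL1 (z := 1 / 4) (by norm_num)
    linarith
  calc ((hyperbolaPoints L).card : ℝ) ≤ ((∑ x ∈ Finset.Icc 1 L, L / x : ℕ) : ℝ) := by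
        exact_mod_cast h1
    _ ≤ L * (5 * (L : ℝ) ^ (1 / 4 : ℝ)) := h2.trans (by gcongr)
    _ = 5 * (L : ℝ) ^ (5 / 4 : ℝ) := by
        rw [show (5 / 4 : ℝ) = 1 + 1 / 4 by norm_num, Real.rpow_add (by positivity),
          Real.rpow_one]
        ring

/-- Factorization pattern of the solutions of `e f = e' f'`. -/
lemma exists_four_number {e f e' f' : ℕ} (he : 0 < e) (h : e * f = e' * f') :
    ∃ x y z w : ℕ, e = x * y ∧ f = z * w ∧ e' = x * z ∧ f' = y * w := by
  obtain ⟨y, z, hyz, hy, hz⟩ := Nat.exists_coprime e e'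
  set x := Nat.gcd e e' with hx
  have hx0 : 0 < x := Nat.gcd_pos_of_pos_left _ he
  have h1 : y * f = z * f' := by
    refine Nat.eq_of_mul_eq_mul_left hx0 ?_
    rw [hy, hz] at h
    linarith
  have hy0 : 0 < y := Nat.pos_of_ne_zero (by rintro rfl; omega)
  obtain ⟨w, hw⟩ : y ∣ f' := hyz.dvd_of_dvd_mul_left (h1 ▸ dvd_mul_right y f)
  refine ⟨x, y, z, w, by rw [mul_comm]; exact hy, ?_, by rw [mul_comm]; exact hz, hw⟩
  refine Nat.eq_of_mul_eq_mul_left hy0 ?_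
  rw [h1, hw]; ring

variable {N : ℕ}

/-- After factoring the differences of odd squares, the resonance reads `(a - b)(a + b + 1) = (d -
c)(d + c + 1)`. The four-number pattern encodes it by two points under a hyperbola, from which all
four indices can be recovered. -/
lemma exists_resonance_factorization {a b c d : Fin N} (hab : b < a)
    (h : (2 * (a : ℤ) + 1) ^ 2 - (2 * (b : ℤ) + 1) ^ 2
      + ((2 * (c : ℤ) + 1) ^ 2 - (2 * (d : ℤ) + 1) ^ 2) = 0) :
    ∃ t ∈ hyperbolaPoints (4 * N) ×ˢ hyperbolaPoints (4 * N),
      (a : ℕ) = b + t.1.1 * t.1.2 ∧ (a : ℕ) + b + 1 = t.2.1 * t.2.2 ∧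
      (d : ℕ) = c + t.1.1 * t.2.1 ∧ (c : ℕ) + d + 1 = t.1.2 * t.2.2 := by
  have ha := a.2
  have hd := d.2
  have hc := c.2
  have hab' : (b : ℕ) < a := hab
  have h1 : ((a : ℤ) - b) * (a + b + 1) = (d - c) * (c + d + 1) := by linarith
  have hcd : (c : ℕ) < d := by
    have : 0 < ((d : ℤ) - c) * (c + d + 1) := by
      rw [← h1]
      exact mul_pos (by omega) (by positivity)
    have := pos_of_mul_pos_left this (by positivity)
    omega
  obtain ⟨e, he⟩ := Nat.exists_eq_add_of_lt hab'
  obtain ⟨e', he'⟩ := Nat.exists_eq_add_of_lt hcd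
  have h2 : (e + 1) * ((a : ℕ) + b + 1) = (e' + 1) * ((c : ℕ) + d + 1) := by
    zify
    rw [show ((e : ℤ) + 1) = a - b by omega, show ((e' : ℤ) + 1) = d - c by omega, h1]
  obtain ⟨x, y, z, w, hxy, hzw, hxz, hyw⟩ := exists_four_number (by omega) h2
  have hx0 : 0 < x := Nat.pos_of_ne_zero (by rintro rfl; omega)
  have hy0 : 0 < y := Nat.pos_of_ne_zero (by rintro rfl; omega)
  have hz0 : 0 < z := Nat.pos_of_ne_zero (by rintro rfl; omega)
  have hw0 : 0 < w := Nat.pos_of_ne_zero (by rintro rfl; omega)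
  exact ⟨((x, y), (z, w)), Finset.mem_product.2 ⟨mem_hyperbolaPoints hx0 hy0 (by omega),
    mem_hyperbolaPoints hz0 hw0 (by omega)⟩, by simp only; omega, by simp only; omega,
    by simp only; omega, by simp only; omega⟩

/-- The quadruples of indices at which four solitons resonate. -/
def resonances (N : ℕ) : Finset ((Fin N × Fin N) × (Fin N × Fin N)) :=
  Finset.univ.filter fun q => (2 * ((q.1.1 : ℕ) : ℤ) + 1) ^ 2 - (2 * ((q.1.2 : ℕ) : ℤ) + 1) ^ 2
      + ((2 * ((q.2.1 : ℕ) : ℤ) + 1) ^ 2 - (2 * ((q.2.2 : ℕ) : ℤ) + 1) ^ 2) = 0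

lemma card_ordered_resonances_le :
    ((resonances N).filter fun q => q.1.2 < q.1.1).card ≤ (hyperbolaPoints (4 * N)).card ^ 2 := by
  have h : ∀ q : (Fin N × Fin N) × (Fin N × Fin N),
      q ∈ (resonances N).filter (fun q => q.1.2 < q.1.1) → _ := fun q hq => by
    simp only [resonances, Finset.mem_filter, Finset.mem_univ, true_and] at hq
    exact exists_resonance_factorization hq.2 hq.1
  choose! g hg using h
  rw [sq, ← Finset.card_product]
  refine Finset.card_le_card_of_injOn g (fun q hq => (hg q hq).1) fun q hq q' hq' hqq => ?_
  obtain ⟨-, h1, h2, h3, h4⟩ := hg q hq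
  obtain ⟨-, h1', h2', h3', h4'⟩ := hg q' hq'
  rw [← hqq] at h1' h2' h3' h4'
  ext <;> omega

/-- Resonances with `a = b` force `c = d` and number at most `N ^ 2`; exchanging both pairs reduces
`a < b` to `b < a`. -/
lemma card_resonances_le_add :
    (resonances N).card ≤ N ^ 2 + 2 * (hyperbolaPoints (4 * N)).card ^ 2 := by
  have h1 : ((resonances N).filter fun q => q.1.1 < q.1.2).card
      ≤ ((resonances N).filter fun q => q.1.2 < q.1.1).card := by
    refine Finset.card_le_card_of_injOn (fun q => (q.1.swap, q.2.swap)) (fun q hq => ?_) ?_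
    · simp only [resonances, Finset.coe_filter, Finset.mem_filter, Finset.mem_univ, true_and,
        Set.mem_ofPred_eq, Prod.fst_swap, Prod.snd_swap] at hq ⊢
      exact ⟨by linarith [hq.1], hq.2⟩
    · rintro ⟨⟨a, b⟩, c, d⟩ - ⟨⟨a', b'⟩, c', d'⟩ - h
      simp only [Prod.swap_prod_mk, Prod.mk.injEq] at h ⊢
      tauto
  have h2 : ((resonances N).filter fun q => q.1.1 = q.1.2).card ≤ N ^ 2 := by
    have : (Finset.univ : Finset (Fin N × Fin N)).card = N ^ 2 := by simp [sq]
    rw [← this]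
    refine Finset.card_le_card_of_injOn (fun q => (q.1.1, q.2.1)) (fun q _ => Finset.mem_univ _) ?_
    have h3 : ∀ q ∈ (resonances N).filter fun q => q.1.1 = q.1.2, q.1.1 = q.1.2 ∧ q.2.1 = q.2.2 := by
      intro q hq
      simp only [resonances, Finset.mem_filter, Finset.mem_univ, true_and] at hq
      refine ⟨hq.2, ?_⟩
      have h4 := hq.1
      rw [hq.2, sub_self, zero_add, sub_eq_zero, sq_eq_sq₀ (by positivity) (by positivity)] at h4
      ext
      omega
    rintro ⟨⟨a, b⟩, c, d⟩ hq ⟨⟨a', b'⟩, c', d'⟩ hq' h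
    have h5 := h3 _ hq
    have h6 := h3 _ hq'
    simp only [Prod.mk.injEq] at h h5 h6 ⊢
    grind
  have h3 : (resonances N) ⊆ ((resonances N).filter fun q => q.1.1 = q.1.2)
      ∪ (((resonances N).filter fun q => q.1.1 < q.1.2)
        ∪ ((resonances N).filter fun q => q.1.2 < q.1.1)) := by
    intro q hq
    simp only [Finset.mem_union, Finset.mem_filter, hq, true_and]
    rcases lt_trichotomy q.1.1 q.1.2 with h | h | h <;> tauto
  have h4 := (Finset.card_le_card h3).trans ((Finset.card_union_le _ _).trans
    (Nat.add_le_add_left (Finset.card_union_le _ _) _))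
  have := card_ordered_resonances_le (N := N)
  omega

lemma card_resonances_le (hN : 0 < N) :
    ((resonances N).card : ℝ) ≤ 1601 * (N : ℝ) ^ (5 / 2 : ℝ) := by
  have hN1 : (1 : ℝ) ≤ N := by exact_mod_cast hN
  have h1 : ((resonances N).card : ℝ) ≤ (N : ℝ) ^ 2 + 2 * ((hyperbolaPoints (4 * N)).card : ℝ) ^ 2 := by
    exact_mod_cast card_resonances_le_add
  have h2 := pow_le_pow_left₀ (by positivity) (card_hyperbolaPoints_le (L := 4 * N) (by omega)) 2
  -- Since `25 * 4^(5/2) = 800`, the total is `2 * 800 + 1 = 1601`.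
  have h3 : (5 * ((4 * N : ℕ) : ℝ) ^ (5 / 4 : ℝ)) ^ 2 = 800 * (N : ℝ) ^ (5 / 2 : ℝ) := by
    rw [mul_pow, ← Real.rpow_natCast, ← Real.rpow_natCast, ← Real.rpow_mul (by positivity)]
    push_cast
    rw [Real.mul_rpow (by positivity) (by positivity)]
    rw [show (5 / 4 * 2 : ℝ) = 5 / 2 by norm_num, show (4 : ℝ) = 2 ^ (2 : ℝ) by norm_num,
      ← Real.rpow_mul (by norm_num), show (2 * (5 / 2) : ℝ) = ((5 : ℕ) : ℝ) by norm_num,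
      Real.rpow_natCast]
    norm_num
    ring
  have h4 : (N : ℝ) ^ 2 ≤ (N : ℝ) ^ (5 / 2 : ℝ) := by
    rw [← Real.rpow_natCast]
    exact Real.rpow_le_rpow_of_exponent_le hN1 (by norm_num)
  linarith

end Resonances

/-! ### Interpolation between the moments of the train. -/

section Moments

lemma sum_sechSpectrum (μ : ℝ) (N : ℕ) : ∑ j, 2 * sechSpectrum μ N j = μ * N ^ 2 := by
  have h : ∀ n : ℕ, ∑ i ∈ Finset.range n, 2 * (μ * ((i : ℝ) + 1 / 2)) = μ * n ^ 2 := by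
    intro n
    induction n with
    | zero => simp
    | succ n ih => rw [Finset.sum_range_succ, ih]; push_cast; ring
  rw [← h N, ← Fin.sum_univ_eq_sum_range (fun i => 2 * (μ * ((i : ℝ) + 1 / 2)))]
  rfl

lemma two_mul_sechSpectrum_le {μ : ℝ} (hμ : 0 < μ) {N : ℕ} (j : Fin N) :
    2 * sechSpectrum μ N j ≤ 2 * (μ * N) := by
  have h : ((j : ℕ) : ℝ) + 1 ≤ N := by exact_mod_cast j.2
  have : sechSpectrum μ N j = μ * ((j : ℕ) + 1 / 2) := rfl
  rw [this]
  have := mul_le_mul_of_nonneg_left h hμ.le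
  nlinarith

lemma filter_sechSpectrum_eq_resonances {μ : ℝ} (hμ : 0 < μ) (N : ℕ) :
    (Finset.univ.filter fun q : (Fin N × Fin N) × (Fin N × Fin N) =>
        (2 * sechSpectrum μ N q.1.1) ^ 2 - (2 * sechSpectrum μ N q.1.2) ^ 2
          + ((2 * sechSpectrum μ N q.2.1) ^ 2 - (2 * sechSpectrum μ N q.2.2) ^ 2) = 0)
      = resonances N := by
  refine Finset.filter_congr fun q _ => ?_
  have h : ∀ j : Fin N, (2 * sechSpectrum μ N j) ^ 2 = μ ^ 2 * (2 * ((j : ℕ) : ℝ) + 1) ^ 2 := by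
    intro j
    have : sechSpectrum μ N j = μ * ((j : ℕ) + 1 / 2) := rfl
    rw [this]; ring
  rw [h, h, h, h, ← mul_sub, ← mul_sub, ← mul_add, mul_eq_zero, or_iff_right (by positivity)]
  exact_mod_cast Iff.rfl

/-- Late-time moments of the train emerging from `μ N sech (μ x)`. -/
lemma exists_trainHat_moment_bounds (a : ℝ) :
    ∃ c C : ℝ, 0 < c ∧ 0 < C ∧ ∀ (N : ℕ) (μ : ℝ), 0 < N → 0 < μ → μ * N ≤ 1 →
      ∀ b : Fin N → ℝ, ∀ᶠ t in atTop,
        c * (μ * (N : ℝ) ^ (2 : ℝ)) ≤ ∫ ξ, japaneseBracket ξ ^ a *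
          ‖trainHat (fun j => 2 * sechSpectrum μ N j) b t ξ‖ ^ 2 ∧
        ∫ ξ, japaneseBracket ξ ^ a * ‖trainHat (fun j => 2 * sechSpectrum μ N j) b t ξ‖ ^ 2
          ≤ C * (μ * (N : ℝ) ^ (2 : ℝ)) ∧
        ∫ ξ, japaneseBracket ξ ^ a * ‖trainHat (fun j => 2 * sechSpectrum μ N j) b t ξ‖ ^ 4
          ≤ C * (μ * (N : ℝ) ^ (7 / 2 : ℝ)) := by
  obtain ⟨c₂, C₂, hc₂, hC₂, h₂⟩ := exists_sechHat_moment_bounds a (b := (2 : ℕ)) (by norm_num)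
  obtain ⟨c₄, C₄, hc₄, hC₄, h₄⟩ := exists_sechHat_moment_bounds a (b := (4 : ℕ)) (by norm_num)
  simp only [Real.rpow_natCast] at h₂ h₄
  refine ⟨c₂ / 2, 2 * C₂ + (1601 * 2 * C₄ + 1), by positivity, by positivity,
    fun N μ hN hμ hμN b => ?_⟩
  have hN0 : (0 : ℝ) < N := by exact_mod_cast hN
  have hκ : ∀ j, 0 < 2 * sechSpectrum μ N j := fun j =>
    mul_pos two_pos (sechSpectrum_pos hμ N j)
  have hκ2 : ∀ j, 2 * sechSpectrum μ N j ≤ 2 := fun j =>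
    (two_mul_sechSpectrum_le hμ j).trans (by linarith)
  have hinj : Function.Injective fun j => 2 * sechSpectrum μ N j := fun i j h =>
    sechSpectrum_injective hμ N (mul_left_cancel₀ two_ne_zero h)
  have hpos : 0 < μ * (N : ℝ) ^ (2 : ℝ) := by positivity
  have hsum : ∑ j, 2 * sechSpectrum μ N j = μ * (N : ℝ) ^ (2 : ℝ) := by
    rw [sum_sechSpectrum]; norm_cast
  have hlow : c₂ * (μ * (N : ℝ) ^ (2 : ℝ))
      ≤ ∑ j, ∫ ξ, japaneseBracket ξ ^ a * ‖sechHat (ξ / (2 * sechSpectrum μ N j))‖ ^ 2 := by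
    rw [← hsum, Finset.mul_sum]
    exact Finset.sum_le_sum fun j _ => (h₂ _ (hκ j) (hκ2 j)).1
  have hupp : ∑ j, ∫ ξ, japaneseBracket ξ ^ a * ‖sechHat (ξ / (2 * sechSpectrum μ N j))‖ ^ 2
      ≤ C₂ * (μ * (N : ℝ) ^ (2 : ℝ)) := by
    rw [← hsum, Finset.mul_sum]
    exact Finset.sum_le_sum fun j _ => (h₂ _ (hκ j) (hκ2 j)).2
  have hlim := tendsto_trainHat_second_moment hκ hinj b a
  have hM : ∀ j, ∫ ξ, japaneseBracket ξ ^ a * ‖sechHat (ξ / (2 * sechSpectrum μ N j))‖ ^ 4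
      ≤ C₄ * (2 * (μ * N)) := fun j => (h₄ _ (hκ j) (hκ2 j)).2.trans
    (mul_le_mul_of_nonneg_left (two_mul_sechSpectrum_le hμ j) hC₄.le)
  -- At most `1601 N^(5/2)` resonances, each costing `2 C₄ μ N`, give order `μ N^(7/2)`; the error
  -- `ε` is taken of the same size.
  have hfour := eventually_trainHat_fourth_moment_le hκ b a hM
    (ε := μ * (N : ℝ) ^ (7 / 2 : ℝ)) (by positivity)
  rw [filter_sechSpectrum_eq_resonances hμ N] at hfour
  have hC₂pos := mul_pos hC₂ hpos
  have hc₂pos := mul_pos hc₂ hpos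
  filter_upwards [hlim.eventually_const_le (u := c₂ / 2 * (μ * (N : ℝ) ^ (2 : ℝ))) (by linarith),
    hlim.eventually_le_const (u := 2 * C₂ * (μ * (N : ℝ) ^ (2 : ℝ))) (by linarith),
    hfour] with t h1 h2 h3
  refine ⟨h1, h2.trans ?_, h3.trans ?_⟩
  · exact mul_le_mul_of_nonneg_right (by linarith) hpos.le
  · have h5 : (N : ℝ) ^ (7 / 2 : ℝ) = (N : ℝ) ^ (5 / 2 : ℝ) * N := by
      rw [show (7 / 2 : ℝ) = 5 / 2 + 1 by norm_num, Real.rpow_add hN0, Real.rpow_one]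
    have h6 := mul_le_mul_of_nonneg_right (card_resonances_le hN)
      (by positivity : 0 ≤ C₄ * (2 * (μ * N)))
    have h7 : 0 ≤ 2 * C₂ * (μ * (N : ℝ) ^ (7 / 2 : ℝ)) := by positivity
    have h8 : 1601 * (N : ℝ) ^ (5 / 2 : ℝ) * (C₄ * (2 * (μ * N)))
        = 1601 * 2 * C₄ * (μ * (N : ℝ) ^ (7 / 2 : ℝ)) := by
      rw [h5]; ring
    linarith

lemma sq_le_rpow_add_pow_four {p A x : ℝ} (hp : p ≤ 2) (hp0 : 0 < p) (hA : 0 < A) (hx : 0 ≤ x) :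
    x ^ 2 ≤ A ^ (2 - p) * x ^ p + (A ^ 2)⁻¹ * x ^ 4 := by
  rcases le_total x A with h | h
  · have h1 : x ^ 2 = x ^ (2 - p) * x ^ p := by
      rcases hx.eq_or_lt with rfl | hx'
      · simp [Real.zero_rpow hp0.ne']
      · rw [← Real.rpow_add hx', ← Real.rpow_natCast]; norm_num
    have h2 := mul_le_mul_of_nonneg_right (Real.rpow_le_rpow hx h (by linarith : 0 ≤ 2 - p))
      (Real.rpow_nonneg hx p)
    have h3 : 0 ≤ (A ^ 2)⁻¹ * x ^ 4 := by positivity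
    linarith
  · have h1 : x ^ 2 ≤ (A ^ 2)⁻¹ * x ^ 4 := by
      rw [← div_eq_inv_mul, le_div_iff₀ (by positivity)]
      nlinarith [pow_le_pow_left₀ hA.le h 2, sq_nonneg x]
    have h2 : 0 ≤ A ^ (2 - p) * x ^ p := by positivity
    linarith

/-- Below the height `A` compare with the square, above it with the fourth power. The factor `x ^ (p
- 4)` is monotone in a direction depending on whether `p` exceeds `4`, so both endpoint values `A`
and `B` appear. -/
lemma rpow_le_sq_add_pow_four {p A B x : ℝ} (hp : 2 ≤ p) (hA : 0 < A) (hx : 0 ≤ x) (hB : x ≤ B) :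
    x ^ p ≤ A ^ (p - 2) * x ^ 2 + (A ^ (p - 4) + B ^ (p - 4)) * x ^ 4 := by
  have hB0 : 0 ≤ B := hx.trans hB
  rcases le_or_gt x A with h | h
  · have h1 : x ^ p = x ^ (p - 2) * x ^ 2 := by
      rcases hx.eq_or_lt with rfl | hx'
      · simp [Real.zero_rpow (by linarith : p ≠ 0)]
      · rw [← Real.rpow_natCast x 2, ← Real.rpow_add hx']; norm_num
    have h2 := mul_le_mul_of_nonneg_right (Real.rpow_le_rpow hx h (by linarith : 0 ≤ p - 2))
      (sq_nonneg x)
    have h3 : 0 ≤ (A ^ (p - 4) + B ^ (p - 4)) * x ^ 4 := by positivity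
    linarith
  · have hx' : 0 < x := hA.trans h
    have h1 : x ^ p = x ^ (p - 4) * x ^ 4 := by
      rw [← Real.rpow_natCast x 4, ← Real.rpow_add hx']; norm_num
    have h2 : x ^ (p - 4) ≤ A ^ (p - 4) + B ^ (p - 4) := by
      rcases le_total p 4 with h4 | h4
      · have := Real.rpow_le_rpow_of_nonpos hA h.le (by linarith : p - 4 ≤ 0)
        have := Real.rpow_nonneg hB0 (p - 4)
        linarith
      · have := Real.rpow_le_rpow hx hB (by linarith : 0 ≤ p - 4)
        have := Real.rpow_nonneg hA.le (p - 4)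
        linarith
    have h3 : 0 ≤ A ^ (p - 2) * x ^ 2 := by positivity
    have h4 := mul_le_mul_of_nonneg_right h2 (by positivity : 0 ≤ x ^ 4)
    linarith

lemma RapidDecay.moment_lower_bound {F : ℝ → ℂ} (hF : RapidDecay F) (a : ℝ) {p A : ℝ} (hp : p ≤ 2)
    (hp0 : 0 < p) (hA : 0 < A) :
    ∫ ξ, japaneseBracket ξ ^ a * ‖F ξ‖ ^ 2 ≤ A ^ (2 - p) * (∫ ξ, japaneseBracket ξ ^ a * ‖F ξ‖ ^ p)
      + (A ^ 2)⁻¹ * ∫ ξ, japaneseBracket ξ ^ a * ‖F ξ‖ ^ 4 := by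
  have h1 := (hF.integrable_rpow a hp0).const_mul (A ^ (2 - p))
  have h2 := (hF.integrable_pow a (b := 4) (by norm_num)).const_mul ((A ^ 2)⁻¹)
  rw [← integral_const_mul, ← integral_const_mul, ← integral_add h1 h2]
  refine integral_mono (hF.integrable_pow a two_pos) (h1.add h2) fun ξ => ?_
  have := mul_le_mul_of_nonneg_left (sq_le_rpow_add_pow_four hp hp0 hA (norm_nonneg (F ξ)))
    (Real.rpow_nonneg (japaneseBracket_pos ξ).le a)
  simp only
  linarith

lemma RapidDecay.moment_upper_bound {F : ℝ → ℂ} (hF : RapidDecay F) (a : ℝ) {p A B : ℝ} (hp : 2 ≤ p)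
    (hA : 0 < A) (hB : ∀ ξ, ‖F ξ‖ ≤ B) :
    ∫ ξ, japaneseBracket ξ ^ a * ‖F ξ‖ ^ p
      ≤ A ^ (p - 2) * (∫ ξ, japaneseBracket ξ ^ a * ‖F ξ‖ ^ 2)
        + (A ^ (p - 4) + B ^ (p - 4)) * ∫ ξ, japaneseBracket ξ ^ a * ‖F ξ‖ ^ 4 := by
  have h1 := (hF.integrable_pow a (b := 2) (by norm_num)).const_mul (A ^ (p - 2))
  have h2 := (hF.integrable_pow a (b := 4) (by norm_num)).const_mul (A ^ (p - 4) + B ^ (p - 4))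
  rw [← integral_const_mul, ← integral_const_mul, ← integral_add h1 h2]
  refine integral_mono (hF.integrable_rpow a (by linarith)) (h1.add h2) fun ξ => ?_
  have := mul_le_mul_of_nonneg_left (rpow_le_sq_add_pow_four hp hA (norm_nonneg (F ξ)) (hB ξ))
    (Real.rpow_nonneg (japaneseBracket_pos ξ).le a)
  simp only
  linarith

/-- For `p < 2` the late-time `p`-th moment is larger than the initial one. -/
lemma exists_trainHat_moment_ge (a : ℝ) {p : ℝ} (hp0 : 0 < p) (hp : p < 2) :
    ∃ c : ℝ, 0 < c ∧ ∀ (N : ℕ) (μ : ℝ), 0 < N → 0 < μ → μ * N ≤ 1 →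
      ∀ b : Fin N → ℝ, ∀ᶠ t in atTop, c * (μ * (N : ℝ) ^ (p + (2 - p) / 4))
        ≤ ∫ ξ, japaneseBracket ξ ^ a *
          ‖trainHat (fun j => 2 * sechSpectrum μ N j) b t ξ‖ ^ p := by
  obtain ⟨c, C, hc, hC, h⟩ := exists_trainHat_moment_bounds a
  set B := Real.sqrt (2 * C / c) with hB
  have hB0 : 0 < B := Real.sqrt_pos.2 (by positivity)
  have hB2 : B ^ 2 = 2 * C / c := Real.sq_sqrt (by positivity)
  refine ⟨c / 2 / B ^ (2 - p), by positivity, fun N μ hN hμ hμN b => ?_⟩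
  have hN0 : (0 : ℝ) < N := by exact_mod_cast hN
  have hκ : ∀ j, 0 < 2 * sechSpectrum μ N j := fun j => mul_pos two_pos (sechSpectrum_pos hμ N j)
  filter_upwards [h N μ hN hμ hμN b] with t ht
  obtain ⟨h1, -, h3⟩ := ht
  -- The height balances `N^(7/2) / A^2` against `N^2`, and `B ^ 2 = 2 C / c` makes the
  -- fourth-moment term exactly half of the lower bound for the second moment, so it can be
  -- absorbed.
  have h4 := (rapidDecay_trainHat hκ b t).moment_lower_bound a (A := B * (N : ℝ) ^ (3 / 4 : ℝ))
    hp.le hp0 (by positivity)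
  set J := ∫ ξ, japaneseBracket ξ ^ a * ‖trainHat (fun j => 2 * sechSpectrum μ N j) b t ξ‖ ^ p
  have h5 : ((B * (N : ℝ) ^ (3 / 4 : ℝ)) ^ 2)⁻¹ * (C * (μ * (N : ℝ) ^ (7 / 2 : ℝ)))
      = c / 2 * (μ * (N : ℝ) ^ (2 : ℝ)) := by
    have : (N : ℝ) ^ (7 / 2 : ℝ) = ((N : ℝ) ^ (3 / 4 : ℝ)) ^ 2 * (N : ℝ) ^ (2 : ℝ) := by
      rw [← Real.rpow_natCast, ← Real.rpow_mul hN0.le, ← Real.rpow_add hN0]; norm_num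
    rw [mul_pow, hB2, this]
    field_simp
  have h6 := mul_le_mul_of_nonneg_left h3
    (by positivity : 0 ≤ ((B * (N : ℝ) ^ (3 / 4 : ℝ)) ^ 2)⁻¹)
  have h7 : (B * (N : ℝ) ^ (3 / 4 : ℝ)) ^ (2 - p)
      = B ^ (2 - p) * (N : ℝ) ^ (3 / 4 * (2 - p)) := by
    rw [Real.mul_rpow hB0.le (by positivity), ← Real.rpow_mul hN0.le]
  have h8 : (N : ℝ) ^ (2 : ℝ) = (N : ℝ) ^ (p + (2 - p) / 4) * (N : ℝ) ^ (3 / 4 * (2 - p)) := by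
    rw [← Real.rpow_add hN0]; congr 1; ring
  rw [h7] at h4
  have h9 : c / 2 * (μ * (N : ℝ) ^ (2 : ℝ)) ≤ B ^ (2 - p) * (N : ℝ) ^ (3 / 4 * (2 - p)) * J := by
    linarith
  rw [h8] at h9
  have hX : 0 < (N : ℝ) ^ (3 / 4 * (2 - p)) := by positivity
  rw [div_mul_eq_mul_div, div_le_iff₀ (by positivity)]
  refine le_of_mul_le_mul_right ?_ hX
  linarith

/-- For `p > 2` the late-time `p`-th moment is smaller than the initial one. -/
lemma exists_trainHat_moment_le (a : ℝ) {p : ℝ} (hp : 2 < p) :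
    ∃ C : ℝ, 0 < C ∧ ∀ (N : ℕ) (μ : ℝ), 0 < N → 0 < μ → μ * N ≤ 1 →
      ∀ b : Fin N → ℝ, ∀ᶠ t in atTop, ∫ ξ, japaneseBracket ξ ^ a *
          ‖trainHat (fun j => 2 * sechSpectrum μ N j) b t ξ‖ ^ p
        ≤ C * (μ * (N : ℝ) ^ (p - min ((p - 2) / 4) (1 / 2))) := by
  obtain ⟨c, C, hc, hC, h⟩ := exists_trainHat_moment_bounds a
  obtain ⟨K, hK, hKle⟩ := exists_norm_trainHat_le
  refine ⟨C * (2 + K ^ (p - 4)), by positivity, fun N μ hN hμ hμN b => ?_⟩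
  have hN0 : (0 : ℝ) < N := by exact_mod_cast hN
  have hN1 : (1 : ℝ) ≤ N := by exact_mod_cast hN
  have hκ : ∀ j, 0 < 2 * sechSpectrum μ N j := fun j => mul_pos two_pos (sechSpectrum_pos hμ N j)
  set δ := min ((p - 2) / 4) (1 / 2) with hδ
  filter_upwards [h N μ hN hμ hμN b] with t ht
  obtain ⟨-, h2, h3⟩ := ht
  -- At height `N^(3/4)` the second- and fourth-moment terms both have exponent `p - (p - 2)/4`. The
  -- trivial bound `K N` on the train contributes `p - 4 + 7/2 = p - 1/2`, whence the minimum in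
  -- `δ`.
  have h4 := (rapidDecay_trainHat hκ b t).moment_upper_bound a (A := (N : ℝ) ^ (3 / 4 : ℝ))
    (B := K * N) hp.le (by positivity) (fun ξ => by simpa using hKle _ b t ξ)
  have hδ1 : δ ≤ (p - 2) / 4 := min_le_left _ _
  have hδ2 : δ ≤ 1 / 2 := min_le_right _ _
  have e1 : ((N : ℝ) ^ (3 / 4 : ℝ)) ^ (p - 2) * (N : ℝ) ^ (2 : ℝ) ≤ (N : ℝ) ^ (p - δ) := by
    rw [← Real.rpow_mul hN0.le, ← Real.rpow_add hN0]
    exact Real.rpow_le_rpow_of_exponent_le hN1 (by linarith)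
  have e2 : ((N : ℝ) ^ (3 / 4 : ℝ)) ^ (p - 4) * (N : ℝ) ^ (7 / 2 : ℝ) ≤ (N : ℝ) ^ (p - δ) := by
    rw [← Real.rpow_mul hN0.le, ← Real.rpow_add hN0]
    exact Real.rpow_le_rpow_of_exponent_le hN1 (by linarith)
  have e3 : (K * N) ^ (p - 4) * (N : ℝ) ^ (7 / 2 : ℝ) ≤ K ^ (p - 4) * (N : ℝ) ^ (p - δ) := by
    rw [Real.mul_rpow hK.le hN0.le, mul_assoc, ← Real.rpow_add hN0]
    exact mul_le_mul_of_nonneg_left (Real.rpow_le_rpow_of_exponent_le hN1 (by linarith))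
      (by positivity)
  refine h4.trans ((add_le_add (mul_le_mul_of_nonneg_left h2 (by positivity))
    (mul_le_mul_of_nonneg_left h3 (by positivity))).trans ?_)
  have := mul_le_mul_of_nonneg_left (add_le_add (add_le_add e1 e2) e3)
    (by positivity : 0 ≤ C * μ)
  linarith

end Moments

/-! ### Choice of scales and norm inflation. -/

section Inflation

/-- The weighted `L^p` norm of a rapidly decaying function. -/
lemma RapidDecay.eLpNorm_eq {F : ℝ → ℂ} (hF : RapidDecay F) (s : ℝ) {p : ℝ} (hp : 0 < p) :
    eLpNorm (fun ξ => ((japaneseBracket ξ ^ s : ℝ) : ℂ) * F ξ) (ENNReal.ofReal p) volume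
      = ENNReal.ofReal ((∫ ξ, japaneseBracket ξ ^ (s * p) * ‖F ξ‖ ^ p) ^ p⁻¹) := by
  have h0 : ENNReal.ofReal p ≠ 0 := by simpa using hp
  have hnorm : ∀ ξ, ‖((japaneseBracket ξ ^ s : ℝ) : ℂ) * F ξ‖ ^ p
      = japaneseBracket ξ ^ (s * p) * ‖F ξ‖ ^ p := by
    intro ξ
    have hpos := japaneseBracket_pos ξ
    rw [norm_mul, Complex.norm_real, Real.norm_of_nonneg (by positivity),
      Real.mul_rpow (by positivity) (norm_nonneg _), ← Real.rpow_mul hpos.le]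
  have hmem : MemLp (fun ξ => ((japaneseBracket ξ ^ s : ℝ) : ℂ) * F ξ) (ENNReal.ofReal p) := by
    have hcont : Continuous fun ξ => ((japaneseBracket ξ ^ s : ℝ) : ℂ) * F ξ :=
      (Complex.continuous_ofReal.comp (continuous_japaneseBracket_rpow s)).mul hF.continuous
    refine (integrable_norm_rpow_iff hcont.aestronglyMeasurable h0 ENNReal.ofReal_ne_top).1 ?_
    simp only [ENNReal.toReal_ofReal hp.le, hnorm]
    exact hF.integrable_rpow (s * p) hp
  rw [hmem.eLpNorm_eq_integral_rpow_norm h0 ENNReal.ofReal_ne_top]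
  simp only [ENNReal.toReal_ofReal hp.le, hnorm]

variable {N : ℕ} {μ : ℝ}

/-- The multisoliton solution of mKdV with initial datum `μ N sech (μ x)`. -/
noncomputable def sechSolution (N : ℕ) (hμ : 0 < μ) : ℝ → 𝓢(ℝ, ℝ) :=
  multisolitonSchwartz (sechSpectrum_pos hμ N) (sechSpectrum_injective hμ N) (sechNorming_pos hμ N)

lemma sechSolution_isSolution (hμ : 0 < μ) : IsSchwartzSolutionMKdV (sechSolution N hμ) :=
  multisolitonSchwartz_isSolution _ _ _

lemma fourierLebesgueNorm_sechSolution_zero (hN : 0 < N) (hμ : 0 < μ) (s : ℝ) {p : ℝ}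
    (hp : 0 < p) :
    fourierLebesgueNorm p s (sechSolution N hμ 0) = ENNReal.ofReal
      (((N : ℝ) ^ p * ∫ ξ, japaneseBracket ξ ^ (s * p) * ‖sechHat (ξ / μ)‖ ^ p) ^ p⁻¹) := by
  have h1 : fourierHat (sechSolution N hμ 0) = fun ξ => (N : ℂ) * sechHat (ξ / μ) := by
    funext ξ
    have h2 : (⇑(sechSolution N hμ 0) : ℝ → ℝ)
        = fun x => (N : ℝ) * (μ * sech (μ * (x - 0))) := by
      funext x
      rw [sechSolution, multisolitonSchwartz_coe, multisoliton_sech hμ hN, sub_zero]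
      ring
    rw [h2, fourierHat_const_mul, fourierHat_scale sech hμ, sechHat]
    simp
  have h3 : RapidDecay fun ξ => (N : ℂ) * sechHat (ξ / μ) :=
    (rapidDecay_sechHat.comp_div hμ).const_mul _
  rw [fourierLebesgueNorm, h1, h3.eLpNorm_eq s hp, ← integral_const_mul]
  congr 3
  funext ξ
  rw [norm_mul, Real.mul_rpow (norm_nonneg _) (norm_nonneg _), Complex.norm_natCast]
  ring

lemma exists_fourierLebesgueNorm_zero_bounds (s : ℝ) {p : ℝ} (hp : 0 < p) :
    ∃ c C : ℝ, 0 < c ∧ 0 < C ∧ ∀ (N : ℕ) (μ : ℝ) (hμ : 0 < μ), 0 < N → μ * N ≤ 1 →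
      ENNReal.ofReal ((c * (μ * (N : ℝ) ^ p)) ^ p⁻¹) ≤ fourierLebesgueNorm p s (sechSolution N hμ 0)
      ∧ fourierLebesgueNorm p s (sechSolution N hμ 0)
        ≤ ENNReal.ofReal ((C * (μ * (N : ℝ) ^ p)) ^ p⁻¹) := by
  obtain ⟨c, C, hc, hC, h⟩ := exists_sechHat_moment_bounds (s * p) hp
  refine ⟨c, C, hc, hC, fun N μ hμ hN hμN => ?_⟩
  have hN1 : (1 : ℝ) ≤ N := by exact_mod_cast hN
  obtain ⟨h1, h2⟩ := h μ hμ (by nlinarith)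
  have hNp : 0 ≤ (N : ℝ) ^ p := by positivity
  rw [fourierLebesgueNorm_sechSolution_zero hN hμ s hp]
  have hJ : 0 ≤ ∫ ξ, japaneseBracket ξ ^ (s * p) * ‖sechHat (ξ / μ)‖ ^ p :=
    (by positivity : 0 ≤ c * μ).trans h1
  refine ⟨ENNReal.ofReal_le_ofReal (Real.rpow_le_rpow (by positivity) ?_ (by positivity)),
    ENNReal.ofReal_le_ofReal (Real.rpow_le_rpow (by positivity) ?_ (by positivity))⟩
  · have := mul_le_mul_of_nonneg_left h1 hNp
    linarith
  · have := mul_le_mul_of_nonneg_left h2 hNp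
    linarith

/-- At late times the norm of `sechSolution` is, up to any prescribed error, that of a train. -/
lemma exists_tendsto_sechSolution_train (N : ℕ) (hμ : 0 < μ) (s : ℝ) {p : ℝ} (hp : 1 ≤ p) :
    ∃ b : Fin N → ℝ, ∀ ε : ℝ≥0∞, 0 < ε → ∀ᶠ t in atTop,
      fourierLebesgueNorm p s (sechSolution N hμ t) ≤ ENNReal.ofReal ((∫ ξ,
        japaneseBracket ξ ^ (s * p) *
          ‖trainHat (fun j => 2 * sechSpectrum μ N j) b t ξ‖ ^ p) ^ p⁻¹) + ε ∧
      ENNReal.ofReal ((∫ ξ, japaneseBracket ξ ^ (s * p) *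
          ‖trainHat (fun j => 2 * sechSpectrum μ N j) b t ξ‖ ^ p) ^ p⁻¹)
        ≤ fourierLebesgueNorm p s (sechSolution N hμ t) + ε := by
  have hk := sechSpectrum_pos hμ N
  have hinj := sechSpectrum_injective hμ N
  have hc := sechNorming_pos hμ N
  obtain ⟨b, hb⟩ := exists_tendsto_eLpNorm_sub_trainHat hk hinj hc s hp
  have hκ : ∀ j, 0 < 2 * sechSpectrum μ N j := fun j => mul_pos two_pos (hk j)
  refine ⟨b, fun ε hε => ?_⟩
  filter_upwards [hb.eventually_le_const hε] with t ht
  have hp1 : 1 ≤ ENNReal.ofReal p := by simpa using hp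
  have hF := rapidDecay_trainHat hκ b t
  have hω := Complex.continuous_ofReal.comp (continuous_japaneseBracket_rpow s)
  have hG : Continuous (fourierHat (multisoliton (sechSpectrum μ N) (sechNorming μ N) t)) :=
    continuous_fourierHat (integrable_multisoliton hk hinj hc t)
  rw [← hF.eLpNorm_eq s (by linarith), fourierLebesgueNorm, sechSolution, multisolitonSchwartz_coe]
  constructor
  · refine le_trans (le_of_eq ?_) ((eLpNorm_add_le (hω.mul hF.continuous).aestronglyMeasurable
      (hω.mul (hG.sub hF.continuous)).aestronglyMeasurable hp1).trans (add_le_add_right ht _))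
    congr 1
    funext ξ
    simp only [Pi.add_apply, Pi.mul_apply, Pi.sub_apply, Function.comp_apply]
    ring
  · refine le_trans (le_of_eq ?_) ((eLpNorm_sub_le (hω.mul hG).aestronglyMeasurable
      (hω.mul (hG.sub hF.continuous)).aestronglyMeasurable hp1).trans (add_le_add_right ht _))
    congr 1
    funext ξ
    simp only [Pi.sub_apply, Pi.mul_apply, Function.comp_apply]
    ring

lemma tendsto_ofReal_mul_rpow_neg {p r : ℝ} (hp : 0 < p) (hr : 0 < r) (C : ℝ) :
    Tendsto (fun n : ℕ => ENNReal.ofReal ((C * ((n + 1 : ℕ) : ℝ) ^ (-r)) ^ p⁻¹)) atTop (𝓝 0) := by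
  have h1 : Tendsto (fun n : ℕ => ((n + 1 : ℕ) : ℝ)) atTop atTop :=
    tendsto_natCast_atTop_atTop.comp (tendsto_add_atTop_nat 1)
  have h2 := (((tendsto_rpow_neg_atTop hr).comp h1).const_mul C).rpow_const
    (p := p⁻¹) (Or.inr (by positivity))
  have h3 := ENNReal.tendsto_ofReal h2
  simpa [Real.zero_rpow (inv_pos.2 hp).ne'] using h3

lemma tendsto_ofReal_mul_rpow {p r c : ℝ} (hp : 0 < p) (hr : 0 < r) (hc : 0 < c) :
    Tendsto (fun n : ℕ => ENNReal.ofReal ((c * ((n + 1 : ℕ) : ℝ) ^ r) ^ p⁻¹)) atTop (𝓝 ∞) := by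
  have h1 : Tendsto (fun n : ℕ => ((n + 1 : ℕ) : ℝ)) atTop atTop :=
    tendsto_natCast_atTop_atTop.comp (tendsto_add_atTop_nat 1)
  exact ENNReal.tendsto_ofReal_atTop.comp ((tendsto_rpow_atTop (inv_pos.2 hp)).comp
    (((tendsto_rpow_atTop hr).comp h1).const_mul_atTop hc))

/-- Scales `μ = N^{-q}` with `q ≥ 1` are admissible. -/
lemma rpow_neg_mul_self_le_one (n : ℕ) {q : ℝ} (hq : 1 ≤ q) :
    ((n + 1 : ℕ) : ℝ) ^ (-q) * ((n + 1 : ℕ) : ℝ) ≤ 1 := by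
  have h1 : (1 : ℝ) ≤ ((n + 1 : ℕ) : ℝ) := by push_cast; linarith [n.cast_nonneg (α := ℝ)]
  have h2 : ((n + 1 : ℕ) : ℝ) ^ (-q) * ((n + 1 : ℕ) : ℝ) = ((n + 1 : ℕ) : ℝ) ^ (-q + 1) := by
    rw [Real.rpow_add_one (by positivity)]
  rw [h2]
  exact Real.rpow_le_one_of_one_le_of_nonpos h1 (by linarith)

/-- For `p < 2` the norm grows as the soliton train separates. -/
lemma exists_norm_inflation_of_lt_two (s : ℝ) {p : ℝ} (hp : 1 ≤ p) (hp2 : p < 2) :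
    ∃ u : ℕ → ℝ → 𝓢(ℝ, ℝ), (∀ n, IsSchwartzSolutionMKdV (u n)) ∧
      Tendsto (fun n => fourierLebesgueNorm p s (u n 0)) atTop (𝓝 0) ∧
      Tendsto (fun n => ⨆ t : ℝ, fourierLebesgueNorm p s (u n t)) atTop (𝓝 ∞) := by
  have hp0 : 0 < p := by linarith
  -- Half of the exponent gain `(2 - p)/4`: with `μ = N^(-(p + r))` the initial moment is of order
  -- `N^(-r)` and the late one at least of order `N^r`.
  set r := (2 - p) / 8 with hr
  have hr0 : 0 < r := by rw [hr]; linarith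
  obtain ⟨_, C, _, hC, h0⟩ := exists_fourierLebesgueNorm_zero_bounds s hp0
  obtain ⟨c, hc, h1⟩ := exists_trainHat_moment_ge (s * p) hp0 hp2
  have hμ : ∀ n : ℕ, 0 < ((n + 1 : ℕ) : ℝ) ^ (-(p + r)) := fun n => by positivity
  have hμN : ∀ n : ℕ, ((n + 1 : ℕ) : ℝ) ^ (-(p + r)) * ((n + 1 : ℕ) : ℝ) ≤ 1 := fun n =>
    rpow_neg_mul_self_le_one n (by linarith)
  refine ⟨fun n => sechSolution (n + 1) (hμ n), fun n => sechSolution_isSolution _, ?_, ?_⟩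
  · refine tendsto_of_tendsto_of_tendsto_of_le_of_le tendsto_const_nhds
      (tendsto_ofReal_mul_rpow_neg hp0 hr0 C) (fun n => zero_le) fun n => ?_
    refine (h0 (n + 1) _ (hμ n) n.succ_pos (hμN n)).2.trans (le_of_eq ?_)
    rw [← Real.rpow_add (by positivity)]
    congr 4
    ring
  -- A fixed error `1` in replacing the solution by the train is harmless, as the main term
  -- diverges.
  · have hlow : ∀ n : ℕ, ENNReal.ofReal ((c * ((n + 1 : ℕ) : ℝ) ^ r) ^ p⁻¹) - 1
        ≤ ⨆ t : ℝ, fourierLebesgueNorm p s (sechSolution (n + 1) (hμ n) t) := by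
      intro n
      obtain ⟨b, hb⟩ := exists_tendsto_sechSolution_train (n + 1) (hμ n) s hp
      obtain ⟨t, ht1, ht2⟩ := ((hb 1 one_pos).and (h1 (n + 1) _ n.succ_pos (hμ n) (hμN n) b)).exists
      rw [tsub_le_iff_right]
      refine le_trans (ENNReal.ofReal_le_ofReal (Real.rpow_le_rpow (by positivity) ?_
        (by positivity))) (ht1.2.trans (add_le_add_left (le_iSup
          (fun t => fourierLebesgueNorm p s (sechSolution (n + 1) (hμ n) t)) t) 1))
      refine le_trans (le_of_eq ?_) ht2
      rw [← Real.rpow_add (by positivity)]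
      congr 2
      rw [hr]; ring
    have h2 := ENNReal.Tendsto.sub (tendsto_ofReal_mul_rpow hp0 hr0 hc)
      (tendsto_const_nhds (x := (1 : ℝ≥0∞))) (Or.inr ENNReal.one_ne_top)
    rw [ENNReal.top_sub ENNReal.one_ne_top] at h2
    exact tendsto_of_tendsto_of_tendsto_of_le_of_le h2 tendsto_const_nhds hlow fun n => le_top

/-- For `p > 2` the norm grows as the soliton train recombines. -/
lemma exists_norm_inflation_of_two_lt (s : ℝ) {p : ℝ} (hp2 : 2 < p) :
    ∃ u : ℕ → ℝ → 𝓢(ℝ, ℝ), (∀ n, IsSchwartzSolutionMKdV (u n)) ∧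
      Tendsto (fun n => fourierLebesgueNorm p s (u n 0)) atTop (𝓝 0) ∧
      Tendsto (fun n => ⨆ t : ℝ, fourierLebesgueNorm p s (u n t)) atTop (𝓝 ∞) := by
  have hp : 1 ≤ p := by linarith
  have hp0 : 0 < p := by linarith
  obtain ⟨C, hC, h1⟩ := exists_trainHat_moment_le (s * p) hp2
  set δ := min ((p - 2) / 4) (1 / 2) with hδ
  have hδ0 : 0 < δ := lt_min (by linarith) (by norm_num)
  have hδ1 : δ ≤ 1 / 2 := min_le_right _ _
  obtain ⟨c, _, hc, _, h0⟩ := exists_fourierLebesgueNorm_zero_bounds s hp0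
  -- The exponent again splits the gain `δ` evenly: order `N^(δ/2)` at the coherent time and at most
  -- `N^(-δ/2)` for the train. Here the replacement error must itself tend to `0`, so it is taken to
  -- be `1 / (n + 1)`.
  have hμ : ∀ n : ℕ, 0 < ((n + 1 : ℕ) : ℝ) ^ (-(p - δ / 2)) := fun n => by positivity
  have hμN : ∀ n : ℕ, ((n + 1 : ℕ) : ℝ) ^ (-(p - δ / 2)) * ((n + 1 : ℕ) : ℝ) ≤ 1 := fun n =>
    rpow_neg_mul_self_le_one n (by linarith)
  have hT : ∀ n : ℕ, ∃ T, fourierLebesgueNorm p s (sechSolution (n + 1) (hμ n) T)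
      ≤ ENNReal.ofReal ((C * ((n + 1 : ℕ) : ℝ) ^ (-(δ / 2))) ^ p⁻¹)
        + ((n + 1 : ℕ) : ℝ≥0∞)⁻¹ := by
    intro n
    obtain ⟨b, hb⟩ := exists_tendsto_sechSolution_train (n + 1) (hμ n) s hp
    obtain ⟨t, ht1, ht2⟩ := ((hb ((n + 1 : ℕ) : ℝ≥0∞)⁻¹
      (ENNReal.inv_pos.2 (ENNReal.natCast_ne_top _))).and
      (h1 (n + 1) _ n.succ_pos (hμ n) (hμN n) b)).exists
    refine ⟨t, ht1.1.trans (add_le_add_left (ENNReal.ofReal_le_ofReal (Real.rpow_le_rpow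
      (integral_nonneg fun ξ => ?_) (ht2.trans (le_of_eq ?_)) (by positivity))) _)⟩
    · have := japaneseBracket_pos ξ
      simp only [Pi.zero_apply]
      positivity
    · rw [← Real.rpow_add (by positivity)]
      congr 2
      ring
  choose T hT using hT
  -- The translated solution starts at the separated time `T n`; the coherent profile is reached at
  -- time `-T n`, which the supremum over all real times includes.
  refine ⟨fun n t => sechSolution (n + 1) (hμ n) (t + T n),
    fun n => (sechSolution_isSolution _).translate (T n), ?_, ?_⟩
  · have h2 := (tendsto_ofReal_mul_rpow_neg hp0 (half_pos hδ0) C).add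
      (ENNReal.tendsto_inv_nat_nhds_zero.comp (tendsto_add_atTop_nat 1))
    rw [add_zero] at h2
    refine tendsto_of_tendsto_of_tendsto_of_le_of_le tendsto_const_nhds h2 (fun n => zero_le)
      fun n => ?_
    simp only [zero_add]
    exact hT n
  · refine tendsto_of_tendsto_of_tendsto_of_le_of_le (tendsto_ofReal_mul_rpow hp0 (half_pos hδ0) hc)
      tendsto_const_nhds (fun n => ?_) fun n => le_top
    refine le_trans (le_trans (le_of_eq ?_) (h0 (n + 1) _ (hμ n) n.succ_pos (hμN n)).1)
      (le_trans (le_of_eq ?_) (le_iSup (fun t : ℝ => fourierLebesgueNorm p s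
        (sechSolution (n + 1) (hμ n) (t + T n))) (-T n)))
    · rw [← Real.rpow_add (by positivity)]
      congr 4
      ring
    · rw [neg_add_cancel]

end Inflation

theorem theorem1p1 (p s : ℝ) (hp : 1 ≤ p) (hp2 : p ≠ 2) :
    ∃ u : ℕ → ℝ → 𝓢(ℝ, ℝ),
      (∀ n, IsSchwartzSolutionMKdV (u n)) ∧
      Tendsto (fun n => fourierLebesgueNorm p s (u n 0)) atTop (𝓝 0) ∧
      Tendsto (fun n => ⨆ t : ℝ, fourierLebesgueNorm p s (u n t)) atTop (𝓝 ∞) := by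
  rcases hp2.lt_or_gt with h | h
  · exact exists_norm_inflation_of_lt_two s hp h
  · exact exists_norm_inflation_of_two_lt s h
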